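/- **Setting.** A right tensor $C^*$-precategory $\mathcal T$ consists of complex Banach spaces $\mathcal T(m,n)$ ($m,n\in\mathbb N=\{0,1,2,\dots\}$; arrows from $m$ to $n$), an associative bilinear composition with $\|ab\|\le\|a\|\|b\|$, an antilinear involution $*:\mathcal T(m,n)\to\mathcal T(n,m)$ with $(ab)^*=b^*a^*$, $\|a^*a\|=\|a\|^2$ and $a^*a\ge 0$ in the $C^*$-algebra $\mathcal T(m,m)$, and linear maps $\otimes 1:\mathcal T(m,n)\to\mathcal T(m+1,n+1)$ preserving composition and involution. An ideal is a family of closed subspaces $\mathcal K(m,n)\subset \mathcal T(m,n)$ absorbing composition with arrows of $\mathcal T$ on both sides; sums, intersections and inclusions are taken entrywise. Put $J(\mathcal K)=\{a\in\mathcal K: a\otimes 1\in\mathcal K\}$; $\ker\otimes 1=\{a: a\otimes 1=0\}$; $\mathcal I^\perp$ is the ideal whose diagonal spaces are the annihilators of $\mathcal I(m,m)$ in $\mathcal T(m,m)$. An ideal $\mathcal N$ is invariant if $\mathcal N\otimes 1\subset\mathcal N$, and $\mathcal J$-saturated if $a\in\mathcal J$, $a\otimes 1\in\mathcal N$ imply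 $a\in\mathcal N$. $\mathrm{Lat}_{\mathcal J}(\mathcal K)$ is the set of ideals $\mathcal K\cap\mathcal N$ with $\mathcal N$ an invariant $\mathcal J$-saturated ideal in $\mathcal T$, ordered by inclusion. $\mathcal K$ admits a transfer action if there are maps $\mathcal L:\mathcal K(n+1,m+1)\to\mathcal K(n,m)$ with $\mathcal L(a)\otimes 1=a$ and $\mathcal L(a(b\otimes 1))=\mathcal L(a)b$ for $a\in\mathcal K(n+1,m+1)$, $b\in\mathcal K(k,n)$. Let $\mathcal K,\mathcal J$ be ideals in $\mathcal T$ with $\mathcal J\subset J(\mathcal K)$. A right tensor representation of $\mathcal K$ in a $C^*$-algebra $B$ is a family of linear maps $\pi_{nm}:\mathcal K(m,n)\to B$ preserving composition and involution with $\pi_{nm}(a)\pi_{m+k,l}(b)=\pi_{n+k,l}((a\otimes 1^k)b)$; it is coisometric on $\mathcal J$ if $\pi_{nm}(a)=\pi_{n+1,m+1}(a\otimes 1)$ for $a\in\mathcal J(m,n)$. $\mathcal O_{\mathcal T}(\mathcal K,\mathcal J)$ is the universal $C^*$-algebra generated by a right tensor representation $i$ of $\mathcal K$ coisometric on $\mathcal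 J$, with gauge action $\gamma_z(i_{nm}(a))=z^{m-n}i_{nm}(a)$, $z\in S^1$; $\mathrm{Lat}(\mathcal O_{\mathcal T}(\mathcal K,\mathcal J))$ is the set of its gauge-invariant closed two-sided ideals, ordered by inclusion. $\mathcal M(m,n)$ denotes the space of matrices $a=(a_{ji})_{j,i\in\mathbb N}$ with $a_{ji}\in\mathcal K(i,j)$ and $a_{ji}=0$ unless $i-j=m-n$ and $i\le m$. For a matrix $x$ put $\Lambda(x)_{j+1,i+1}=x_{ji}\otimes 1$, $\Lambda(x)_{ji}=0$ if $i=0$ or $j=0$, and $S(x)=\sum_{k\ge0}\Lambda^k(x)$. Let $a\star b=a\cdot\sum_{k\ge 0}\Lambda^k(b)+\sum_{k\ge 1}\Lambda^k(a)\cdot b$, and let $\|a\|^{\mathcal J}$ be the maximum of $\|S(a)_{nm}\|$ and of the norms of $S(a)_{ji}$ in $\mathcal T(i,j)/\mathcal J(i,j)$, $i<m$, $j<n$. Then $\mathcal K_{\mathcal J}(m,n)=\mathcal M(m,n)/\|\cdot\|^{\mathcal J}$, with composition induced by $\star$ and right tensoring $\otimes_{\mathcal J}1$ induced by the inclusions $\mathcal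 M(m,n)\subset\mathcal M(m+1,n+1)$; $\mathrm{Lat}_{\mathcal K_{\mathcal J}}(\mathcal K_{\mathcal J})$ is the set of closed ideals $\mathcal N_{\mathcal J}$ in $\mathcal K_{\mathcal J}$ with $\mathcal N_{\mathcal J}\otimes_{\mathcal J}1\subset\mathcal N_{\mathcal J}$ and $(\otimes_{\mathcal J}1)^{-1}(\mathcal N_{\mathcal J})\subset\mathcal N_{\mathcal J}$, ordered by inclusion. For $\mathcal I\in\mathrm{Lat}_{\mathcal J}(\mathcal K)$ let $\mathcal N_{\mathcal J}[\mathcal I](m,n)$ be the set of classes of matrices in $\mathcal M(m,n)$ all of whose entries are in $\mathcal I$. For $a\in\mathcal M(m,n)$ put $\Psi(a)=\sum_{j,i} i_{ji}(a_{ji})\in\mathcal O_{\mathcal T}(\mathcal K,\mathcal J)$. **Theorem.** Let $\mathcal K$, $\mathcal J$ be ideals in a right tensor $C^*$-precategory $\mathcal T$ with $\mathcal J\subset J(\mathcal K)$. Suppose that (i) $\mathcal K\subset\mathcal J+\ker\otimes 1$, or (ii) $\mathcal K$ admits a transfer action and $\mathcal J=J(\mathcal K)\cap(\ker\otimes 1)^\perp$.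 Then every ideal in $\mathrm{Lat}_{\mathcal K_{\mathcal J}}(\mathcal K_{\mathcal J})$ is of the form $\mathcal N_{\mathcal J}[\mathcal K\cap\mathcal N]$ with $\mathcal K\cap\mathcal N\in\mathrm{Lat}_{\mathcal J}(\mathcal K)$. There are lattice isomorphisms (order isomorphisms for inclusion) $$\mathrm{Lat}_{\mathcal J}(\mathcal K)\cong\mathrm{Lat}_{\mathcal K_{\mathcal J}}(\mathcal K_{\mathcal J})\cong\mathrm{Lat}(\mathcal O_{\mathcal T}(\mathcal K,\mathcal J)),$$ the first being $\mathcal I\mapsto\mathcal N_{\mathcal J}[\mathcal I]$ and the second sending $\mathcal N_{\mathcal J}$ to the closed linear span of $\{\Psi(a):[a]\in\mathcal N_{\mathcal J}\}$, with inverse $P\mapsto\{[a]:\Psi(a)\in P\}$. Moreover, for every gauge-invariant ideal $P$ in $\mathcal O_{\mathcal T}(\mathcal K,\mathcal J)$ there is an invariant ideal $\mathcal N$ in $\mathcal T$ such that $P$ is the closed two-sided ideal generated by $i(\mathcal K\cap\mathcal N)$ and $\mathcal O_{\mathcal T}(\mathcal K\cap\mathcal N,\mathcal J\cap\mathcal N)\cong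 P$ via the $*$-isomorphism that sends the universal image of each $a\in\mathcal K\cap\mathcal N$ to $i(a)$. -/

import Mathlib

open scoped ENNReal

universe u

namespace RightTensor

noncomputable section

/-! ### Precategories with a right tensoring, and their ideals -/

/-- Objects `0, 1, 2, …`; a normed complex vector space `Hom m n` of arrows from `m` to `n`;
a bilinear composition; a linear right tensoring `a ↦ a ⊗ 1`. These are the data needed to speak of
ideals, invariance and saturation; the axioms of a right tensor `C*`-precategory
are in `CStarPrecategory` below. -/
structure Precategory where
  Hom : ℕ → ℕ → Type u
  [normedAddCommGroup : ∀ m n, NormedAddCommGroup (Hom m n)]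
  [normedSpace : ∀ m n, NormedSpace ℂ (Hom m n)]
  comp : ∀ {l m n : ℕ}, Hom m n →ₗ[ℂ] Hom l m →ₗ[ℂ] Hom l n
  tens : ∀ {m n : ℕ}, Hom m n →ₗ[ℂ] Hom (m + 1) (n + 1)

attribute [instance] Precategory.normedAddCommGroup Precategory.normedSpace

namespace Precategory

variable (D : Precategory.{u})

/-- `a ↦ a ⊗ 1^k`. -/
def tensPow {m n : ℕ} : ∀ k : ℕ, D.Hom m n →ₗ[ℂ] D.Hom (m + k) (n + k)
  | 0 => LinearMap.id
  | k + 1 => D.tens ∘ₗ tensPow k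

/-- Closed two-sided ideals. -/
@[ext]
structure Ideal where
  carrier : ∀ m n : ℕ, Submodule ℂ (D.Hom m n)
  isClosed : ∀ m n, IsClosed (carrier m n : Set (D.Hom m n))
  comp_mem_left : ∀ {l m n : ℕ} (a : D.Hom m n) {b : D.Hom l m},
    b ∈ carrier l m → D.comp a b ∈ carrier l n
  comp_mem_right : ∀ {l m n : ℕ} {a : D.Hom m n} (b : D.Hom l m),
    a ∈ carrier m n → D.comp a b ∈ carrier l n

variable {D}

namespace Ideal

/-- Ideals are ordered by inclusion. -/
instance : PartialOrder D.Ideal :=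
  PartialOrder.lift Ideal.carrier fun _ _ h => Ideal.ext h

/-- Intersection of ideals. -/
instance : Min D.Ideal where
  min K N :=
    { carrier := fun m n => K.carrier m n ⊓ N.carrier m n
      isClosed := fun m n => (K.isClosed m n).inter (N.isClosed m n)
      comp_mem_left := fun a _ hb => ⟨K.comp_mem_left a hb.1, N.comp_mem_left a hb.2⟩
      comp_mem_right := fun b ha => ⟨K.comp_mem_right b ha.1, N.comp_mem_right b ha.2⟩ }

/-- The whole precategory as an ideal in itself. -/
instance : Top D.Ideal where
  top :=
    { carrier := fun _ _ => ⊤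
      isClosed := fun _ _ => isClosed_univ
      comp_mem_left := fun _ _ _ => Submodule.mem_top
      comp_mem_right := fun _ _ => Submodule.mem_top }

/-- `N ⊗ 1 ⊆ N`. -/
def IsInvariant (N : D.Ideal) : Prop :=
  ∀ (m n : ℕ) (a : D.Hom m n), a ∈ N.carrier m n → D.tens a ∈ N.carrier (m + 1) (n + 1)

/-- `N` is `J`-saturated: `J ∩ (⊗1)⁻¹(N) ⊆ N`. -/
def IsSaturated (N J : D.Ideal) : Prop :=
  ∀ (m n : ℕ) (a : D.Hom m n), a ∈ J.carrier m n → D.tens a ∈ N.carrier (m + 1) (n + 1) →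
    a ∈ N.carrier m n

/-- `J(K) = (⊗1)⁻¹(K) ∩ K`, as a family of subspaces. -/
def tensPreimage (K : D.Ideal) (m n : ℕ) : Submodule ℂ (D.Hom m n) :=
  (K.carrier (m + 1) (n + 1)).comap D.tens ⊓ K.carrier m n

/-- `K` admits a transfer action: maps `L : K(n+1,m+1) → K(n,m)` with `L(a) ⊗ 1 = a` and
`L(a (b ⊗ 1)) = L(a) b`. -/
def AdmitsTransferAction (K : D.Ideal) : Prop :=
  ∃ L : ∀ n m : ℕ, K.carrier (n + 1) (m + 1) → K.carrier n m,
    (∀ (n m : ℕ) (a : K.carrier (n + 1) (m + 1)), D.tens (L n m a : D.Hom n m) = a) ∧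
    ∀ (k n m : ℕ) (a : K.carrier (n + 1) (m + 1)) (b : K.carrier k n),
      (L k m ⟨D.comp (a : D.Hom (n + 1) (m + 1)) (D.tens (b : D.Hom k n)),
          K.comp_mem_right _ a.2⟩ : D.Hom k m) =
        D.comp (L n m a : D.Hom n m) (b : D.Hom k n)

end Ideal

/-- `ker ⊗1`, as a family of subspaces. -/
def kerTens (D : Precategory.{u}) (m n : ℕ) : Submodule ℂ (D.Hom m n) :=
  LinearMap.ker D.tens

/-- The annihilator `F^⊥` of a family of subspaces `F`: all arrows `a` with `a b = 0` whenever `b`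
is in `F` and composable with `a`. In a `C*`-precategory, if `F` is an ideal, this is the ideal
whose diagonal space at `m` is the annihilator of `F m m` in the `C*`-algebra `Hom m m`. -/
def annihilator (F : ∀ m n : ℕ, Submodule ℂ (D.Hom m n)) (m n : ℕ) : Submodule ℂ (D.Hom m n) where
  carrier := {a | ∀ (k : ℕ) (b : D.Hom k m), b ∈ F k m → D.comp a b = 0}
  zero_mem' := fun k b _ => by simp
  add_mem' := fun {a a'} ha ha' k b hb => by simp [ha k b hb, ha' k b hb]
  smul_mem' := fun c a ha k b hb => by simp [ha k b hb]

/-- `Lat_J(K)`: the ideals `K ∩ N`, where `N` is an invariant and `J`-saturated ideal,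
ordered by inclusion. -/
def Lat (J K : D.Ideal) : Set D.Ideal :=
  {I | ∃ N : D.Ideal, N.IsInvariant ∧ N.IsSaturated J ∧ I = K ⊓ N}

end Precategory

/-- A right tensor `C*`-precategory. The field `adj_comp_self_pos` is positivity of `a* a` in the
`C*`-algebra `Hom m m`. -/
structure CStarPrecategory extends Precategory.{u} where
  complete : ∀ m n, CompleteSpace (Hom m n)
  comp_assoc : ∀ {k l m n : ℕ} (a : Hom m n) (b : Hom l m) (c : Hom k l),
    comp (comp a b) c = comp a (comp b c)
  norm_comp_le : ∀ {l m n : ℕ} (a : Hom m n) (b : Hom l m), ‖comp a b‖ ≤ ‖a‖ * ‖b‖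
  adj : ∀ {m n : ℕ}, Hom m n →ₗ⋆[ℂ] Hom n m
  adj_adj : ∀ {m n : ℕ} (a : Hom m n), adj (adj a) = a
  adj_comp : ∀ {l m n : ℕ} (a : Hom m n) (b : Hom l m), adj (comp a b) = comp (adj b) (adj a)
  norm_adj_comp_self : ∀ {m n : ℕ} (a : Hom m n), ‖comp (adj a) a‖ = ‖a‖ ^ 2
  adj_comp_self_pos : ∀ {m n : ℕ} (a : Hom m n), ∃ b : Hom m m, comp (adj a) a = comp (adj b) b
  tens_comp : ∀ {l m n : ℕ} (a : Hom m n) (b : Hom l m),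
    tens (comp a b) = comp (tens a) (tens b)
  tens_adj : ∀ {m n : ℕ} (a : Hom m n), tens (adj a) = adj (tens a)

namespace CStarPrecategory

variable {T : CStarPrecategory.{u}}

/-- The `C*`-algebra of endomorphisms of `n`. -/
instance (n : ℕ) : NonUnitalCStarAlgebra (T.Hom n n) where
  mul a b := T.comp a b
  left_distrib a b c := map_add (T.comp a) b c
  right_distrib a b c := by change T.comp (a + b) c = T.comp a c + T.comp b c; simp
  zero_mul a := by change T.comp 0 a = 0; simp
  mul_zero a := map_zero (T.comp a)
  mul_assoc a b c := T.comp_assoc a b c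
  dist_eq := (T.normedAddCommGroup n n).dist_eq
  norm_mul_le := T.norm_comp_le
  star := T.adj
  star_involutive := T.adj_adj
  star_mul := T.adj_comp
  star_add := map_add T.adj
  complete := (T.complete n n).complete
  norm_mul_self_le a := by
    have h := T.norm_adj_comp_self a
    rw [sq] at h
    exact h.ge
  __ := T.normedSpace n n
  smul_assoc c a b := by change T.comp (c • a) b = c • T.comp a b; simp
  smul_comm c a b := by change c • T.comp a b = T.comp a (c • b); simp
  star_smul c a := by change T.adj (c • a) = _; rw [LinearMap.map_smulₛₗ]; rfl

theorem mul_def {n : ℕ} (a b : T.Hom n n) : a * b = T.comp a b := rfl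

theorem star_def {n : ℕ} (a : T.Hom n n) : star a = T.adj a := rfl

/-- An ideal in a `C*`-precategory is self-adjoint. -/
theorem adj_mem (K : T.Ideal) {m n : ℕ} {a : T.Hom m n} (ha : a ∈ K.carrier m n) :
    T.adj a ∈ K.carrier n m := by
  set x : T.Hom n n := T.comp a (T.adj a) with hx
  have hxK : x ∈ K.carrier n n := K.comp_mem_right _ ha
  have hsa : IsSelfAdjoint x := by
    change T.adj x = x
    rw [hx, T.adj_comp, T.adj_adj]
  let f : ℕ → ℝ → ℝ := fun k t => k * t ^ 2 / (1 + k * t ^ 2)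
  let h : ℕ → ℝ → ℝ := fun k t => k * t / (1 + k * t ^ 2)
  have hpos : ∀ (k : ℕ) (t : ℝ), 0 < 1 + k * t ^ 2 := fun k t => by positivity
  have hfc : ∀ k, Continuous (f k) := fun k =>
    Continuous.div (by fun_prop) (by fun_prop) fun t => (hpos k t).ne'
  have hhc : ∀ k, Continuous (h k) := fun k =>
    Continuous.div (by fun_prop) (by fun_prop) fun t => (hpos k t).ne'
  have hf0 : ∀ k, f k 0 = 0 := fun k => by simp [f]
  have hh0 : ∀ k, h k 0 = 0 := fun k => by simp [h]
  let u : ℕ → T.Hom n n := fun k => cfcₙ (f k) x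
  have huK : ∀ k, u k ∈ K.carrier n n := by
    intro k
    have h1 : u k = x * cfcₙ (h k) x := by
      have h2 : x * cfcₙ (h k) x = cfcₙ (fun t : ℝ => t) x * cfcₙ (h k) x := by
        rw [cfcₙ_id' ℝ x]
      rw [h2, ← cfcₙ_mul (fun t : ℝ => t) (h k) x (by fun_prop) rfl
        (hhc k).continuousOn (hh0 k)]
      refine cfcₙ_congr fun t _ => ?_
      simp only [f, h]
      ring
    rw [h1]
    exact K.comp_mem_right _ hxK
  have husa : ∀ k, T.adj (u k) = u k := fun k => cfcₙ_predicate (f k) x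
  have hnorm : ∀ k : ℕ, 0 < k →
      ‖T.adj a - T.comp (T.adj a) (u k)‖ ^ 2 ≤ (1 / Real.sqrt k) := by
    intro k hk
    have hk' : (0 : ℝ) < k := by exact_mod_cast hk
    rw [← T.norm_adj_comp_self]
    have e1 : T.comp (T.adj (T.adj a - T.comp (T.adj a) (u k)))
        (T.adj a - T.comp (T.adj a) (u k)) = x - x * u k - u k * x + u k * x * u k := by
      simp only [map_sub, T.adj_comp, T.adj_adj, husa, mul_def, hx, LinearMap.sub_apply,
        T.comp_assoc]
      abel
    have e2 : x - x * u k - u k * x + u k * x * u k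
        = cfcₙ (fun t : ℝ => t - t * f k t - f k t * t + f k t * t * f k t) x := by
      have c0 : ContinuousOn (f k) (quasispectrum ℝ x) := (hfc k).continuousOn
      have hf00 := hf0 k
      rw [cfcₙ_add (R := ℝ) (fun t : ℝ => t - t * f k t - f k t * t)
          (fun t : ℝ => f k t * t * f k t) x (by fun_prop) (by simp) (by fun_prop) (by simp),
        cfcₙ_sub (R := ℝ) (fun t : ℝ => t - t * f k t) (fun t : ℝ => f k t * t) x
          (by fun_prop) (by simp) (by fun_prop) (by simp),
        cfcₙ_sub (R := ℝ) (fun t : ℝ => t) (fun t : ℝ => t * f k t) x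
          (by fun_prop) rfl (by fun_prop) (by simp),
        cfcₙ_mul (R := ℝ) (fun t : ℝ => f k t * t) (f k) x (by fun_prop) (by simp)
          (by fun_prop) (by simp [hf00]),
        cfcₙ_mul (R := ℝ) (f k) (fun t : ℝ => t) x (by fun_prop) (by simp [hf00])
          (by fun_prop) rfl,
        cfcₙ_mul (R := ℝ) (fun t : ℝ => t) (f k) x (by fun_prop) rfl
          (by fun_prop) (by simp [hf00]), cfcₙ_id' ℝ x]
    rw [e1, e2]
    refine norm_cfcₙ_le fun t _ => ?_
    have e3 : t - t * f k t - f k t * t + f k t * t * f k t = t / (1 + k * t ^ 2) ^ 2 := by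
      have := (hpos k t).ne'
      simp only [f]
      field_simp
      ring
    rw [e3, Real.norm_eq_abs, abs_div, abs_of_pos (by positivity : 0 < (1 + k * t ^ 2) ^ 2)]
    have hs : 0 < Real.sqrt k := Real.sqrt_pos.2 hk'
    rw [div_le_div_iff₀ (by positivity) hs]
    have e4 : (k : ℝ) * t ^ 2 = (Real.sqrt k * |t|) ^ 2 := by
      rw [mul_pow, Real.sq_sqrt hk'.le, sq_abs]
    rw [e4]
    set y := Real.sqrt k * |t| with hy
    have hy0 : 0 ≤ y := by positivity
    nlinarith [sq_nonneg (y - 1), sq_nonneg y, sq_nonneg (y ^ 2)]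
  have hlim : Filter.Tendsto (fun k : ℕ => T.comp (T.adj a) (u k)) Filter.atTop
      (nhds (T.adj a)) := by
    rw [tendsto_iff_norm_sub_tendsto_zero]
    have h1 : Filter.Tendsto (fun k : ℕ => 1 / Real.sqrt k) Filter.atTop (nhds 0) := by
      have := (Real.tendsto_sqrt_atTop.comp tendsto_natCast_atTop_atTop).inv_tendsto_atTop
      simp only [one_div]
      exact this
    have h2 : Filter.Tendsto
        (fun k : ℕ => ‖T.comp (T.adj a) (u k) - T.adj a‖ ^ 2) Filter.atTop (nhds 0) := by
      refine squeeze_zero' (Filter.Eventually.of_forall fun k => by positivity) ?_ h1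
      filter_upwards [Filter.eventually_gt_atTop 0] with k hk
      rw [norm_sub_rev]
      exact hnorm k hk
    have h3 := h2.sqrt
    simpa [Real.sqrt_sq (norm_nonneg _)] using h3
  exact (K.isClosed n m).mem_of_tendsto hlim
    (Filter.Eventually.of_forall fun k => K.comp_mem_left _ (huK k))

/-! ### Right tensor representations and the algebra `O_T(K, J)` -/

/-- A right tensor representation of the ideal `K` in the `C*`-algebra `B`. -/
structure TensorRep (K : T.Ideal) (B : Type*) [NonUnitalCStarAlgebra B] where
  toFun : ∀ m n : ℕ, K.carrier m n →ₗ[ℂ] B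
  map_adj : ∀ {m n : ℕ} (a : K.carrier m n),
    toFun n m ⟨T.adj (a : T.Hom m n), adj_mem K a.2⟩ = star (toFun m n a)
  map_comp : ∀ {l m n : ℕ} (a : K.carrier m n) (b : K.carrier l m),
    toFun l n ⟨T.comp (a : T.Hom m n) (b : T.Hom l m), K.comp_mem_left _ b.2⟩ =
      toFun m n a * toFun l m b
  map_tens : ∀ {l m n : ℕ} (k : ℕ) (a : K.carrier m n) (b : K.carrier l (m + k)),
    toFun m n a * toFun l (m + k) b =
      toFun l (n + k)
        ⟨T.comp (T.tensPow k (a : T.Hom m n)) (b : T.Hom l (m + k)), K.comp_mem_left _ b.2⟩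

namespace TensorRep

variable {K J : T.Ideal} {B : Type*} [NonUnitalCStarAlgebra B]

/-- `π` is coisometric on `J`: `π(a) = π(a ⊗ 1)` for all `a` in `J` (for which both sides are
meaningful, that is, for all `a` in `J` if `J ⊆ J(K)`). -/
def IsCoisometricOn (π : TensorRep K B) (J : T.Ideal) : Prop :=
  ∀ (m n : ℕ) (a : T.Hom m n) (ha : a ∈ K.carrier m n)
    (ha' : T.tens a ∈ K.carrier (m + 1) (n + 1)), a ∈ J.carrier m n →
      π.toFun m n ⟨a, ha⟩ = π.toFun (m + 1) (n + 1) ⟨T.tens a, ha'⟩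

/-- Representations are contractive. -/
theorem norm_apply_le (π : TensorRep K B) {m n : ℕ} (a : K.carrier m n) :
    ‖π.toFun m n a‖ ≤ ‖a‖ := by
  let S : NonUnitalStarSubalgebra ℂ (T.Hom m m) :=
    { carrier := (K.carrier m m : Set (T.Hom m m))
      add_mem' := fun h h' => (K.carrier m m).add_mem h h'
      zero_mem' := (K.carrier m m).zero_mem
      smul_mem' := fun c _ h => (K.carrier m m).smul_mem c h
      mul_mem' := fun {x y} _ h' => K.comp_mem_left x h'
      star_mem' := fun h => adj_mem K h }
  have : IsClosed (S : Set (T.Hom m m)) := K.isClosed m m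
  let φ : S →⋆ₙₐ[ℂ] B :=
    { toFun := fun x => π.toFun m m ⟨x.1, x.2⟩
      map_smul' := fun c x => (π.toFun m m).map_smul c ⟨x.1, x.2⟩
      map_zero' := (π.toFun m m).map_zero
      map_add' := fun x y => (π.toFun m m).map_add ⟨x.1, x.2⟩ ⟨y.1, y.2⟩
      map_mul' := fun x y => π.map_comp ⟨x.1, x.2⟩ ⟨y.1, y.2⟩
      map_star' := fun x => π.map_adj ⟨x.1, x.2⟩ }
  let s : S := ⟨T.comp (T.adj (a : T.Hom m n)) (a : T.Hom m n), K.comp_mem_left _ a.2⟩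
  have h1 : star (π.toFun m n a) * π.toFun m n a = φ s := by
    rw [← π.map_adj, ← π.map_comp]
    rfl
  have h2 : ‖φ s‖ ≤ ‖s‖ := NonUnitalStarAlgHom.norm_apply_le φ s
  have h3 : ‖s‖ = ‖(a : T.Hom m n)‖ ^ 2 := T.norm_adj_comp_self _
  have h4 : ‖π.toFun m n a‖ * ‖π.toFun m n a‖ ≤ ‖(a : T.Hom m n)‖ ^ 2 := by
    rw [← CStarRing.norm_star_mul_self, h1, ← h3]
    exact h2
  rw [← sq] at h4
  exact (sq_le_sq₀ (norm_nonneg _) (norm_nonneg _)).1 h4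

/-- The representation `a ↦ z^(m-n) π(a)`, `a ∈ K(m,n)`. -/
def rotate (z : Circle) (π : TensorRep K B) : TensorRep K B where
  toFun m n := ((z : ℂ) ^ ((m : ℤ) - n)) • π.toFun m n
  map_adj {m n} a := by
    have h : star ((z : ℂ) ^ ((m : ℤ) - n)) = (z : ℂ) ^ ((n : ℤ) - m) := by
      rw [star_zpow₀]
      change (starRingEnd ℂ (z : ℂ)) ^ _ = _
      rw [← Circle.coe_inv_eq_conj, Circle.coe_inv, inv_zpow', neg_sub]
    simp only [LinearMap.smul_apply, π.map_adj, star_smul, h]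
  map_comp {l m n} a b := by
    have h : (z : ℂ) ^ ((l : ℤ) - n) = (z : ℂ) ^ ((m : ℤ) - n) * (z : ℂ) ^ ((l : ℤ) - m) := by
      rw [← zpow_add₀ (Circle.coe_ne_zero z)]
      congr 1
      ring
    simp only [LinearMap.smul_apply, π.map_comp, smul_mul_smul_comm, h]
  map_tens {l m n} k a b := by
    have h : (z : ℂ) ^ ((l : ℤ) - (n + k : ℕ)) =
        (z : ℂ) ^ ((m : ℤ) - n) * (z : ℂ) ^ ((l : ℤ) - (m + k : ℕ)) := by
      rw [← zpow_add₀ (Circle.coe_ne_zero z)]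
      congr 1
      push_cast
      ring
    simp only [LinearMap.smul_apply, ← π.map_tens, smul_mul_smul_comm, h]

theorem IsCoisometricOn.rotate {π : TensorRep K B} (h : π.IsCoisometricOn J) (z : Circle) :
    (π.rotate z).IsCoisometricOn J := by
  intro m n a ha ha' haJ
  have e : ((m + 1 : ℕ) : ℤ) - (n + 1 : ℕ) = (m : ℤ) - n := by push_cast; ring
  simp only [TensorRep.rotate, LinearMap.smul_apply, h m n a ha ha' haJ, e]

end TensorRep

section Algebra

variable (K J : T.Ideal)

/-- A right tensor representation of `K`, coisometric on `J`, in some `C*`-algebra. -/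
structure CoisometricRep where
  B : Type u
  [cstar : NonUnitalCStarAlgebra B]
  rep : TensorRep K B
  coisometric : rep.IsCoisometricOn J

attribute [instance] CoisometricRep.cstar

variable {K J} in
/-- `CoisometricRep` version of `TensorRep.rotate`. -/
abbrev CoisometricRep.rotate (z : Circle) (ρ : CoisometricRep K J) : CoisometricRep K J where
  B := ρ.B
  rep := ρ.rep.rotate z
  coisometric := ρ.coisometric.rotate z

/-- The `ℓ^∞`-product of the target algebras of all right tensor representations of `K` that are
coisometric on `J`. -/
abbrev RepProduct : Type (u + 1) := lp (fun ρ : CoisometricRep K J => ρ.B) ∞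

/-- The product of all right tensor representations of `K` that are coisometric on `J`. -/
def productRep : TensorRep K (RepProduct K J) where
  toFun m n :=
    { toFun := fun a => ⟨fun ρ => ρ.rep.toFun m n a, memℓp_infty ⟨‖a‖, by
        rintro _ ⟨ρ, rfl⟩
        exact ρ.rep.norm_apply_le a⟩⟩
      map_add' := fun a b => by ext ρ; exact map_add (ρ.rep.toFun m n) a b
      map_smul' := fun c a => by ext ρ; exact map_smul (ρ.rep.toFun m n) c a }
  map_adj a := by ext ρ; exact ρ.rep.map_adj a
  map_comp a b := by ext ρ; exact ρ.rep.map_comp a b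
  map_tens k a b := by ext ρ; exact ρ.rep.map_tens k a b

/-- The `C*`-subalgebra generated by the image of the product representation. -/
def algebraO : NonUnitalStarSubalgebra ℂ (RepProduct K J) :=
  (NonUnitalStarAlgebra.adjoin ℂ
    {x | ∃ (m n : ℕ) (a : K.carrier m n), x = (productRep K J).toFun m n a}).topologicalClosure

/-- The universal `C*`-algebra `O_T(K, J)` of right tensor representations of `K` that are
coisometric on `J`. -/
abbrev O : Type (u + 1) := algebraO K J

instance isClosed_algebraO : IsClosed (algebraO K J : Set (RepProduct K J)) :=
  NonUnitalStarSubalgebra.isClosed_topologicalClosure _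

theorem productRep_mem {m n : ℕ} (a : K.carrier m n) :
    (productRep K J).toFun m n a ∈ algebraO K J :=
  NonUnitalStarSubalgebra.le_topologicalClosure _
    (NonUnitalStarAlgebra.subset_adjoin ℂ _ ⟨m, n, a, rfl⟩)

/-- The universal representation `i` of `K` in `O_T(K, J)`. -/
def univRep : TensorRep K (O K J) where
  toFun m n := LinearMap.codRestrict (algebraO K J).toNonUnitalSubalgebra.toSubmodule
    ((productRep K J).toFun m n) fun a => productRep_mem K J a
  map_adj a := Subtype.ext ((productRep K J).map_adj a)
  map_comp a b := Subtype.ext ((productRep K J).map_comp a b)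
  map_tens k a b := Subtype.ext ((productRep K J).map_tens k a b)

theorem univRep_coisometric : (univRep K J).IsCoisometricOn J := by
  intro m n a ha ha' haJ
  apply Subtype.ext
  ext ρ
  exact ρ.coisometric m n a ha ha' haJ

/-- The representation of `O_T(K, J)` to which a coisometric representation `ρ` integrates. -/
def integrate (ρ : CoisometricRep K J) : O K J →⋆ₙₐ[ℂ] ρ.B where
  toFun x := x.1 ρ
  map_smul' _ _ := rfl
  map_zero' := rfl
  map_add' _ _ := rfl
  map_mul' _ _ := rfl
  map_star' _ := rfl

theorem integrate_univRep (ρ : CoisometricRep K J) {m n : ℕ} (a : K.carrier m n) :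
    integrate K J ρ ((univRep K J).toFun m n a) = ρ.rep.toFun m n a := rfl

/-- Composition of the coordinates with `ρ ↦ z·ρ`. -/
def rotateProduct (z : Circle) : RepProduct K J →⋆ₙₐ[ℂ] RepProduct K J where
  toFun x := ⟨fun ρ => x (ρ.rotate z), memℓp_infty ⟨‖x‖, by
    rintro _ ⟨ρ, rfl⟩
    exact lp.norm_apply_le_norm ENNReal.top_ne_zero x (ρ.rotate z)⟩⟩
  map_smul' _ _ := rfl
  map_zero' := rfl
  map_add' _ _ := rfl
  map_mul' _ _ := rfl
  map_star' _ := rfl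

theorem rotateProduct_mem (z : Circle) {x : RepProduct K J} (hx : x ∈ algebraO K J) :
    rotateProduct K J z x ∈ algebraO K J := by
  have hc : Continuous (rotateProduct K J z) :=
    AddMonoidHomClass.continuous_of_bound (rotateProduct K J z) 1 fun x => by
      rw [one_mul]
      exact NonUnitalStarAlgHom.norm_apply_le _ x
  have h2 := NonUnitalStarSubalgebra.map_topologicalClosure_le
    (NonUnitalStarAlgebra.adjoin ℂ
      {x | ∃ (m n : ℕ) (a : K.carrier m n), x = (productRep K J).toFun m n a}) hc ⟨x, hx, rfl⟩
  refine NonUnitalStarSubalgebra.topologicalClosure_minimal _ ?_ (isClosed_algebraO K J) h2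
  rw [NonUnitalStarAlgHom.map_adjoin, NonUnitalStarAlgebra.adjoin_le_iff]
  rintro _ ⟨_, ⟨m, n, a, rfl⟩, rfl⟩
  have : rotateProduct K J z ((productRep K J).toFun m n a) =
      ((z : ℂ) ^ ((m : ℤ) - n)) • (productRep K J).toFun m n a := by
    ext ρ; rfl
  rw [this]
  exact (algebraO K J).smul_mem' _ (productRep_mem K J a)

/-- The gauge action of the circle on `O_T(K, J)`. -/
def gauge (z : Circle) : O K J →⋆ₙₐ[ℂ] O K J where
  toFun x := ⟨rotateProduct K J z x.1, rotateProduct_mem K J z x.2⟩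
  map_smul' _ _ := rfl
  map_zero' := rfl
  map_add' _ _ := rfl
  map_mul' _ _ := rfl
  map_star' _ := rfl

theorem gauge_univRep (z : Circle) {m n : ℕ} (a : K.carrier m n) :
    gauge K J z ((univRep K J).toFun m n a) =
      ((z : ℂ) ^ ((m : ℤ) - n)) • (univRep K J).toFun m n a := rfl

/-- Closed two-sided ideals of a `C*`-algebra. -/
def IsClosedIdeal {A : Type*} [NonUnitalCStarAlgebra A] (P : Submodule ℂ A) : Prop :=
  IsClosed (P : Set A) ∧ ∀ x, ∀ p ∈ P, x * p ∈ P ∧ p * x ∈ P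

/-- `Lat(O_T(K, J))`: the gauge-invariant closed two-sided ideals of `O_T(K, J)`, ordered by
inclusion. -/
def gaugeLat : Set (Submodule ℂ (O K J)) :=
  {P | IsClosedIdeal P ∧ ∀ z : Circle, ∀ p ∈ P, gauge K J z p ∈ P}

end Algebra

/-! ### The precategory `K_J` -/

section KJ

/-- `Λ(x)` for a matrix `x` of arrows; the entry `x i j` is an arrow from `i` to `j`. -/
def shift (x : ∀ i j : ℕ, T.Hom i j) : ∀ i j : ℕ, T.Hom i j
  | i + 1, j + 1 => T.tens (x i j)
  | 0, _ => 0
  | _ + 1, 0 => 0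

/-- `∑_{k ≥ 0} Λ^k(x)`. On the diagonal through `(i, j)` its entry at `(i, j)` is
`x i j + x (i-1) (j-1) ⊗ 1 + x (i-2) (j-2) ⊗ 1^2 + ⋯`. -/
def partialSum (x : ∀ i j : ℕ, T.Hom i j) : ∀ i j : ℕ, T.Hom i j
  | i + 1, j + 1 => x (i + 1) (j + 1) + T.tens (partialSum x i j)
  | 0, j => x 0 j
  | i + 1, 0 => x (i + 1) 0

theorem partialSum_eq (x : ∀ i j : ℕ, T.Hom i j) (i j : ℕ) :
    partialSum x i j = x i j + shift (partialSum x) i j := by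
  cases i <;> cases j <;> simp [partialSum, shift]

theorem shift_add (x y : ∀ i j : ℕ, T.Hom i j) (i j : ℕ) :
    shift (x + y) i j = shift x i j + shift y i j := by
  cases i <;> cases j <;> simp [shift]

theorem shift_smul (c : ℂ) (x : ∀ i j : ℕ, T.Hom i j) (i j : ℕ) :
    shift (c • x) i j = c • shift x i j := by
  cases i <;> cases j <;> simp [shift]

theorem partialSum_add (x y : ∀ i j : ℕ, T.Hom i j) :
    partialSum (x + y) = partialSum x + partialSum y := by
  funext i
  induction i with
  | zero => funext j; simp [partialSum]
  | succ i ih =>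
    funext j
    cases j with
    | zero => simp [partialSum]
    | succ j => simp [partialSum, ih]; abel

theorem partialSum_smul (c : ℂ) (x : ∀ i j : ℕ, T.Hom i j) :
    partialSum (c • x) = c • partialSum x := by
  funext i
  induction i with
  | zero => funext j; simp [partialSum]
  | succ i ih =>
    funext j
    cases j with
    | zero => simp [partialSum]
    | succ j => simp [partialSum, ih]

/-- The convolution product `a ⋆ b = a · ∑_{k ≥ 0} Λ^k(b) + ∑_{k ≥ 1} Λ^k(a) · b`, where `a` is in
`M(m,n)` and `b` is in `M(l,m)` (see `band`), so that in the matrix products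
the entries with middle index `k > m` do not contribute. -/
def convolution (m : ℕ) (a b : ∀ i j : ℕ, T.Hom i j) (i j : ℕ) : T.Hom i j :=
  ∑ k ∈ Finset.range (m + 1),
    (T.comp (a k j) (partialSum b i k) + T.comp (shift (partialSum a) k j) (b i k))

variable (K J : T.Ideal)

/-- `M(m,n)`: the matrices with entries in `K` that vanish off the diagonal through `(m, n)` and
beyond `(m, n)`. -/
def band (m n : ℕ) : Submodule ℂ (∀ i j : ℕ, T.Hom i j) where
  carrier := {a | (∀ i j, a i j ∈ K.carrier i j) ∧
    ∀ i j, ¬(i + n = j + m ∧ i ≤ m) → a i j = 0}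
  zero_mem' := ⟨fun i j => (K.carrier i j).zero_mem, fun _ _ _ => rfl⟩
  add_mem' := fun ha hb => ⟨fun i j => (K.carrier i j).add_mem (ha.1 i j) (hb.1 i j),
    fun i j h => by simp [ha.2 i j h, hb.2 i j h]⟩
  smul_mem' := fun c a ha => ⟨fun i j => (K.carrier i j).smul_mem c (ha.1 i j),
    fun i j h => by simp [ha.2 i j h]⟩

variable {K} in
theorem partialSum_eq_zero {m n : ℕ} {a : ∀ i j : ℕ, T.Hom i j} (ha : a ∈ band K m n) :
    ∀ i j : ℕ, i + n ≠ j + m → partialSum a i j = 0 := by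
  intro i
  induction i with
  | zero => intro j h; exact ha.2 0 j fun h' => h h'.1
  | succ i ih =>
    intro j h
    cases j with
    | zero => exact ha.2 _ _ fun h' => h h'.1
    | succ j =>
      simp only [partialSum]
      rw [ha.2 _ _ fun h' => h h'.1, ih j (by omega)]
      simp

variable {K} in
theorem shift_partialSum_eq_zero {m n : ℕ} {a : ∀ i j : ℕ, T.Hom i j} (ha : a ∈ band K m n)
    {i j : ℕ} (h : i + n ≠ j + m) : shift (partialSum a) i j = 0 := by
  have h1 := partialSum_eq a i j
  rw [partialSum_eq_zero ha i j h, ha.2 i j fun h' => h h'.1, zero_add] at h1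
  exact h1.symm

variable {K} in
/-- The partial sums of a convolution product are the products of the partial sums. -/
theorem partialSum_convolution {l m : ℕ} {a b : ∀ i j : ℕ, T.Hom i j}
    (hb : b ∈ band K l m) : ∀ i j : ℕ, i ≤ l → partialSum (convolution m a b) i j =
      ∑ k ∈ Finset.range (m + 1), T.comp (partialSum a k j) (partialSum b i k) := by
  have key : ∀ i j : ℕ, shift (partialSum (convolution m a b)) i j =
      ∑ k ∈ Finset.range (m + 1), T.comp (shift (partialSum a) k j) (shift (partialSum b) i k) →
      partialSum (convolution m a b) i j =
      ∑ k ∈ Finset.range (m + 1), T.comp (partialSum a k j) (partialSum b i k) := by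
    intro i j h
    rw [partialSum_eq, h, convolution, ← Finset.sum_add_distrib]
    refine Finset.sum_congr rfl fun k _ => ?_
    rw [partialSum_eq a k j, partialSum_eq b i k]
    simp only [map_add, LinearMap.add_apply]
    abel
  intro i
  induction i with
  | zero =>
    intro j hi
    refine key 0 j ?_
    simp [shift]
  | succ i ih =>
    intro j hi
    refine key (i + 1) j ?_
    cases j with
    | zero =>
      simp only [shift]
      refine (Finset.sum_eq_zero fun k _ => ?_).symm
      cases k <;> simp
    | succ j =>
      simp only [shift]
      rw [ih j (by omega), map_sum, Finset.sum_range_succ, Finset.sum_range_succ']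
      rw [partialSum_eq_zero hb i m (by omega)]
      simp [T.tens_comp]

variable {K} in
theorem convolution_mem {l m n : ℕ} {a b : ∀ i j : ℕ, T.Hom i j} (ha : a ∈ band K m n)
    (hb : b ∈ band K l m) : convolution m a b ∈ band K l n := by
  refine ⟨fun i j => (K.carrier i j).sum_mem fun k _ => (K.carrier i j).add_mem
    (K.comp_mem_right _ (ha.1 k j)) (K.comp_mem_left _ (hb.1 i k)), fun i j h => ?_⟩
  refine Finset.sum_eq_zero fun k hk => ?_
  have hkm : k ≤ m := Nat.lt_succ_iff.1 (Finset.mem_range.1 hk)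
  have h1 : T.comp (a k j) (partialSum b i k) = 0 := by
    by_cases h1 : k + n = j + m
    · rw [partialSum_eq_zero hb i k (by omega), map_zero]
    · rw [ha.2 k j fun h' => h1 h'.1]
      simp
  have h2 : T.comp (shift (partialSum a) k j) (b i k) = 0 := by
    by_cases h2 : k + n = j + m
    · rw [hb.2 i k (by omega), map_zero]
    · rw [shift_partialSum_eq_zero ha h2]
      simp
  rw [h1, h2, add_zero]

/-- The linear map whose norm is the seminorm `‖·‖^J` on `M(m,n)`. -/
def bandMap (m n : ℕ) : band K m n →ₗ[ℂ]
    ((i : Fin m) → (j : Fin n) → T.Hom i j ⧸ J.carrier i j) × T.Hom m n where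
  toFun a := (fun i j => (J.carrier i j).mkQ (partialSum a.1 i j), partialSum a.1 m n)
  map_add' a b := by
    ext i j
    · simp [partialSum_add]
    · simp [partialSum_add]
  map_smul' c a := by
    ext i j
    · simp [partialSum_smul]
    · simp [partialSum_smul]

/-- `M(m,n)` with the seminorm
`‖a‖^J = max (max_{i < m, j < n} ‖q_J(partialSum a i j)‖) ‖partialSum a m n‖`
(the entries off the diagonal through `(m, n)` vanish). -/
def Band (K _J : T.Ideal) (m n : ℕ) : Type u := band K m n

instance (m n : ℕ) : AddCommGroup (Band K J m n) := inferInstanceAs (AddCommGroup (band K m n))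

instance (m n : ℕ) : Module ℂ (Band K J m n) := inferInstanceAs (Module ℂ (band K m n))

instance (m n : ℕ) : SeminormedAddCommGroup (Band K J m n) :=
  SeminormedAddCommGroup.induced (Band K J m n)
    (((i : Fin m) → (j : Fin n) → T.Hom i j ⧸ J.carrier i j) × T.Hom m n) (bandMap K J m n)

instance (m n : ℕ) : NormedSpace ℂ (Band K J m n) :=
  NormedSpace.induced ℂ (Band K J m n)
    (((i : Fin m) → (j : Fin n) → T.Hom i j ⧸ J.carrier i j) × T.Hom m n) (bandMap K J m n)

variable {K J}

theorem Band.norm_def {m n : ℕ} (a : Band K J m n) : ‖a‖ = ‖bandMap K J m n a‖ := rfl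

theorem Band.norm_eq_zero_iff {m n : ℕ} (a : Band K J m n) :
    ‖a‖ = 0 ↔ (∀ i j : ℕ, i < m → j < n → partialSum a.1 i j ∈ J.carrier i j) ∧
      partialSum a.1 m n = 0 := by
  have hJ : ∀ (i j : ℕ) (x : T.Hom i j), ‖(J.carrier i j).mkQ x‖ = 0 ↔ x ∈ J.carrier i j := by
    intro i j x
    have : IsClosed ((J.carrier i j).toAddSubgroup : Set (T.Hom i j)) := J.isClosed i j
    exact QuotientAddGroup.norm_mk_eq_zero (S := (J.carrier i j).toAddSubgroup) (m := x)
  have hmax : ‖a‖ = max ‖(bandMap K J m n a).1‖ ‖partialSum a.1 m n‖ := rfl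
  have h1 : ‖(bandMap K J m n a).1‖ = 0 ↔
      ∀ i j : ℕ, i < m → j < n → partialSum a.1 i j ∈ J.carrier i j := by
    rw [← (norm_nonneg _).ge_iff_eq', pi_norm_le_iff_of_nonneg le_rfl]
    constructor
    · intro h i j hi hj
      have h' := h ⟨i, hi⟩
      rw [pi_norm_le_iff_of_nonneg le_rfl] at h'
      exact (hJ i j _).1 (le_antisymm (h' ⟨j, hj⟩) (norm_nonneg _))
    · intro h i
      rw [pi_norm_le_iff_of_nonneg le_rfl]
      exact fun j => ((hJ i j _).2 (h i j i.2 j.2)).le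
  rw [← h1, ← norm_eq_zero (a := partialSum a.1 m n), hmax]
  constructor
  · intro h
    exact ⟨le_antisymm (h ▸ le_max_left _ _) (norm_nonneg _),
      le_antisymm (h ▸ le_max_right _ _) (norm_nonneg _)⟩
  · rintro ⟨h, h'⟩
    rw [h, h', max_self]

/-- The convolution product `M(m,n) × M(l,m) → M(l,n)`. -/
def Band.mul {l m n : ℕ} : Band K J m n →ₗ[ℂ] Band K J l m →ₗ[ℂ] Band K J l n :=
  LinearMap.mk₂ ℂ (fun a b => (⟨convolution m a.1 b.1, convolution_mem a.2 b.2⟩ : band K l n))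
    (fun a a' b => by
      refine Subtype.ext ?_
      funext i j
      change convolution m (a.1 + a'.1) b.1 i j =
        convolution m a.1 b.1 i j + convolution m a'.1 b.1 i j
      simp only [convolution, partialSum_add, shift_add, Pi.add_apply, map_add,
        LinearMap.add_apply, ← Finset.sum_add_distrib]
      exact Finset.sum_congr rfl fun k _ => by abel)
    (fun c a b => by
      refine Subtype.ext ?_
      funext i j
      change convolution m (c • a.1) b.1 i j = c • convolution m a.1 b.1 i j
      simp only [convolution, partialSum_smul, shift_smul, Pi.smul_apply, map_smul,
        LinearMap.smul_apply, Finset.smul_sum, smul_add])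
    (fun a b b' => by
      refine Subtype.ext ?_
      funext i j
      change convolution m a.1 (b.1 + b'.1) i j =
        convolution m a.1 b.1 i j + convolution m a.1 b'.1 i j
      simp only [convolution, partialSum_add, Pi.add_apply, map_add, ← Finset.sum_add_distrib]
      exact Finset.sum_congr rfl fun k _ => by abel)
    (fun c a b => by
      refine Subtype.ext ?_
      funext i j
      change convolution m a.1 (c • b.1) i j = c • convolution m a.1 b.1 i j
      simp only [convolution, partialSum_smul, Pi.smul_apply, map_smul, Finset.smul_sum,
        smul_add])

theorem Band.norm_mul_eq_zero_left {l m n : ℕ} {a : Band K J m n} (b : Band K J l m)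
    (ha : ‖a‖ = 0) : ‖Band.mul a b‖ = 0 := by
  rw [Band.norm_eq_zero_iff] at ha ⊢
  have hS := partialSum_convolution (a := a.1) b.2
  constructor
  · intro i j hi hj
    change partialSum (convolution m a.1 b.1) i j ∈ _
    rw [hS i j hi.le]
    refine (J.carrier i j).sum_mem fun k hk => ?_
    by_cases h : k + n = j + m
    · exact J.comp_mem_right _ (ha.1 k j (by omega) hj)
    · rw [partialSum_eq_zero a.2 k j h]
      simp
  · change partialSum (convolution m a.1 b.1) l n = 0
    rw [hS l n le_rfl]
    refine Finset.sum_eq_zero fun k hk => ?_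
    by_cases h : k = m
    · subst h
      rw [ha.2]
      simp
    · rw [partialSum_eq_zero a.2 k n (by omega)]
      simp

theorem Band.norm_mul_eq_zero_right {l m n : ℕ} (a : Band K J m n) {b : Band K J l m}
    (hb : ‖b‖ = 0) : ‖Band.mul a b‖ = 0 := by
  rw [Band.norm_eq_zero_iff] at hb ⊢
  have hS := partialSum_convolution (a := a.1) b.2
  constructor
  · intro i j hi hj
    change partialSum (convolution m a.1 b.1) i j ∈ _
    rw [hS i j hi.le]
    refine (J.carrier i j).sum_mem fun k hk => ?_
    by_cases h : i + m = k + l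
    · exact J.comp_mem_left _ (hb.1 i k hi (by omega))
    · rw [partialSum_eq_zero b.2 i k h, map_zero]
      exact zero_mem _
  · change partialSum (convolution m a.1 b.1) l n = 0
    rw [hS l n le_rfl]
    refine Finset.sum_eq_zero fun k hk => ?_
    by_cases h : k = m
    · subst h
      rw [hb.2, map_zero]
    · rw [partialSum_eq_zero b.2 l k (by omega), map_zero]

/-- The inclusion `M(m,n) ⊆ M(m+1,n+1)`. -/
def Band.incl {m n : ℕ} : Band K J m n →ₗ[ℂ] Band K J (m + 1) (n + 1) where
  toFun a := (⟨a.1, a.2.1, fun i j h => a.2.2 i j (by omega)⟩ : band K (m + 1) (n + 1))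
  map_add' _ _ := rfl
  map_smul' _ _ := rfl

theorem Band.norm_incl_eq_zero {m n : ℕ} {a : Band K J m n} (ha : ‖a‖ = 0) :
    ‖Band.incl a‖ = 0 := by
  rw [Band.norm_eq_zero_iff] at ha ⊢
  constructor
  · intro i j hi hj
    change partialSum a.1 i j ∈ _
    by_cases h : i + n = j + m
    · rcases Nat.lt_succ_iff_lt_or_eq.1 hi with h' | h'
      · exact ha.1 i j h' (by omega)
      · obtain rfl : j = n := by omega
        subst h'
        rw [ha.2]
        exact zero_mem _
    · rw [partialSum_eq_zero a.2 i j h]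
      exact zero_mem _
  · change partialSum a.1 (m + 1) (n + 1) = 0
    simp only [partialSum]
    rw [ha.2, a.2.2 _ _ (by omega)]
    simp

theorem Band.inseparable_iff {m n : ℕ} {a b : Band K J m n} :
    Inseparable a b ↔ ‖a - b‖ = 0 := by
  rw [Metric.inseparable_iff, dist_eq_norm]

variable (K J)

/-- `K_J`: the spaces `K_J(m,n) = M(m,n)/‖·‖^J`, with composition induced by the convolution product
and right tensoring `⊗_J 1` induced by the inclusions `M(m,n) ⊆ M(m+1,n+1)`. (Its involution, induced by
`a ↦ (a_{ji}^*)`, plays no role in the notions of ideal, invariance and saturation.) -/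
def KJ : Precategory.{u} where
  Hom m n := SeparationQuotient (Band K J m n)
  comp {l m n} := LinearMap.mk₂ ℂ
    (SeparationQuotient.lift₂ (fun a b => SeparationQuotient.mk (Band.mul a b)) (by
      intro a b a' b' ha hb
      rw [SeparationQuotient.mk_eq_mk, Band.inseparable_iff] at *
      have e : Band.mul a b - Band.mul a' b' = Band.mul (a - a') b + Band.mul a' (b - b') := by
        simp only [map_sub, LinearMap.sub_apply]
        abel
      rw [e]
      refine le_antisymm ((norm_add_le _ _).trans ?_) (norm_nonneg _)
      rw [Band.norm_mul_eq_zero_left _ ha, Band.norm_mul_eq_zero_right _ hb, add_zero]))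
    (fun a a' b => by
      obtain ⟨a, rfl⟩ := SeparationQuotient.surjective_mk a
      obtain ⟨a', rfl⟩ := SeparationQuotient.surjective_mk a'
      obtain ⟨b, rfl⟩ := SeparationQuotient.surjective_mk b
      simp only [← SeparationQuotient.mk_add, SeparationQuotient.lift₂_mk, map_add,
        LinearMap.add_apply])
    (fun c a b => by
      obtain ⟨a, rfl⟩ := SeparationQuotient.surjective_mk a
      obtain ⟨b, rfl⟩ := SeparationQuotient.surjective_mk b
      simp only [← SeparationQuotient.mk_smul, SeparationQuotient.lift₂_mk, map_smul,
        LinearMap.smul_apply])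
    (fun a b b' => by
      obtain ⟨a, rfl⟩ := SeparationQuotient.surjective_mk a
      obtain ⟨b, rfl⟩ := SeparationQuotient.surjective_mk b
      obtain ⟨b', rfl⟩ := SeparationQuotient.surjective_mk b'
      simp only [← SeparationQuotient.mk_add, SeparationQuotient.lift₂_mk, map_add])
    (fun c a b => by
      obtain ⟨a, rfl⟩ := SeparationQuotient.surjective_mk a
      obtain ⟨b, rfl⟩ := SeparationQuotient.surjective_mk b
      simp only [← SeparationQuotient.mk_smul, SeparationQuotient.lift₂_mk, map_smul])
  tens {m n} :=
    { toFun := SeparationQuotient.lift (fun a => SeparationQuotient.mk (Band.incl a)) (by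
        intro a b h
        rw [SeparationQuotient.mk_eq_mk]
        rw [Band.inseparable_iff] at h ⊢
        rw [← map_sub]
        exact Band.norm_incl_eq_zero h)
      map_add' := fun a b => by
        obtain ⟨a, rfl⟩ := SeparationQuotient.surjective_mk a
        obtain ⟨b, rfl⟩ := SeparationQuotient.surjective_mk b
        simp only [← SeparationQuotient.mk_add, SeparationQuotient.lift_mk, map_add]
      map_smul' := fun c a => by
        obtain ⟨a, rfl⟩ := SeparationQuotient.surjective_mk a
        simp only [← SeparationQuotient.mk_smul, SeparationQuotient.lift_mk, map_smul,
          RingHom.id_apply] }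

/-- The class in `K_J(m,n)` of an element of `M(m,n)`. -/
def toKJ {m n : ℕ} (a : Band K J m n) : (KJ K J).Hom m n := SeparationQuotient.mk a

/-- `N_J[I](m,n)`: the classes of the matrices in `M(m,n)` with all entries in the ideal `I`. -/
def bandIdeal (I : T.Ideal) (m n : ℕ) : Set ((KJ K J).Hom m n) :=
  {x | ∃ a : Band K J m n, (∀ i j, a.1 i j ∈ I.carrier i j) ∧ toKJ K J a = x}

/-- The canonical map `M(m,n) → O_T(K, J)`, sending a matrix `a` to `∑ i(a_{ij})`. -/
def bandToO {m n : ℕ} (a : Band K J m n) : O K J :=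
  ∑ i ∈ Finset.range (m + 1), ∑ j ∈ Finset.range (n + 1),
    (univRep K J).toFun i j ⟨a.1 i j, a.2.1 i j⟩

end KJ

end CStarPrecategory
end
end RightTensor

open RightTensor RightTensor.Precategory RightTensor.CStarPrecategory

/-! Matrices are handled through their partial sums `S(a)` instead of their entries. Convolution
becomes the matrix product of partial sums, and a matrix has seminorm zero exactly when its partial
sums lie in `J` before the corner and vanish at the corner. Write `Ψ` for `bandToO`. It is
multiplicative, respects involution and the inclusions that define `⊗_J 1`, and is contractive for
the seminorm: on null matrices coisometry turns it into a telescoping sum that vanishes. For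
invariant `N`, the class of `a` is in `N_J[K ∩ N]` iff `S(a)` lies in `J + N` before the corner and
in `N` at the corner (`toKJ_mem_bandIdeal_iff`).

For the first isomorphism, a saturated invariant ideal of `K_J` determines its core, the ideal of
all `a` in `K` whose one-entry matrix has class in it. Its invariant hull `N` satisfies `core = K ∩
N` and is `J`-saturated (`coreIdeal_eq`, `isSaturated_invariantHull`). Conditions (i) and (ii) enter
only through `IsDecomposable`: each class is `w ⊗_J 1` plus the class of one entry `x` at the
corner, and this `x` is forced into the core. Saturation then strips `⊗_J 1` from `w`, and induction
on the corner shows that the core recovers the ideal (`carrier_eq_bandIdeal`).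

The second isomorphism needs enough representations and enough matrices. Representations: if the
partial sums of `a` violate the criterion above, some representation coisometric on `J` kills `N`
but not `Ψ(a)` (`exists_coisometricRep`). It is a GNS-type construction: Toeplitz matrices act on an
ultralimit of spaces built from positive functionals that kill `N`. Either a single functional kills
`J + N` and detects a partial sum outside it, or functionals on objects tending to infinity detect
the corner. In the second case saturation makes `⊗ 1` isometric modulo `N` on `J + N`, so nothing is
lost along the way, and the defect of coisometry stays at a fixed position that the vectors leave
behind. Matrices: a gauge-invariant ideal is the closed span of the `Ψ(a)` that it contains
(`mem_of_gaugeInvariant`). Fourier components reduce this to homogeneous elements, these are limits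
of elements `Ψ(b)`, and functional calculus cuts `b` to a nearby matrix with image inside the ideal.

For the last claim, the kernel of `O(K ∩ N, J ∩ N) → O(K, J)` is gauge-invariant, so injectivity
need only be tested on matrices. There the same separation applies, with the hull of the core of the
null classes in place of `N` (`restrictHom_injective`). -/

namespace RightTensor

noncomputable section

/-! ### Closed ideals of `C*`-algebras -/

namespace CStarPrecategory.IsClosedIdeal

attribute [local instance] CStarAlgebra.spectralOrder CStarAlgebra.spectralOrderedRing

variable {A : Type*} [NonUnitalCStarAlgebra A] {P : Submodule ℂ A}

/-- Compression `x ↦ (1 - u) x (1 - u)` by a positive contraction is contractive and positive. -/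
theorem compress_of_nonneg {u : A} (hu : 0 ≤ u) (hu1 : ‖u‖ ≤ 1) :
    (∀ x : A, ‖x - u * x - x * u + u * x * u‖ ≤ ‖x‖) ∧
      ∀ x : A, 0 ≤ x → 0 ≤ x - u * x - x * u + u * x * u := by
  have hmem := CStarAlgebra.inr_mem_Icc_iff_norm_le.2 ⟨hu, hu1⟩
  set v : Unitization ℂ A := 1 - (u : Unitization ℂ A) with hv
  have hv0 : 0 ≤ v := sub_nonneg.2 hmem.2
  have hv1 : v ≤ 1 := sub_le_self _ hmem.1
  have hvn : ‖v‖ ≤ 1 := (CStarAlgebra.norm_le_one_iff_of_nonneg v hv0).2 hv1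
  have key : ∀ x : A, ((x - u * x - x * u + u * x * u : A) : Unitization ℂ A) = v * x * v := by
    intro x
    simp only [Unitization.inr_add, Unitization.inr_sub, Unitization.inr_mul, hv]
    noncomm_ring
  constructor
  · intro x
    rw [← Unitization.norm_inr (𝕜 := ℂ), key, ← Unitization.norm_inr (𝕜 := ℂ) x]
    calc ‖v * (x : Unitization ℂ A) * v‖ ≤ ‖v‖ * ‖(x : Unitization ℂ A)‖ * ‖v‖ :=
          (norm_mul_le _ _).trans (by gcongr; exact norm_mul_le _ _)
      _ ≤ 1 * ‖(x : Unitization ℂ A)‖ * 1 := by gcongr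
      _ = _ := by ring
  · intro x hx
    rw [← Unitization.inr_nonneg_iff, key]
    have hvs : star v = v := (IsSelfAdjoint.of_nonneg hv0).star_eq
    have := star_left_conjugate_nonneg (Unitization.inr_nonneg_iff.2 hx) v
    rwa [hvs] at this

/-- Supplies an approximate unit of `P` adapted to one self-adjoint `y`, together with the two
compression properties, so that quotients by `P` never have to be formed. -/
theorem exists_compress (hP : IsClosedIdeal P) {y : A} (hy : y ∈ P) (hys : IsSelfAdjoint y)
    {ε : ℝ} (hε : 0 < ε) :
    ∃ u ∈ P, star u = u ∧ (∀ x : A, ‖x - u * x - x * u + u * x * u‖ ≤ ‖x‖) ∧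
      (∀ x : A, 0 ≤ x → 0 ≤ x - u * x - x * u + u * x * u) ∧
      ‖y - u * y - y * u + u * y * u‖ ≤ ε := by
  obtain ⟨N, hN⟩ := exists_nat_gt (1 / ε ^ 2)
  have hNpos : (0 : ℝ) < N := lt_trans (by positivity) hN
  -- Since `f(t) = t h(t)`, the element `f(y)` is a multiple of `y` and so lies in `P`. Moreover `t
  -- (1 - f(t))² = t / (1 + N t²)²` is of order `N^(-1/2)`, uniformly in `t`.
  let f : ℝ → ℝ := fun t => N * t ^ 2 / (1 + N * t ^ 2)
  let h : ℝ → ℝ := fun t => N * t / (1 + N * t ^ 2)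
  have hpos : ∀ t : ℝ, 0 < 1 + N * t ^ 2 := fun t => by positivity
  have hfc : Continuous f := Continuous.div (by fun_prop) (by fun_prop) fun t => (hpos t).ne'
  have hhc : Continuous h := Continuous.div (by fun_prop) (by fun_prop) fun t => (hpos t).ne'
  have hf0 : f 0 = 0 := by simp [f]
  have hh0 : h 0 = 0 := by simp [h]
  have hmem : cfcₙ f y ∈ P := by
    have h1 : cfcₙ f y = y * cfcₙ h y := by
      conv_rhs => rw [show y * cfcₙ h y = cfcₙ (fun t : ℝ => t) y * cfcₙ h y by rw [cfcₙ_id' ℝ y]]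
      rw [← cfcₙ_mul (fun t : ℝ => t) h y (by fun_prop) rfl hhc.continuousOn hh0]
      refine cfcₙ_congr fun t _ => ?_
      simp only [f, h]
      ring
    rw [h1]
    exact (hP.2 _ _ hy).2
  have hu0 : 0 ≤ cfcₙ f y := cfcₙ_nonneg fun t _ => by positivity
  have hu1 : ‖cfcₙ f y‖ ≤ 1 := by
    refine norm_cfcₙ_le fun t _ => ?_
    rw [Real.norm_eq_abs, abs_of_nonneg (by positivity), div_le_one (hpos t)]
    linarith
  obtain ⟨hc1, hc2⟩ := compress_of_nonneg hu0 hu1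
  refine ⟨cfcₙ f y, hmem, (IsSelfAdjoint.of_nonneg hu0).star_eq, hc1, hc2, ?_⟩
  have e2 : y - cfcₙ f y * y - y * cfcₙ f y + cfcₙ f y * y * cfcₙ f y
      = cfcₙ (fun t : ℝ => t - f t * t - t * f t + f t * t * f t) y := by
    have c0 : ContinuousOn f (quasispectrum ℝ y) := hfc.continuousOn
    rw [cfcₙ_add (R := ℝ) (fun t : ℝ => t - f t * t - t * f t)
        (fun t : ℝ => f t * t * f t) y (by fun_prop) (by simp) (by fun_prop) (by simp),
      cfcₙ_sub (R := ℝ) (fun t : ℝ => t - f t * t) (fun t : ℝ => t * f t) y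
        (by fun_prop) (by simp) (by fun_prop) (by simp),
      cfcₙ_sub (R := ℝ) (fun t : ℝ => t) (fun t : ℝ => f t * t) y
        (by fun_prop) rfl (by fun_prop) (by simp),
      cfcₙ_mul (R := ℝ) (fun t : ℝ => f t * t) f y (by fun_prop) (by simp)
        (by fun_prop) (by simp [hf0]),
      cfcₙ_mul (R := ℝ) f (fun t : ℝ => t) y (by fun_prop) (by simp [hf0])
        (by fun_prop) rfl,
      cfcₙ_mul (R := ℝ) (fun t : ℝ => t) f y (by fun_prop) rfl
        (by fun_prop) (by simp [hf0]), cfcₙ_id' ℝ y]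
  rw [e2]
  refine norm_cfcₙ_le fun t _ => ?_
  have e3 : t - f t * t - t * f t + f t * t * f t = t / (1 + N * t ^ 2) ^ 2 := by
    have := (hpos t).ne'
    simp only [f]
    field_simp
    ring
  rw [e3, Real.norm_eq_abs, abs_div, abs_of_pos (by positivity : 0 < (1 + N * t ^ 2) ^ 2),
    div_le_iff₀ (by positivity)]
  have h1 : 1 < ε ^ 2 * N := by
    rw [div_lt_iff₀ (by positivity)] at hN
    linarith
  have h2 : |t| ≤ ε * (1 + N * t ^ 2) := by
    have h3 : 0 ≤ ε * (1 + N * t ^ 2) := by positivity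
    refine abs_le_of_sq_le_sq ?_ h3
    have : t ^ 2 * 1 ≤ t ^ 2 * (ε ^ 2 * N) := by gcongr
    nlinarith [sq_nonneg (1 - N * t ^ 2), sq_nonneg ε, sq_nonneg (N * t ^ 2), mul_nonneg (sq_nonneg ε) (mul_nonneg hNpos.le (sq_nonneg t)), sq_nonneg (ε * (1 - N * t ^ 2))]
  calc |t| ≤ ε * (1 + N * t ^ 2) * 1 := by linarith
    _ ≤ ε * (1 + N * t ^ 2) * (1 + N * t ^ 2) := by
        gcongr
        have : 0 ≤ N * t ^ 2 := by positivity
        linarith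
    _ = _ := by ring

/-- For `u` as in `exists_compress`, `‖x - x u‖²` is the norm of the compression of `x* x`, so `x`
is a limit of elements `x u` of `P`. -/
theorem mem_of_star_mul_self_mem (hP : IsClosedIdeal P) {x : A} (hx : star x * x ∈ P) : x ∈ P := by
  refine hP.1.closure_subset (Metric.mem_closure_iff.2 fun ε hε => ?_)
  obtain ⟨u, huP, hus, -, -, hn⟩ :=
    exists_compress hP hx (IsSelfAdjoint.star_mul_self x) (ε := (ε / 2) ^ 2) (by positivity)
  refine ⟨x * u, (hP.2 _ _ huP).1, ?_⟩
  rw [dist_eq_norm]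
  have : ‖x - x * u‖ * ‖x - x * u‖ ≤ (ε / 2) ^ 2 := by
    rw [← CStarRing.norm_star_mul_self]
    refine le_trans (le_of_eq ?_) hn
    congr 1
    simp only [star_sub, star_mul, hus]
    noncomm_ring
  have h2 : ‖x - x * u‖ ≤ ε / 2 := abs_le_of_sq_le_sq' (by rwa [sq]) (by positivity) |>.2
  linarith

theorem star_mem (hP : IsClosedIdeal P) {x : A} (hx : x ∈ P) : star x ∈ P :=
  hP.mem_of_star_mul_self_mem (by rw [star_star]; exact (hP.2 _ _ hx).2)

/-- If `y` is within distance less than `c` of `P`, then `(y - c)₊ ∈ P`. -/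
theorem cfcₙ_sub_posPart_mem (hP : IsClosedIdeal P) {y i : A} (hy : IsSelfAdjoint y) (hi : i ∈ P)
    {c : ℝ} (hc : ‖y - i‖ < c) : cfcₙ (fun t : ℝ => max (t - c) 0) y ∈ P := by
  have hc0 : 0 < c := (norm_nonneg _).trans_lt hc
  set c' := ‖y - i‖ with hc'
  -- With `w n = g n (y)` one has `w n = y (w (n+1)) = i (w (n+1)) + (y - i) (w (n+1))`. The first
  -- summand is in `P`, so each step costs at most a factor `‖y - i‖` in the distance to `P`, while
  -- `‖w n‖` grows only like `c⁻ⁿ`. As `‖y - i‖ < c`, the distance of `w 0` to `P` is zero.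
  let g : ℕ → ℝ → ℝ := fun n t => max (t - c) 0 / max t c ^ n
  have hpos : ∀ t : ℝ, 0 < max t c := fun t => lt_max_of_lt_right hc0
  have hgc : ∀ n, Continuous (g n) := fun n =>
    Continuous.div (by fun_prop) (by fun_prop) fun t => (pow_pos (hpos t) n).ne'
  have hg0 : ∀ n, g n 0 = 0 := fun n => by simp [g, hc0.le]
  let w : ℕ → A := fun n => cfcₙ (g n) y
  have hw : ∀ n, w n = y * w (n + 1) := by
    intro n
    have : y * w (n + 1) = cfcₙ (fun t : ℝ => t) y * cfcₙ (g (n + 1)) y := by rw [cfcₙ_id' ℝ y]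
    rw [this, ← cfcₙ_mul (fun t : ℝ => t) (g (n + 1)) y (by fun_prop) rfl
      (hgc _).continuousOn (hg0 _)]
    refine cfcₙ_congr fun t _ => ?_
    simp only [g]
    rcases le_total t c with h | h
    · simp [h]
    · have h0 : 0 < t := hc0.trans_le h
      rw [max_eq_left h]
      field_simp
      ring
  have hstep : ∀ n, ∀ p ∈ P, ∃ p' ∈ P, ‖w 0 - p'‖ ≤ c' ^ n * ‖w n - p‖ := by
    intro n
    induction n with
    | zero => exact fun p hp => ⟨p, hp, by simp⟩
    | succ n ih =>
      intro p hp
      obtain ⟨p', hp', h⟩ := ih (i * w (n + 1) + (y - i) * p)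
        (P.add_mem (hP.2 _ _ hi).2 (hP.2 _ _ hp).1)
      refine ⟨p', hp', h.trans ?_⟩
      have e : w n - (i * w (n + 1) + (y - i) * p) = (y - i) * (w (n + 1) - p) := by
        rw [hw n]
        noncomm_ring
      rw [e, pow_succ, mul_assoc]
      gcongr
      exact norm_mul_le _ _
  have hwn : ∀ n, ‖w n‖ ≤ ‖y‖ / c ^ n := by
    intro n
    refine norm_cfcₙ_le fun t ht => ?_
    have htn : |t| ≤ ‖y‖ := by
      have := norm_apply_le_norm_cfcₙ (𝕜 := ℝ) (fun t : ℝ => t) y ht (by fun_prop) rfl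
      rwa [cfcₙ_id' ℝ y, Real.norm_eq_abs] at this
    rw [Real.norm_eq_abs, abs_of_nonneg (by have := hpos t; positivity)]
    refine div_le_div₀ (norm_nonneg _) ?_ (by positivity)
      (pow_le_pow_left₀ hc0.le (le_max_right _ _) n)
    exact max_le (by linarith [le_abs_self t]) (norm_nonneg _)
  have hlim : Filter.Tendsto (fun n : ℕ => (c' / c) ^ n * ‖y‖) Filter.atTop (nhds 0) := by
    have := (tendsto_pow_atTop_nhds_zero_of_lt_one (r := c' / c) (by positivity)
      ((div_lt_one hc0).2 hc)).mul_const ‖y‖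
    simpa using this
  have hw0 : w 0 = cfcₙ (fun t : ℝ => max (t - c) 0) y := by simp [w, g]
  rw [← hw0]
  refine hP.1.closure_subset (Metric.mem_closure_iff.2 fun ε hε => ?_)
  obtain ⟨n, hn⟩ := ((tendsto_order.1 hlim).2 ε hε).exists
  obtain ⟨p', hp', h⟩ := hstep n 0 P.zero_mem
  refine ⟨p', hp', ?_⟩
  rw [dist_eq_norm]
  refine lt_of_le_of_lt (h.trans ?_) hn
  rw [sub_zero, div_pow, div_mul_eq_mul_div, ← mul_div_assoc']
  gcongr
  exact hwn n

/-- On the spectrum of a positive element, `t - (t - c)₊ = min t c` lies between `0` and `c`. -/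
theorem norm_sub_cfcₙ_sub_posPart_le {y : A} (hy : 0 ≤ y) {c : ℝ} (hc : 0 ≤ c) :
    ‖y - cfcₙ (fun t : ℝ => max (t - c) 0) y‖ ≤ c := by
  have hys : IsSelfAdjoint y := IsSelfAdjoint.of_nonneg hy
  have e : y - cfcₙ (fun t : ℝ => max (t - c) 0) y = cfcₙ (fun t : ℝ => t - max (t - c) 0) y := by
    rw [cfcₙ_sub (R := ℝ) (fun t : ℝ => t) (fun t : ℝ => max (t - c) 0) y
        (by fun_prop) rfl (by fun_prop) (by simp [hc]), cfcₙ_id' ℝ y]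
  rw [e]
  refine norm_cfcₙ_le fun t ht => ?_
  have ht0 : 0 ≤ t := quasispectrum_nonneg_of_nonneg y hy t ht
  rw [Real.norm_eq_abs, abs_le]
  constructor
  · rcases max_cases (t - c) 0 with h | h <;> linarith
  · rcases max_cases (t - c) 0 with h | h <;> linarith

/-- A real-linear functional that is positive, contractive, kills `P` and has a value at `h` of at
least the distance from `h` to `P`. -/
theorem exists_real_functional (hP : IsClosedIdeal P) {h : A} (hh : 0 ≤ h) :
    ∃ g : A →ₗ[ℝ] ℝ, (∀ p, 0 ≤ p → 0 ≤ g p) ∧ (∀ i ∈ P, g i = 0) ∧ (∀ a, |g a| ≤ ‖a‖) ∧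
      Metric.infDist h P ≤ g h := by
  -- The distance to the convex cone `P - A₊` is sublinear. A linear functional dominated by it is
  -- nonpositive on the cone, hence positive and zero on `P`. Hahn–Banach extends `c h ↦ c N(h)`
  -- under this bound.
  let C : Set A := {x | ∃ i ∈ P, ∃ p : A, 0 ≤ p ∧ x = i - p}
  have h0C : (0 : A) ∈ C := ⟨0, P.zero_mem, 0, le_rfl, by simp⟩
  have hCne : C.Nonempty := ⟨0, h0C⟩
  let N : A → ℝ := fun a => Metric.infDist a C
  have hN0 : ∀ a, 0 ≤ N a := fun a => Metric.infDist_nonneg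
  have hNle : ∀ a, N a ≤ ‖a‖ := fun a => by
    simpa using Metric.infDist_le_dist_of_mem (x := a) h0C
  have hNC : ∀ a ∈ C, N a = 0 := fun a ha => Metric.infDist_zero_of_mem ha
  have hCsmul : ∀ c : ℝ, 0 < c → ∀ x ∈ C, c • x ∈ C := by
    rintro c hc _ ⟨i, hi, p, hp, rfl⟩
    refine ⟨c • i, ?_, c • p, smul_nonneg hc.le hp, smul_sub _ _ _⟩
    have : c • i = (c : ℂ) • i := (Complex.coe_smul c i).symm
    rw [this]
    exact P.smul_mem _ hi
  have hNsmul_le : ∀ c : ℝ, 0 < c → ∀ x, N (c • x) ≤ c * N x := by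
    intro c hc x
    refine le_of_forall_pos_le_add fun ε hε => ?_
    obtain ⟨y, hy, hxy⟩ := (Metric.infDist_lt_iff hCne).1
      (show N x < N x + ε / c from lt_add_of_pos_right _ (by positivity))
    refine (Metric.infDist_le_dist_of_mem (hCsmul c hc y hy)).trans ?_
    rw [dist_smul₀, Real.norm_eq_abs, abs_of_pos hc]
    calc c * dist x y ≤ c * (N x + ε / c) := by gcongr
      _ = c * N x + ε := by field_simp
  have hNsmul : ∀ c : ℝ, 0 < c → ∀ x, N (c • x) = c * N x := by
    intro c hc x
    refine le_antisymm (hNsmul_le c hc x) ?_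
    have := hNsmul_le c⁻¹ (inv_pos.2 hc) (c • x)
    rw [smul_smul, inv_mul_cancel₀ hc.ne', one_smul] at this
    calc c * N x ≤ c * (c⁻¹ * N (c • x)) := by gcongr
      _ = _ := by field_simp
  have hNadd : ∀ x y, N (x + y) ≤ N x + N y := by
    intro x y
    refine le_of_forall_pos_le_add fun ε hε => ?_
    obtain ⟨x', ⟨i, hi, p, hp, rfl⟩, hx'⟩ := (Metric.infDist_lt_iff hCne).1
      (show N x < N x + ε / 2 from lt_add_of_pos_right _ (by positivity))
    obtain ⟨y', ⟨j, hj, q, hq, rfl⟩, hy'⟩ := (Metric.infDist_lt_iff hCne).1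
      (show N y < N y + ε / 2 from lt_add_of_pos_right _ (by positivity))
    refine (Metric.infDist_le_dist_of_mem (show (i - p) + (j - q) ∈ C from
      ⟨i + j, P.add_mem hi hj, p + q, add_nonneg hp hq, by abel⟩)).trans ?_
    have := dist_add_add_le x y (i - p) (j - q)
    linarith
  -- Enlarging `P` to the cone does not bring `h` closer. After compression by an approximate unit
  -- `u` for `i`, the term `i` is small and `p ≥ 0` can only increase the norm, while the
  -- compression of `h` differs from `h` by an element of `P`.
  have hNh : Metric.infDist h P ≤ N h := by
    refine le_of_forall_pos_le_add fun ε hε => ?_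
    obtain ⟨x', ⟨i, hi, p, hp, rfl⟩, hx'⟩ := (Metric.infDist_lt_iff hCne).1
      (show N h < N h + ε / 2 from lt_add_of_pos_right _ (by positivity))
    rw [dist_eq_norm] at hx'
    set s : A := star i * i with hs
    obtain ⟨u, huP, hus, hc1, hc2, hn⟩ := exists_compress hP (hP.2 (star i) i hi).1
      (IsSelfAdjoint.star_mul_self i) (ε := (ε / 2) ^ 2) (by positivity)
    have hiu : ‖i - i * u‖ ≤ ε / 2 := by
      have : ‖i - i * u‖ * ‖i - i * u‖ ≤ (ε / 2) ^ 2 := by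
        rw [← CStarRing.norm_star_mul_self]
        refine le_trans (le_of_eq ?_) hn
        congr 1
        simp only [star_sub, star_mul, hus]
        noncomm_ring
      exact abs_le_of_sq_le_sq' (by rwa [sq]) (by positivity) |>.2
    have hicut : ‖i - u * i - i * u + u * i * u‖ ≤ ε / 2 := by
      have e : i - u * i - i * u + u * i * u = (i - i * u) - u * (i - i * u) := by noncomm_ring
      have hun : ‖(i - i * u) - u * (i - i * u)‖ * ‖(i - i * u) - u * (i - i * u)‖ ≤
          ‖i - i * u‖ * ‖i - i * u‖ := by
        rw [← CStarRing.norm_self_mul_star, ← CStarRing.norm_self_mul_star (x := i - i * u)]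
        refine le_trans (le_of_eq ?_) (hc1 ((i - i * u) * star (i - i * u)))
        congr 1
        simp only [star_sub, star_mul, hus]
        noncomm_ring
      rw [e]
      exact (abs_le_of_sq_le_sq' (by simpa only [sq] using hun) (norm_nonneg _)).2.trans hiu
    have hb := hc1 (h - (i - p))
    have e2 : h - (i - p) - u * (h - (i - p)) - (h - (i - p)) * u + u * (h - (i - p)) * u =
        ((h - u * h - h * u + u * h * u) + (p - u * p - p * u + u * p * u)) -
          (i - u * i - i * u + u * i * u) := by noncomm_ring
    rw [e2] at hb
    have hle : ‖h - u * h - h * u + u * h * u‖ ≤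
        ‖(h - u * h - h * u + u * h * u) + (p - u * p - p * u + u * p * u)‖ :=
      CStarAlgebra.norm_le_norm_of_nonneg_of_le (hc2 h hh) (le_add_of_nonneg_right (hc2 p hp))
    have hmem : u * h + h * u - u * h * u ∈ P :=
      P.sub_mem (P.add_mem (hP.2 _ _ huP).2 (hP.2 _ _ huP).1) (hP.2 _ _ huP).1
    refine (Metric.infDist_le_dist_of_mem hmem).trans ?_
    rw [dist_eq_norm]
    have e3 : h - (u * h + h * u - u * h * u) = h - u * h - h * u + u * h * u := by abel
    rw [e3]
    have := norm_sub_norm_le ((h - u * h - h * u + u * h * u) + (p - u * p - p * u + u * p * u))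
      (i - u * i - i * u + u * i * u)
    linarith
  have hd : ∀ c : ℝ, c • h = 0 → (RingHom.id ℝ) c • N h = 0 := by
    intro c hc
    rcases smul_eq_zero.1 hc with rfl | rfl
    · simp
    · simp [hNC 0 h0C]
  obtain ⟨g, hg, hgN⟩ := exists_extension_of_le_sublinear
    (LinearPMap.mkSpanSingleton' h (N h) hd) N hNsmul hNadd (by
      rintro ⟨x, hx⟩
      obtain ⟨c, rfl⟩ := Submodule.mem_span_singleton.1 hx
      rw [LinearPMap.mkSpanSingleton'_apply, RingHom.id_apply, smul_eq_mul]
      rcases le_or_gt c 0 with hc | hc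
      · exact (mul_nonpos_of_nonpos_of_nonneg hc (hN0 h)).trans (hN0 _)
      · exact (hNsmul c hc h).ge)
  refine ⟨g, fun p hp => ?_, fun i hi => ?_, fun a => ?_, ?_⟩
  · have := (hgN (-p)).trans (hNC (-p) ⟨0, P.zero_mem, p, hp, by simp⟩).le
    rw [map_neg] at this
    linarith
  · have h1 := (hgN i).trans (hNC i ⟨i, hi, 0, le_rfl, by simp⟩).le
    have h2 := (hgN (-i)).trans (hNC (-i) ⟨-i, P.neg_mem hi, 0, le_rfl, by simp⟩).le
    rw [map_neg] at h2
    linarith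
  · refine abs_le.2 ⟨?_, (hgN a).trans (hNle a)⟩
    have := (hgN (-a)).trans (hNle (-a))
    rw [map_neg, norm_neg] at this
    linarith
  · have hmem : h ∈ (LinearPMap.mkSpanSingleton' h (N h) hd).domain :=
      Submodule.mem_span_singleton_self h
    have := hg ⟨h, hmem⟩
    rw [LinearPMap.mkSpanSingleton'_apply_self] at this
    exact hNh.trans this.ge

/-- A positive linear functional that kills `P` and has a value at `h` of at least the distance
from `h` to `P`. -/
theorem exists_functional (hP : IsClosedIdeal P) (h : A) :
    ∃ φ : A →ₗ[ℂ] ℂ, (∀ b, 0 ≤ (φ (star b * b)).re) ∧ (∀ b, φ (star b) = star (φ b)) ∧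
      (∀ i ∈ P, φ i = 0) ∧ (∀ a, ‖φ a‖ ≤ 2 * ‖a‖) ∧
      Metric.infDist (star h * h) P ≤ (φ (star h * h)).re := by
  obtain ⟨g, hg0, hgP, hgn, hgh⟩ := hP.exists_real_functional (star_mul_self_nonneg h)
  -- Averaging over the involution makes the functional Hermitian and does not change its values on
  -- elements `b* b`.
  let f : A →ₗ[ℝ] ℝ :=
    { toFun := fun a => (g a + g (star a)) / 2
      map_add' := fun a b => by simp only [star_add, map_add]; ring
      map_smul' := fun c a => by
        simp only [star_smul, star_trivial, map_smul, smul_eq_mul, RingHom.id_apply]; ring }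
  have hfs : ∀ a, f (star a) = f a := fun a => by
    change (g (star a) + g (star (star a))) / 2 = (g a + g (star a)) / 2
    rw [star_star, add_comm]
  have hfn : ∀ a, |f a| ≤ ‖a‖ := fun a => by
    have h1 := hgn a
    have h2 := hgn (star a)
    rw [norm_star] at h2
    change |(g a + g (star a)) / 2| ≤ _
    rw [abs_le] at *
    constructor <;> linarith
  -- The standard complexification of a real-linear functional. Bounding its two terms separately
  -- gives the crude constant 2, which suffices.
  let φ : A →ₗ[ℂ] ℂ :=
    { toFun := fun a => (f a : ℂ) - Complex.I * f (Complex.I • a)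
      map_add' := fun a b => by simp only [smul_add, map_add, Complex.ofReal_add]; ring
      map_smul' := fun c a => by
        have e1 : c • a = c.re • a + c.im • (Complex.I • a) := by
          rw [← Complex.coe_smul c.re, ← Complex.coe_smul c.im, smul_smul, ← add_smul,
            Complex.re_add_im]
        have e2 : Complex.I • c • a = c.re • (Complex.I • a) - c.im • a := by
          rw [← Complex.coe_smul c.re, ← Complex.coe_smul c.im, smul_smul, smul_smul, ← sub_smul]
          congr 1
          conv_lhs => rw [← Complex.re_add_im c]
          ring_nf
          rw [Complex.I_sq]
          ring
        rw [e2, e1]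
        simp only [map_add, map_sub, map_smul, smul_eq_mul, RingHom.id_apply, Complex.ofReal_add,
          Complex.ofReal_sub, Complex.ofReal_mul]
        conv_rhs => rw [← Complex.re_add_im c]
        ring_nf
        rw [Complex.I_sq]
        ring }
  have hφ : ∀ a, φ a = (f a : ℂ) - Complex.I * f (Complex.I • a) := fun _ => rfl
  have hre : ∀ a, (φ a).re = f a := fun a => by simp [hφ]
  have hfsq : ∀ b, f (star b * b) = g (star b * b) := fun b => by
    change (g (star b * b) + g (star (star b * b))) / 2 = _
    rw [star_mul, star_star]
    ring
  have hfP : ∀ i ∈ P, f i = 0 := fun i hi => by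
    change (g i + g (star i)) / 2 = 0
    rw [hgP i hi, hgP _ (hP.star_mem hi)]
    simp
  refine ⟨φ, fun b => ?_, fun b => ?_, fun i hi => ?_, fun a => ?_, ?_⟩
  · rw [hre, hfsq]
    exact hg0 _ (star_mul_self_nonneg b)
  · have : f (Complex.I • star b) = - f (Complex.I • b) := by
      rw [← hfs (Complex.I • b), star_smul, ← map_neg]
      simp
    rw [hφ, hφ, this, hfs]
    simp
  · rw [hφ, hfP i hi, hfP _ (P.smul_mem _ hi)]
    simp
  · have h1 := hfn a
    have h2 := hfn (Complex.I • a)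
    rw [norm_smul, Complex.norm_I, one_mul] at h2
    rw [hφ]
    refine (norm_sub_le _ _).trans ?_
    rw [norm_mul, Complex.norm_I, one_mul, Complex.norm_real, Complex.norm_real,
      Real.norm_eq_abs, Real.norm_eq_abs]
    linarith
  · rw [hre, hfsq]
    exact hgh

end CStarPrecategory.IsClosedIdeal

/-! ### Ideals of `C*`-precategories -/

namespace CStarPrecategory

attribute [local instance] CStarAlgebra.spectralOrder CStarAlgebra.spectralOrderedRing

variable {T : CStarPrecategory.{u}}

theorem norm_adj {m n : ℕ} (a : T.Hom m n) : ‖T.adj a‖ = ‖a‖ := by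
  have key : ∀ {m n : ℕ} (a : T.Hom m n), ‖a‖ ≤ ‖T.adj a‖ := by
    intro m n a
    rcases eq_or_ne a 0 with rfl | h
    · simp
    · have h0 : 0 < ‖a‖ := norm_pos_iff.2 h
      have h1 := T.norm_comp_le (T.adj a) a
      rw [T.norm_adj_comp_self, sq] at h1
      exact le_of_mul_le_mul_right h1 h0
  refine le_antisymm ?_ (key a)
  simpa only [T.adj_adj] using key (T.adj a)

theorem continuous_comp_left {l m n : ℕ} (a : T.Hom m n) :
    Continuous fun b : T.Hom l m => T.comp a b :=
  AddMonoidHomClass.continuous_of_bound (T.comp a) ‖a‖ fun b => T.norm_comp_le a b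

theorem continuous_comp_right {l m n : ℕ} (b : T.Hom l m) :
    Continuous fun a : T.Hom m n => T.comp a b :=
  AddMonoidHomClass.continuous_of_bound ((T.comp (l := l) (m := m) (n := n)).flip b) ‖b‖ fun a =>
    (T.norm_comp_le a b).trans_eq (mul_comm _ _)

theorem continuous_adj {m n : ℕ} : Continuous fun a : T.Hom m n => T.adj a :=
  AddMonoidHomClass.continuous_of_bound T.adj 1 fun a => by rw [norm_adj, one_mul]

/-- `a ↦ a ⊗ 1` on the `C*`-algebra of endomorphisms of `m`. -/
def tensHom (T : CStarPrecategory.{u}) (m : ℕ) : T.Hom m m →⋆ₙₐ[ℂ] T.Hom (m + 1) (m + 1) where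
  toFun a := T.tens a
  map_smul' c a := map_smul T.tens c a
  map_zero' := map_zero T.tens
  map_add' := map_add T.tens
  map_mul' := T.tens_comp
  map_star' := T.tens_adj

theorem norm_tens_le {m n : ℕ} (a : T.Hom m n) : ‖T.tens a‖ ≤ ‖a‖ := by
  have h : ‖T.tens a‖ ^ 2 ≤ ‖a‖ ^ 2 := by
    rw [← T.norm_adj_comp_self, ← T.norm_adj_comp_self, ← T.tens_adj, ← T.tens_comp]
    exact NonUnitalStarAlgHom.norm_apply_le (tensHom T m) _
  exact (sq_le_sq₀ (norm_nonneg _) (norm_nonneg _)).1 h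

theorem continuous_tens {m n : ℕ} : Continuous fun a : T.Hom m n => T.tens a :=
  AddMonoidHomClass.continuous_of_bound T.tens 1 fun a => by
    rw [one_mul]; exact norm_tens_le a

theorem isClosedIdeal_carrier (K : T.Ideal) (m : ℕ) : IsClosedIdeal (K.carrier m m) :=
  ⟨K.isClosed m m, fun x _ hp => ⟨K.comp_mem_left x hp, K.comp_mem_right x hp⟩⟩

/-- Approximate right units of an ideal. -/
theorem exists_right_unit (K : T.Ideal) {m n : ℕ} {x : T.Hom m n}
    (hx : T.comp (T.adj x) x ∈ K.carrier m m) {ε : ℝ} (hε : 0 < ε) :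
    ∃ u ∈ K.carrier m m, (∀ (n' : ℕ) (y : T.Hom m n'), ‖y - T.comp y u‖ ≤ ‖y‖) ∧
      ‖x - T.comp x u‖ ≤ ε := by
  obtain ⟨u, huK, hus, hc, -, hn⟩ := IsClosedIdeal.exists_compress (isClosedIdeal_carrier K m) hx
    (show T.adj (T.comp (T.adj x) x) = _ by rw [T.adj_comp, T.adj_adj]) (ε := ε ^ 2) (by positivity)
  -- By the `C*`-identity everything reduces to the compression of `y* y` inside the algebra of
  -- endomorphisms of `m`.
  have key : ∀ (n' : ℕ) (y : T.Hom m n'), ‖y - T.comp y u‖ ^ 2 =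
      ‖T.comp (T.adj y) y - u * T.comp (T.adj y) y - T.comp (T.adj y) y * u +
        u * T.comp (T.adj y) y * u‖ := by
    intro n' y
    rw [← T.norm_adj_comp_self]
    congr 1
    have : T.adj u = u := hus
    simp only [map_sub, T.adj_comp, this, mul_def, LinearMap.sub_apply, T.comp_assoc]
    abel
  refine ⟨u, huK, fun n' y => ?_, ?_⟩
  · refine (sq_le_sq₀ (norm_nonneg _) (norm_nonneg _)).1 ?_
    rw [key, ← T.norm_adj_comp_self]
    exact hc _
  · refine (sq_le_sq₀ (norm_nonneg _) hε.le).1 ?_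
    rw [key]
    exact hn

/-- An element `x` of an ideal is a limit of products `x u` with `u` in that ideal, so closed
conditions need only be checked on these. This is how statements about composition with all of `T`
are reduced to `K`. -/
theorem mem_of_forall_comp_mem (K : T.Ideal) {m n : ℕ} {x : T.Hom m n}
    (hx : x ∈ K.carrier m n) {C : Set (T.Hom m n)} (hC : IsClosed C)
    (h : ∀ u ∈ K.carrier m m, T.comp x u ∈ C) : x ∈ C := by
  refine hC.closure_subset (Metric.mem_closure_iff.2 fun ε hε => ?_)
  obtain ⟨u, hu, -, hn⟩ := exists_right_unit K (K.comp_mem_left (T.adj x) hx) (half_pos hε)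
  refine ⟨_, h u hu, ?_⟩
  rw [dist_eq_norm]
  linarith

theorem mem_of_forall_comp_mem_left (K : T.Ideal) {m n : ℕ} {x : T.Hom m n}
    (hx : x ∈ K.carrier m n) {C : Set (T.Hom m n)} (hC : IsClosed C)
    (h : ∀ u ∈ K.carrier n n, T.comp u x ∈ C) : x ∈ C := by
  have := mem_of_forall_comp_mem K (adj_mem K hx) (hC.preimage continuous_adj) fun u hu => by
    change T.adj (T.comp (T.adj x) u) ∈ C
    rw [T.adj_comp, T.adj_adj]
    exact h _ (adj_mem K hu)
  simpa only [Set.mem_preimage, T.adj_adj] using this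

theorem mem_of_adj_comp_self_mem (K : T.Ideal) {m n : ℕ} {x : T.Hom m n}
    (hx : T.comp (T.adj x) x ∈ K.carrier m m) : x ∈ K.carrier m n := by
  refine (K.isClosed m n).closure_subset (Metric.mem_closure_iff.2 fun ε hε => ?_)
  obtain ⟨u, hu, -, hn⟩ := exists_right_unit K hx (half_pos hε)
  refine ⟨_, K.comp_mem_left x hu, ?_⟩
  rw [dist_eq_norm]
  linarith

/-- The addition map from the two ideals has a controlled right inverse on their sum, which by
completeness passes to the closure. -/
theorem isClosed_sup (J N : T.Ideal) (m n : ℕ) :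
    IsClosed ((J.carrier m n ⊔ N.carrier m n : Submodule ℂ (T.Hom m n)) : Set (T.Hom m n)) := by
  have := T.complete m n
  have : CompleteSpace (J.carrier m n) := (J.isClosed m n).completeSpace_coe
  have : CompleteSpace (N.carrier m n) := (N.isClosed m n).completeSpace_coe
  let f : NormedAddGroupHom (J.carrier m n × N.carrier m n) (T.Hom m n) :=
    AddMonoidHom.mkNormedAddGroupHom
      { toFun := fun p => p.1 + p.2
        map_zero' := by simp
        map_add' := fun p q => by simp only [Prod.fst_add, Prod.snd_add, Submodule.coe_add]; abel }
      2 (fun p => by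
        refine (norm_add_le _ _).trans ?_
        have h1 : ‖(p.1 : T.Hom m n)‖ ≤ ‖p‖ := norm_fst_le p
        have h2 : ‖(p.2 : T.Hom m n)‖ ≤ ‖p‖ := norm_snd_le p
        linarith)
  let S : AddSubgroup (T.Hom m n) := (J.carrier m n ⊔ N.carrier m n).toAddSubgroup
  have hf : f.SurjectiveOnWith S 3 := by
    intro h hh
    rcases eq_or_ne h 0 with rfl | h0
    · exact ⟨0, map_zero f, by simp⟩
    · obtain ⟨j, hj, x, hx, rfl⟩ := Submodule.mem_sup.1 hh
      -- The decomposition `j + x` is replaced by `(j + x u) + (x - x u)`. With tolerance `‖j + x‖`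
      -- in `‖j - j u‖`, the second part has norm at most `2 ‖j + x‖` and the first at most `3 ‖j +
      -- x‖`.
      obtain ⟨u, hu, hc, hn⟩ := exists_right_unit J (J.comp_mem_left (T.adj j) hj)
        (norm_pos_iff.2 h0)
      have h1 : ‖x - T.comp x u‖ ≤ 2 * ‖j + x‖ := by
        have e : x - T.comp x u = ((j + x) - T.comp (j + x) u) - (j - T.comp j u) := by
          simp only [map_add, LinearMap.add_apply]
          abel
        rw [e]
        refine (norm_sub_le _ _).trans ?_
        linarith [hc n (j + x)]
      have h2 : ‖j + T.comp x u‖ ≤ 3 * ‖j + x‖ := by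
        have e : j + T.comp x u = (j + x) - (x - T.comp x u) := by abel
        rw [e]
        refine (norm_sub_le _ _).trans ?_
        linarith
      refine ⟨(⟨j + T.comp x u, (J.carrier m n).add_mem hj (J.comp_mem_left x hu)⟩,
        ⟨x - T.comp x u, (N.carrier m n).sub_mem hx (N.comp_mem_right u hx)⟩), ?_, ?_⟩
      · change j + T.comp x u + (x - T.comp x u) = j + x
        abel
      · refine max_le h2 (h1.trans ?_)
        linarith [norm_nonneg (j + x)]
  have hcl := controlled_closure_of_complete (f := f) (K := S) (by norm_num) one_pos hf
  have : closure (S : Set (T.Hom m n)) ⊆ S := by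
    intro x hx
    obtain ⟨p, rfl, -⟩ := hcl x hx
    exact Submodule.add_mem_sup p.1.2 p.2.2
  exact isClosed_of_closure_subset this

/-- The sum of two ideals. -/
def sumIdeal (J N : T.Ideal) : T.Ideal where
  carrier m n := J.carrier m n ⊔ N.carrier m n
  isClosed := isClosed_sup J N
  comp_mem_left {l m n} a b hb := by
    obtain ⟨j, hj, x, hx, rfl⟩ := Submodule.mem_sup.1 hb
    rw [map_add]
    exact Submodule.add_mem_sup (J.comp_mem_left a hj) (N.comp_mem_left a hx)
  comp_mem_right {l m n} a b ha := by
    obtain ⟨j, hj, x, hx, rfl⟩ := Submodule.mem_sup.1 ha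
    rw [map_add]
    exact Submodule.add_mem_sup (J.comp_mem_right b hj) (N.comp_mem_right b hx)

/-- Saturation passes from `J` to `J + N`: the `J`-part of `x` has its tensor in `N` because the
`N`-part does, by invariance. -/
theorem mem_of_mem_sumIdeal {J N : T.Ideal} (hN : N.IsInvariant) (hNJ : N.IsSaturated J)
    {m n : ℕ} {x : T.Hom m n} (hx : x ∈ (sumIdeal J N).carrier m n)
    (hx' : T.tens x ∈ N.carrier (m + 1) (n + 1)) : x ∈ N.carrier m n := by
  obtain ⟨j, hj, y, hy, rfl⟩ := Submodule.mem_sup.1 hx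
  refine (N.carrier m n).add_mem (hNJ m n j hj ?_) hy
  have : T.tens j = T.tens (j + y) - T.tens y := by rw [map_add]; abel
  rw [this]
  exact (N.carrier _ _).sub_mem hx' (hN m n y hy)

/-- If `⊗ 1` is injective modulo `N` on the ideal `R`, then it does not decrease the distance to
`N` of the positive elements of `R`. -/
theorem infDist_le_infDist_tens {R N : T.Ideal}
    (hRN : ∀ (m : ℕ) (x : T.Hom m m), x ∈ R.carrier m m →
      T.tens x ∈ N.carrier (m + 1) (m + 1) → x ∈ N.carrier m m)
    {m : ℕ} (x : T.Hom m m) (hx : star x * x ∈ R.carrier m m) :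
    Metric.infDist (star x * x) (N.carrier m m) ≤
      Metric.infDist (T.tens (star x * x)) (N.carrier (m + 1) (m + 1)) := by
  set y : T.Hom m m := star x * x with hy
  have hy0 : 0 ≤ y := star_mul_self_nonneg x
  have hys : IsSelfAdjoint y := IsSelfAdjoint.of_nonneg hy0
  refine le_of_forall_gt_imp_ge_of_dense fun c hc => ?_
  obtain ⟨i, hi, hyi⟩ := (Metric.infDist_lt_iff ⟨0, (N.carrier (m + 1) (m + 1)).zero_mem⟩).1 hc
  rw [dist_eq_norm] at hyi
  have hc0 : 0 < c := (norm_nonneg _).trans_lt hyi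
  -- If `y ⊗ 1` is within distance less than `c` of `N`, then `(y ⊗ 1 - c)₊ = (y - c)₊ ⊗ 1` is in
  -- `N`. The element `(y - c)₊` is a multiple of `y`, hence in `R`, so it is itself in `N`, and it
  -- is within `c` of `y`.
  let f : ℝ → ℝ := fun t => max (t - c) 0
  let k : ℝ → ℝ := fun t => max (t - c) 0 / max t c
  have hfc : Continuous f := by fun_prop
  have hkc : Continuous k := Continuous.div (by fun_prop) (by fun_prop) fun t =>
    (lt_max_of_lt_right hc0).ne'
  have hf0 : f 0 = 0 := by simp [f, hc0.le]
  have hk0 : k 0 = 0 := by simp [k, hc0.le]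
  have h1 : T.tens (cfcₙ f y) ∈ N.carrier (m + 1) (m + 1) := by
    have e : T.tens (cfcₙ f y) = cfcₙ f (tensHom T m y) :=
      NonUnitalStarAlgHom.map_cfcₙ (tensHom T m) f y hfc.continuousOn hf0
        (continuous_tens (T := T)) hys (hys.map _)
    rw [e]
    exact IsClosedIdeal.cfcₙ_sub_posPart_mem (isClosedIdeal_carrier N (m + 1)) (hys.map _) hi hyi
  have h2 : cfcₙ f y ∈ R.carrier m m := by
    have e : cfcₙ f y = y * cfcₙ k y := by
      have : y * cfcₙ k y = cfcₙ (fun t : ℝ => t) y * cfcₙ k y := by rw [cfcₙ_id' ℝ y]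
      rw [this, ← cfcₙ_mul (fun t : ℝ => t) k y (by fun_prop) rfl hkc.continuousOn hk0]
      refine cfcₙ_congr fun t _ => ?_
      simp only [f, k]
      rcases le_total t c with h | h
      · simp [h]
      · have h0 : 0 < t := hc0.trans_le h
        rw [max_eq_left h]
        field_simp
    rw [e]
    exact R.comp_mem_right _ hx
  refine (Metric.infDist_le_dist_of_mem (hRN m _ h2 h1)).trans ?_
  rw [dist_eq_norm]
  exact IsClosedIdeal.norm_sub_cfcₙ_sub_posPart_le hy0 hc0.le

/-- `x* t* t x ≤ ‖t‖² x* x`. -/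
theorem exists_norm_sq_smul_sub_eq {l m n : ℕ} (t : T.Hom m n) (x : T.Hom l m) :
    ∃ s : T.Hom l l, ((‖t‖ ^ 2 : ℝ) : ℂ) • T.comp (T.adj x) x -
      T.comp (T.adj (T.comp t x)) (T.comp t x) = star s * s := by
  obtain ⟨t', ht'⟩ := T.adj_comp_self_pos t
  set y : T.Hom m m := star t' * t' with hy
  have hyt : T.comp (T.adj t) t = y := ht'
  have hys : IsSelfAdjoint y := IsSelfAdjoint.star_mul_self t'
  have hyn : ‖y‖ = ‖t‖ ^ 2 := by rw [← hyt, T.norm_adj_comp_self]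
  set r : ℝ := ‖t‖ with hr
  -- The wanted square root is that of `r² - y`. Subtracting the constant `r` makes the function
  -- vanish at `0`, so that it exists in the nonunital calculus. Then formally `(r + b)² = r² - y`,
  -- and the difference is the square of `r x + b x`.
  let g : ℝ → ℝ := fun s => √(r ^ 2 - s) - r
  have hgc : Continuous g := by fun_prop
  have hg0 : g 0 = 0 := by simp [g, hr]
  set b : T.Hom m m := cfcₙ g y with hb
  have hbs : T.adj b = b := cfcₙ_predicate g y
  have hb2 : b * b + (2 * r) • b = - y := by
    have e1 : -y = cfcₙ (fun s : ℝ => -s) y := by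
      rw [cfcₙ_neg (R := ℝ) (fun s : ℝ => s) y, cfcₙ_id' ℝ y]
    rw [e1, hb, ← cfcₙ_mul g g y, ← cfcₙ_smul (2 * r) g y, ← cfcₙ_add (R := ℝ) (fun s => g s * g s)
      (fun s => (2 * r) • g s) y (by fun_prop) (by simp [hg0]) (by fun_prop) (by simp [hg0])]
    refine cfcₙ_congr fun s hs => ?_
    have hsn : |s| ≤ r ^ 2 := by
      have := norm_apply_le_norm_cfcₙ (𝕜 := ℝ) (fun t : ℝ => t) y hs (by fun_prop) rfl
      rwa [cfcₙ_id' ℝ y, Real.norm_eq_abs, hyn] at this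
    have h0 : 0 ≤ r ^ 2 - s := by linarith [le_abs_self s]
    have := Real.mul_self_sqrt h0
    simp only [g, smul_eq_mul]
    linear_combination this
  have hpos := T.adj_comp_self_pos ((r : ℂ) • x + T.comp b x)
  obtain ⟨s, hs⟩ := hpos
  refine ⟨s, ?_⟩
  have hs' : star s * s = T.comp (T.adj s) s := rfl
  rw [hs', ← hs]
  have hyb : T.comp (T.adj t) t = - (T.comp b b) - ((2 * r : ℝ) : ℂ) • b := by
    have : b * b + ((2 * r : ℝ) : ℂ) • b = -y := by
      rw [← hb2]
      congr 1
    rw [hyt, ← neg_neg y, ← this, mul_def]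
    abel
  have e3 : T.comp (T.adj (T.comp t x)) (T.comp t x) =
      T.comp (T.adj x) (T.comp (T.comp (T.adj t) t) x) := by
    simp only [T.adj_comp, T.comp_assoc]
  rw [e3, hyb]
  simp only [map_add, map_sub, map_neg, T.adj_comp, hbs, LinearMap.map_smulₛₗ, LinearMap.add_apply,
    LinearMap.sub_apply, LinearMap.neg_apply, LinearMap.smul_apply, map_smul, T.comp_assoc,
    Complex.conj_ofReal, smul_add, smul_smul]
  push_cast
  module

end CStarPrecategory

/-! ### Toeplitz matrices -/

namespace CStarPrecategory

variable {T : CStarPrecategory.{u}}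

/-- The matrix with the only nonzero entry `a`. -/
def entry {m n : ℕ} (a : T.Hom m n) : ∀ i j : ℕ, T.Hom i j := Pi.single m (Pi.single n a)

theorem entry_same {m n : ℕ} (a : T.Hom m n) : entry a m n = a := by simp [entry]

theorem entry_of_ne {m n : ℕ} (a : T.Hom m n) {i j : ℕ} (h : ¬(i = m ∧ j = n)) :
    entry a i j = 0 := by
  unfold entry
  by_cases hi : i = m
  · subst hi
    rw [Pi.single_eq_same, Pi.single_eq_of_ne fun hj => h ⟨rfl, hj⟩]
  · rw [Pi.single_eq_of_ne hi]
    rfl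

theorem entry_add {m n : ℕ} (a b : T.Hom m n) : entry (a + b) = entry a + entry b := by
  simp only [entry, Pi.single_add]

theorem entry_smul {m n : ℕ} (c : ℂ) (a : T.Hom m n) : entry (c • a) = c • entry a := by
  simp only [entry, Pi.single_smul]

/-- The Toeplitz matrix with the entries `a ⊗ 1^k` at `(m + k, n + k)`. -/
def toeplitz {m n : ℕ} (a : T.Hom m n) : ∀ i j : ℕ, T.Hom i j := partialSum (entry a)

theorem toeplitz_add {m n : ℕ} (a b : T.Hom m n) : toeplitz (a + b) = toeplitz a + toeplitz b := by
  rw [toeplitz, entry_add, partialSum_add]; rfl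

theorem toeplitz_smul {m n : ℕ} (c : ℂ) (a : T.Hom m n) : toeplitz (c • a) = c • toeplitz a := by
  rw [toeplitz, entry_smul, partialSum_smul]; rfl

theorem toeplitz_eq_zero {m n : ℕ} (a : T.Hom m n) {i j : ℕ} (h : ¬(i + n = j + m ∧ m ≤ i)) :
    toeplitz a i j = 0 := by
  induction i generalizing j with
  | zero => exact entry_of_ne a (by omega)
  | succ i ih =>
    cases j with
    | zero => exact entry_of_ne a (by omega)
    | succ j =>
      change entry a (i + 1) (j + 1) + T.tens (toeplitz a i j) = 0
      rw [entry_of_ne a (by omega), ih (by omega), map_zero, add_zero]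

theorem toeplitz_succ {m n : ℕ} (a : T.Hom m n) {i j : ℕ} (h : m ≤ i) :
    toeplitz a (i + 1) (j + 1) = T.tens (toeplitz a i j) := by
  change entry a (i + 1) (j + 1) + T.tens (toeplitz a i j) = _
  rw [entry_of_ne a (by omega), zero_add]

theorem toeplitz_same {m n : ℕ} (a : T.Hom m n) : toeplitz a m n = a := by
  have h := partialSum_eq (entry a) m n
  rw [entry_same] at h
  rw [toeplitz, h]
  cases m with
  | zero => cases n <;> exact add_zero a
  | succ m =>
    cases n with
    | zero => exact add_zero a
    | succ n =>
      change a + T.tens (toeplitz a m n) = a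
      rw [toeplitz_eq_zero a (by omega), map_zero, add_zero]

theorem toeplitz_add_right {m n : ℕ} (a : T.Hom m n) (k : ℕ) :
    toeplitz a (m + k) (n + k) = T.tensPow k a := by
  induction k with
  | zero => exact toeplitz_same a
  | succ k ih =>
    change toeplitz a (m + k + 1) (n + k + 1) = T.tens (T.tensPow k a)
    rw [toeplitz_succ a (by omega), ih]

/-- The Toeplitz matrices of `a` and of `a ⊗ 1` differ at a single position, which is the whole
obstruction to coisometry. -/
theorem toeplitz_eq_entry_add {m n : ℕ} (a : T.Hom m n) (i j : ℕ) :
    toeplitz a i j = entry a i j + toeplitz (T.tens a) i j := by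
  by_cases h : i + n = j + m ∧ m ≤ i
  · obtain ⟨k, rfl⟩ := Nat.exists_eq_add_of_le h.2
    obtain rfl : j = n + k := by omega
    cases k with
    | zero =>
      change toeplitz a m n = entry a m n + toeplitz (T.tens a) m n
      rw [toeplitz_same, entry_same, toeplitz_eq_zero (T.tens a) (by omega), add_zero]
    | succ k =>
      clear h
      rw [entry_of_ne a (by omega), zero_add]
      induction k with
      | zero =>
        change toeplitz a (m + 1) (n + 1) = toeplitz (T.tens a) (m + 1) (n + 1)
        rw [toeplitz_same, toeplitz_succ a le_rfl, toeplitz_same]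
      | succ k ih =>
        change toeplitz a (m + (k + 1) + 1) (n + (k + 1) + 1) =
          toeplitz (T.tens a) (m + (k + 1) + 1) (n + (k + 1) + 1)
        rw [toeplitz_succ a (by omega), ih, toeplitz_succ (T.tens a) (by omega)]
  · rw [toeplitz_eq_zero a h, entry_of_ne a (by omega), toeplitz_eq_zero _ (by omega), add_zero]

theorem norm_toeplitz_le {m n : ℕ} (a : T.Hom m n) (i j : ℕ) : ‖toeplitz a i j‖ ≤ ‖a‖ := by
  by_cases h : i + n = j + m ∧ m ≤ i
  · obtain ⟨k, rfl⟩ := Nat.exists_eq_add_of_le h.2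
    obtain rfl : j = n + k := by omega
    clear h
    induction k with
    | zero => exact (congrArg norm (toeplitz_same a)).le
    | succ k ih =>
      change ‖toeplitz a (m + k + 1) (n + k + 1)‖ ≤ _
      rw [toeplitz_succ a (by omega)]
      exact (norm_tens_le _).trans ih
  · rw [toeplitz_eq_zero a h, norm_zero]
    exact norm_nonneg a

theorem toeplitz_adj {m n : ℕ} (a : T.Hom m n) (i j : ℕ) :
    toeplitz (T.adj a) j i = T.adj (toeplitz a i j) := by
  by_cases h : i + n = j + m ∧ m ≤ i
  · obtain ⟨k, rfl⟩ := Nat.exists_eq_add_of_le h.2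
    obtain rfl : j = n + k := by omega
    clear h
    induction k with
    | zero =>
      change toeplitz (T.adj a) n m = T.adj (toeplitz a m n)
      rw [toeplitz_same, toeplitz_same]
    | succ k ih =>
      change toeplitz (T.adj a) (n + k + 1) (m + k + 1) = T.adj (toeplitz a (m + k + 1) (n + k + 1))
      rw [toeplitz_succ a (by omega), toeplitz_succ _ (by omega), ih, T.tens_adj]
  · rw [toeplitz_eq_zero a h, toeplitz_eq_zero _ (by omega), map_zero]

theorem toeplitz_mem {N : T.Ideal} (hN : N.IsInvariant) {m n : ℕ} {a : T.Hom m n}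
    (ha : a ∈ N.carrier m n) (i j : ℕ) : toeplitz a i j ∈ N.carrier i j := by
  by_cases h : i + n = j + m ∧ m ≤ i
  · obtain ⟨k, rfl⟩ := Nat.exists_eq_add_of_le h.2
    obtain rfl : j = n + k := by omega
    clear h
    induction k with
    | zero =>
      change toeplitz a m n ∈ N.carrier m n
      rwa [toeplitz_same]
    | succ k ih =>
      change toeplitz a (m + k + 1) (n + k + 1) ∈ N.carrier (m + k + 1) (n + k + 1)
      rw [toeplitz_succ a (by omega)]
      exact hN _ _ _ ih
  · rw [toeplitz_eq_zero a h]
    exact (N.carrier i j).zero_mem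

/-- The relation `π(a) π(b) = π((a ⊗ 1^k) b)` in terms of Toeplitz matrices. Both sides vanish
before the first column where `b` acts. -/
theorem toeplitz_comp {l m n k : ℕ} (a : T.Hom m n) (b : T.Hom l (m + k)) {p q j : ℕ}
    (h1 : p + (m + k) = q + l) (h2 : q + n = j + m) :
    toeplitz (T.comp (T.tensPow k a) b) p j = T.comp (toeplitz a q j) (toeplitz b p q) := by
  by_cases h : l ≤ p
  · obtain ⟨r, rfl⟩ := Nat.exists_eq_add_of_le h
    obtain rfl : q = m + k + r := by omega
    obtain rfl : j = n + k + r := by omega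
    clear h1 h2 h
    induction r with
    | zero =>
      change toeplitz (T.comp (T.tensPow k a) b) l (n + k) =
        T.comp (toeplitz a (m + k) (n + k)) (toeplitz b l (m + k))
      rw [toeplitz_same, toeplitz_same, toeplitz_add_right]
    | succ r ih =>
      change toeplitz (T.comp (T.tensPow k a) b) (l + r + 1) (n + k + r + 1) =
        T.comp (toeplitz a (m + k + r + 1) (n + k + r + 1))
          (toeplitz b (l + r + 1) (m + k + r + 1))
      rw [toeplitz_succ _ (by omega), toeplitz_succ _ (by omega), toeplitz_succ _ (by omega), ih,
        T.tens_comp]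
  · rw [toeplitz_eq_zero b (by omega), toeplitz_eq_zero _ (by omega), map_zero]

/-- A matrix in `M(m,n)` is the sum of its entries. -/
theorem partialSum_eq_sum_toeplitz {K : T.Ideal} {m n : ℕ} {a : ∀ i j : ℕ, T.Hom i j}
    (ha : a ∈ band K m n) (p q : ℕ) :
    partialSum a p q = ∑ i ∈ Finset.range (m + 1), ∑ j ∈ Finset.range (n + 1),
      toeplitz (a i j) p q := by
  have e : a = ∑ i ∈ Finset.range (m + 1), ∑ j ∈ Finset.range (n + 1), entry (a i j) := by
    funext p q
    simp only [Finset.sum_apply]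
    by_cases h : p ≤ m ∧ q ≤ n
    · rw [Finset.sum_eq_single_of_mem p (Finset.mem_range.2 (by omega)) fun i _ hi =>
        Finset.sum_eq_zero fun j _ => entry_of_ne _ (by omega),
        Finset.sum_eq_single_of_mem q (Finset.mem_range.2 (by omega)) fun j _ hj =>
          entry_of_ne _ (by omega), entry_same]
    · rw [ha.2 p q (by omega)]
      refine (Finset.sum_eq_zero fun i hi => Finset.sum_eq_zero fun j hj => ?_).symm
      have := Finset.mem_range.1 hi
      have := Finset.mem_range.1 hj
      exact entry_of_ne _ (by omega)
  let S : (∀ i j : ℕ, T.Hom i j) →+ (∀ i j : ℕ, T.Hom i j) :=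
    { toFun := partialSum
      map_zero' := by
        have := partialSum_smul (T := T) 0 0
        simpa using this
      map_add' := partialSum_add }
  have h2 : partialSum a = ∑ i ∈ Finset.range (m + 1), ∑ j ∈ Finset.range (n + 1),
      toeplitz (a i j) := by
    conv_lhs => rw [e]
    change S _ = _
    simp only [map_sum]
    rfl
  rw [h2]
  simp only [Finset.sum_apply]

end CStarPrecategory

/-! ### Representations on Hilbert spaces -/

namespace CStarPrecategory

variable {T : CStarPrecategory.{u}}

/-- The limit along the hyperfilter. -/
def hyperLim (f : ℕ → ℂ) : ℂ := Filter.limUnder (Filter.hyperfilter ℕ : Filter ℕ) f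

/-- A bounded sequence stays in a compact ball, where every ultrafilter converges. -/
theorem tendsto_hyperLim {f : ℕ → ℂ} (h : ∃ C, ∀ k, ‖f k‖ ≤ C) :
    Filter.Tendsto f (Filter.hyperfilter ℕ : Filter ℕ) (nhds (hyperLim f)) := by
  obtain ⟨C, hC⟩ := h
  obtain ⟨x, -, hx⟩ := (isCompact_closedBall (0 : ℂ) C).ultrafilter_le_nhds
    ((Filter.hyperfilter ℕ).map f) (Filter.tendsto_principal.2
      (Filter.Eventually.of_forall fun k => by simpa using hC k))
  exact tendsto_nhds_limUnder ⟨x, hx⟩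

theorem eventually_hyperfilter {p : ℕ → Prop} (h : ∀ᶠ k in Filter.atTop, p k) :
    ∀ᶠ k in (Filter.hyperfilter ℕ : Filter ℕ), p k :=
  Nat.hyperfilter_le_atTop h

theorem hyperLim_eq {f : ℕ → ℂ} {c : ℂ}
    (h : Filter.Tendsto f (Filter.hyperfilter ℕ : Filter ℕ) (nhds c)) : hyperLim f = c :=
  h.limUnder_eq

theorem sum_toeplitz_comp {l m n : ℕ} (a : T.Hom m n) (v : ∀ i, T.Hom l i) {s : Finset ℕ}
    {i j : ℕ} (hi : i ∈ s) (h : i + n = j + m) :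
    ∑ i ∈ s, T.comp (toeplitz a i j) (v i) = T.comp (toeplitz a i j) (v i) :=
  Finset.sum_eq_single_of_mem i hi fun i' _ h' => by
    rw [toeplitz_eq_zero a (by omega)]; simp

theorem sum_toeplitz_comp_eq_zero {l m n : ℕ} (a : T.Hom m n) (v : ∀ i, T.Hom l i)
    {s : Finset ℕ} {j : ℕ} (h : ∀ i ∈ s, i + n ≠ j + m) :
    ∑ i ∈ s, T.comp (toeplitz a i j) (v i) = 0 :=
  Finset.sum_eq_zero fun i hi => by
    rw [toeplitz_eq_zero a fun h' => h i hi h'.1]; simp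

/-- A sequence of positive functionals that kill `N`, and that kill `J` unless their objects tend
to infinity. -/
structure FunctionalSeq (J N : T.Ideal) where
  obj : ℕ → ℕ
  fn : ∀ k, T.Hom (obj k) (obj k) →ₗ[ℂ] ℂ
  nonneg : ∀ k b, 0 ≤ (fn k (star b * b)).re
  map_star : ∀ k b, fn k (star b) = star (fn k b)
  norm_le : ∀ k b, ‖fn k b‖ ≤ 2 * ‖b‖
  eq_zero : ∀ k, ∀ x ∈ N.carrier (obj k) (obj k), fn k x = 0
  eventually : ∀ m, ∀ᶠ k in Filter.atTop,
    m < obj k ∨ ∀ x ∈ J.carrier (obj k) (obj k), fn k x = 0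

namespace FunctionalSeq

variable {J N : T.Ideal} (σ : FunctionalSeq J N)

theorem re_nonneg {k n : ℕ} (x : T.Hom (σ.obj k) n) :
    0 ≤ (σ.fn k (T.comp (T.adj x) x)).re := by
  obtain ⟨b, hb⟩ := T.adj_comp_self_pos x
  rw [hb]
  exact σ.nonneg k b

/-- Positivity of the functional applied to `x* t* t x ≤ ‖t‖² x* x`. It gives boundedness of the
action. -/
theorem re_comp_le {k m n : ℕ} (t : T.Hom m n) (x : T.Hom (σ.obj k) m) :
    (σ.fn k (T.comp (T.adj (T.comp t x)) (T.comp t x))).re ≤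
      ‖t‖ ^ 2 * (σ.fn k (T.comp (T.adj x) x)).re := by
  obtain ⟨s, hs⟩ := exists_norm_sq_smul_sub_eq t x
  have := σ.nonneg k s
  rw [← hs, map_sub, map_smul, smul_eq_mul, Complex.sub_re, Complex.re_ofReal_mul] at this
  linarith

/-- Bounded sequences of vectors whose supports are uniformly close to the objects. -/
def vectors : Submodule ℂ (∀ k n : ℕ, T.Hom (σ.obj k) n) where
  carrier := {x | (∃ C, ∀ k n, ‖x k n‖ ≤ C) ∧
    ∃ D, ∀ k n, ¬(σ.obj k ≤ n + D ∧ n ≤ σ.obj k + D) → x k n = 0}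
  zero_mem' := ⟨⟨0, fun k n => by simp⟩, 0, fun k n _ => rfl⟩
  add_mem' := by
    rintro x y ⟨⟨C, hC⟩, D, hD⟩ ⟨⟨C', hC'⟩, D', hD'⟩
    refine ⟨⟨C + C', fun k n => (norm_add_le _ _).trans (add_le_add (hC k n) (hC' k n))⟩,
      D + D', fun k n h => ?_⟩
    change x k n + y k n = 0
    rw [hD k n (by omega), hD' k n (by omega), add_zero]
  smul_mem' := by
    rintro c x ⟨⟨C, hC⟩, D, hD⟩
    refine ⟨⟨‖c‖ * C, fun k n => ?_⟩, D, fun k n h => ?_⟩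
    · change ‖c • x k n‖ ≤ _
      rw [norm_smul]
      exact mul_le_mul_of_nonneg_left (hC k n) (norm_nonneg c)
    · change c • x k n = 0
      rw [hD k n h, smul_zero]

/-- The pre-Hilbert space on which `T` is represented. -/
def PreHilbert : Type u := σ.vectors

instance : AddCommGroup σ.PreHilbert := inferInstanceAs (AddCommGroup σ.vectors)

instance : Module ℂ σ.PreHilbert := inferInstanceAs (Module ℂ σ.vectors)

variable {σ} in
theorem PreHilbert.ext {x y : σ.PreHilbert} (h : ∀ k n, x.1 k n = y.1 k n) : x = y :=
  Subtype.ext (funext fun k => funext fun n => h k n)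

/-- The terms of the sequence whose limit is the inner product. -/
def form (x y : σ.PreHilbert) (k : ℕ) : ℂ :=
  ∑ n ∈ Finset.range (σ.obj k + k + 1), σ.fn k (T.comp (T.adj (x.1 k n)) (y.1 k n))

/-- The support of `x k` lies within distance `D` of `obj k`, so at most `2 D + 1` terms are
nonzero, uniformly in `k`. -/
theorem exists_norm_form_le (x y : σ.PreHilbert) : ∃ C, ∀ k, ‖σ.form x y k‖ ≤ C := by
  obtain ⟨⟨C, hC⟩, D, hD⟩ := x.2
  obtain ⟨⟨C', hC'⟩, -⟩ := y.2
  have hC0 : 0 ≤ C := (norm_nonneg _).trans (hC 0 0)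
  have hC0' : 0 ≤ C' := (norm_nonneg _).trans (hC' 0 0)
  refine ⟨(2 * D + 1 : ℕ) * (2 * (C * C')), fun k => ?_⟩
  have h1 : ∀ n ∈ Finset.range (σ.obj k + k + 1),
      ‖σ.fn k (T.comp (T.adj (x.1 k n)) (y.1 k n))‖ ≤
        if σ.obj k ≤ n + D ∧ n ≤ σ.obj k + D then 2 * (C * C') else 0 := by
    intro n _
    split_ifs with h
    · refine (σ.norm_le k _).trans (mul_le_mul_of_nonneg_left ?_ zero_le_two)
      refine (T.norm_comp_le _ _).trans (mul_le_mul ?_ (hC' k n) (norm_nonneg _) hC0)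
      rw [norm_adj]
      exact hC k n
    · rw [hD k n h]
      simp
  refine (norm_sum_le_of_le _ h1).trans ?_
  rw [← Finset.sum_filter, Finset.sum_const, nsmul_eq_mul]
  refine mul_le_mul_of_nonneg_right ?_ (by positivity)
  refine Nat.cast_le.2 ((Finset.card_le_card (t := Finset.Icc (σ.obj k - D) (σ.obj k + D))
    fun n hn => ?_).trans ?_)
  · have := (Finset.mem_filter.1 hn).2
    exact Finset.mem_Icc.2 ⟨by omega, by omega⟩
  · rw [Nat.card_Icc]
    omega

theorem tendsto_form (x y : σ.PreHilbert) :
    Filter.Tendsto (σ.form x y) (Filter.hyperfilter ℕ : Filter ℕ)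
      (nhds (hyperLim (σ.form x y))) :=
  tendsto_hyperLim (σ.exists_norm_form_le x y)

/-- The positive semidefinite inner product. -/
abbrev core : PreInnerProductSpace.Core ℂ σ.PreHilbert where
  inner x y := hyperLim (σ.form x y)
  conj_inner_symm x y := by
    refine (hyperLim_eq (f := σ.form x y) ?_).symm
    refine ((Complex.continuous_conj.tendsto _).comp (σ.tendsto_form y x)).congr fun k => ?_
    simp only [Function.comp, form, map_sum]
    refine Finset.sum_congr rfl fun n _ => ?_
    have h := σ.map_star k (T.comp (T.adj (y.1 k n)) (x.1 k n))
    rw [star_def, T.adj_comp, T.adj_adj] at h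
    exact h.symm
  re_inner_nonneg x := by
    have h := (Complex.continuous_re.tendsto _).comp (σ.tendsto_form x x)
    refine ge_of_tendsto' h fun k => ?_
    simp only [Function.comp, form, Complex.re_sum]
    exact Finset.sum_nonneg fun n _ => σ.re_nonneg _
  add_left x y z := by
    refine hyperLim_eq (((σ.tendsto_form x z).add (σ.tendsto_form y z)).congr fun k => ?_)
    simp only [form, ← Finset.sum_add_distrib]
    refine Finset.sum_congr rfl fun n _ => ?_
    change _ = σ.fn k (T.comp (T.adj (x.1 k n + y.1 k n)) (z.1 k n))
    simp only [map_add, LinearMap.add_apply]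
  smul_left x y c := by
    refine hyperLim_eq (((σ.tendsto_form x y).const_mul ((starRingEnd ℂ) c)).congr fun k => ?_)
    simp only [form, Finset.mul_sum]
    refine Finset.sum_congr rfl fun n _ => ?_
    change _ = σ.fn k (T.comp (T.adj (c • x.1 k n)) (y.1 k n))
    simp only [LinearMap.map_smulₛₗ, LinearMap.smul_apply, smul_eq_mul, map_smul]

instance : SeminormedAddCommGroup σ.PreHilbert :=
  InnerProductSpace.Core.toSeminormedAddCommGroup (c := σ.core)

instance : InnerProductSpace ℂ σ.PreHilbert := InnerProductSpace.ofCore σ.core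

theorem inner_def (x y : σ.PreHilbert) : inner ℂ x y = hyperLim (σ.form x y) := rfl

theorem tendsto_re_form (x : σ.PreHilbert) :
    Filter.Tendsto (fun k => (σ.form x x k).re) (Filter.hyperfilter ℕ : Filter ℕ)
      (nhds (‖x‖ ^ 2)) := by
  have h := (Complex.continuous_re.tendsto _).comp (σ.tendsto_form x x)
  have e : ‖x‖ ^ 2 = (hyperLim (σ.form x x)).re := by
    rw [← σ.inner_def]
    exact norm_sq_eq_re_inner (𝕜 := ℂ) x
  rw [e]
  exact h

/-- The hyperfilter refines the cofinite filter, so only the tail in `k` matters for the norm. -/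
theorem norm_eq_zero_of_eventually {x : σ.PreHilbert}
    (h : ∀ᶠ k in Filter.atTop, ∀ n, σ.fn k (T.comp (T.adj (x.1 k n)) (x.1 k n)) = 0) :
    ‖x‖ = 0 := by
  have h1 : Filter.Tendsto (fun k => (σ.form x x k).re) (Filter.hyperfilter ℕ : Filter ℕ)
      (nhds 0) := by
    refine tendsto_const_nhds.congr' ?_
    filter_upwards [eventually_hyperfilter h] with k hk
    simp [form, hk]
  exact pow_eq_zero_iff two_ne_zero |>.1 (tendsto_nhds_unique (σ.tendsto_re_form x) h1)

/-- The action of `a` by its Toeplitz matrix. -/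
def act {m n : ℕ} (a : T.Hom m n) : σ.PreHilbert →ₗ[ℂ] σ.PreHilbert where
  toFun x := ⟨fun k j => ∑ i ∈ Finset.range (j + m + 1), T.comp (toeplitz a i j) (x.1 k i), by
    obtain ⟨⟨C, hC⟩, D, hD⟩ := x.2
    have hC0 : 0 ≤ C := (norm_nonneg _).trans (hC 0 0)
    refine ⟨⟨‖a‖ * C, fun k j => ?_⟩, D + m + n, fun k j h => ?_⟩
    · change ‖∑ i ∈ Finset.range (j + m + 1), T.comp (toeplitz a i j) (x.1 k i)‖ ≤ _
      by_cases h : n ≤ j + m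
      · obtain ⟨i, hi⟩ := Nat.exists_eq_add_of_le' h
        refine (congrArg norm (sum_toeplitz_comp a (x.1 k) (Finset.mem_range.2 (by omega))
          hi.symm)).trans_le ?_
        exact (T.norm_comp_le _ _).trans (mul_le_mul (norm_toeplitz_le a i j) (hC k i)
          (norm_nonneg _) (norm_nonneg _))
      · refine (congrArg norm (sum_toeplitz_comp_eq_zero a (x.1 k) fun i _ => by omega)).trans_le ?_
        simpa using mul_nonneg (norm_nonneg a) hC0
    · refine Finset.sum_eq_zero fun i _ => ?_
      by_cases hi : i + n = j + m
      · rw [hD k i (by omega), map_zero]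
      · rw [toeplitz_eq_zero a fun h' => hi h'.1]
        simp⟩
  map_add' x y := PreHilbert.ext fun k j => by
    change ∑ i ∈ Finset.range (j + m + 1), T.comp (toeplitz a i j) (x.1 k i + y.1 k i) =
      (∑ i ∈ Finset.range (j + m + 1), T.comp (toeplitz a i j) (x.1 k i)) +
      ∑ i ∈ Finset.range (j + m + 1), T.comp (toeplitz a i j) (y.1 k i)
    simp only [map_add, Finset.sum_add_distrib]
  map_smul' c x := PreHilbert.ext fun k j => by
    change ∑ i ∈ Finset.range (j + m + 1), T.comp (toeplitz a i j) (c • x.1 k i) =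
      c • ∑ i ∈ Finset.range (j + m + 1), T.comp (toeplitz a i j) (x.1 k i)
    simp only [map_smul, Finset.smul_sum]

theorem act_apply {m n i j : ℕ} (a : T.Hom m n) (x : σ.PreHilbert) (k : ℕ) (h : i + n = j + m) :
    (σ.act a x).1 k j = T.comp (toeplitz a i j) (x.1 k i) :=
  sum_toeplitz_comp a (x.1 k) (Finset.mem_range.2 (by omega)) h

theorem act_apply_eq_zero {m n j : ℕ} (a : T.Hom m n) (x : σ.PreHilbert) (k : ℕ)
    (h : j + m < n) : (σ.act a x).1 k j = 0 :=
  sum_toeplitz_comp_eq_zero a (x.1 k) (s := Finset.range (j + m + 1)) fun i _ => by omega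

theorem act_apply_eq_sum {m n : ℕ} (a : T.Hom m n) (x : σ.PreHilbert) {k R : ℕ} (j : ℕ)
    (h : ∀ i, R ≤ i → x.1 k i = 0) :
    (σ.act a x).1 k j = ∑ i ∈ Finset.range R, T.comp (toeplitz a i j) (x.1 k i) := by
  by_cases hi : n ≤ j + m
  · obtain ⟨i, hi⟩ := Nat.exists_eq_add_of_le' hi
    rw [σ.act_apply a x k hi.symm]
    by_cases hR : i < R
    · exact (sum_toeplitz_comp a (x.1 k) (Finset.mem_range.2 hR) hi.symm).symm
    · rw [h i (by omega), map_zero]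
      exact (sum_toeplitz_comp_eq_zero a (x.1 k) fun i' hi' => by
        have := Finset.mem_range.1 hi'
        omega).symm
  · rw [σ.act_apply_eq_zero a x k (by omega)]
    exact (sum_toeplitz_comp_eq_zero a (x.1 k) fun i _ => by omega).symm

/-- Explains the cutoff in `form`: the sum has a range independent of the vectors, yet for large `k`
it contains their whole support because the width `D` is fixed while the window grows with `k`. -/
theorem eventually_eq_zero (x : σ.PreHilbert) :
    ∀ᶠ k in Filter.atTop, ∀ i, σ.obj k + k + 1 ≤ i → x.1 k i = 0 := by
  obtain ⟨-, D, hD⟩ := x.2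
  filter_upwards [Filter.eventually_ge_atTop D] with k hk i hi
  exact hD k i (by omega)

/-- For large `k` the cutoff contains both supports. The claim is then the exchange of a double sum
and the fact that the adjoint of a Toeplitz matrix is the Toeplitz matrix of the adjoint. -/
theorem inner_act {m n : ℕ} (a : T.Hom m n) (x y : σ.PreHilbert) :
    inner ℂ (σ.act a x) y = inner ℂ x (σ.act (T.adj a) y) := by
  rw [inner_def, inner_def]
  refine hyperLim_eq ((σ.tendsto_form x (σ.act (T.adj a) y)).congr' ?_)
  filter_upwards [eventually_hyperfilter (σ.eventually_eq_zero x),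
    eventually_hyperfilter (σ.eventually_eq_zero y)] with k hx hy
  simp only [form, σ.act_apply_eq_sum a x _ hx, σ.act_apply_eq_sum (T.adj a) y _ hy, map_sum,
    LinearMap.sum_apply]
  rw [Finset.sum_comm]
  refine Finset.sum_congr rfl fun j _ => Finset.sum_congr rfl fun i _ => ?_
  rw [toeplitz_adj, T.adj_comp, T.comp_assoc]

/-- Each coordinate of `x k` is sent to at most one coordinate of the image, by a Toeplitz entry of
norm at most `‖a‖`, so the squares can be compared term by term. -/
theorem norm_act_le {m n : ℕ} (a : T.Hom m n) (x : σ.PreHilbert) :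
    ‖σ.act a x‖ ≤ ‖a‖ * ‖x‖ := by
  refine (sq_le_sq₀ (norm_nonneg _) (by positivity)).1 ?_
  rw [mul_pow]
  refine le_of_tendsto_of_tendsto (σ.tendsto_re_form _)
    ((σ.tendsto_re_form x).const_mul (‖a‖ ^ 2)) ?_
  filter_upwards [eventually_hyperfilter (σ.eventually_eq_zero x)] with k hx
  simp only [form, Complex.re_sum, Finset.mul_sum]
  set R := σ.obj k + k + 1
  let c : ℕ → ℝ := fun i => ‖a‖ ^ 2 * (σ.fn k (T.comp (T.adj (x.1 k i)) (x.1 k i))).re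
  have hc : ∀ i, 0 ≤ c i := fun i => mul_nonneg (by positivity) (σ.re_nonneg _)
  have h1 : ∀ j ∈ Finset.range R,
      (σ.fn k (T.comp (T.adj ((σ.act a x).1 k j)) ((σ.act a x).1 k j))).re ≤
        ∑ i ∈ Finset.range R, if i + n = j + m then c i else 0 := by
    intro j _
    have h0 : 0 ≤ ∑ i ∈ Finset.range R, if i + n = j + m then c i else 0 :=
      Finset.sum_nonneg fun i _ => by split_ifs; exacts [hc i, le_rfl]
    by_cases hi : n ≤ j + m
    · obtain ⟨i, hi⟩ := Nat.exists_eq_add_of_le' hi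
      rw [σ.act_apply a x k hi.symm]
      by_cases hR : i < R
      · refine ((σ.re_comp_le _ _).trans ?_).trans (Finset.single_le_sum (f := fun i =>
          if i + n = j + m then c i else 0) (fun i _ => by split_ifs; exacts [hc i, le_rfl])
          (Finset.mem_range.2 hR))
        simp only [hi, if_true, c]
        exact mul_le_mul_of_nonneg_right
          (pow_le_pow_left₀ (norm_nonneg _) (norm_toeplitz_le a i j) 2) (σ.re_nonneg _)
      · rw [hx i (by omega)]
        simpa using h0
    · rw [σ.act_apply_eq_zero a x k (by omega)]
      simpa using h0
  refine (Finset.sum_le_sum h1).trans ?_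
  rw [Finset.sum_comm]
  refine Finset.sum_le_sum fun i _ => ?_
  by_cases hi : m ≤ i + n
  · obtain ⟨j, hj⟩ := Nat.exists_eq_add_of_le' hi
    have : ∀ j', i + n = j' + m ↔ j = j' := fun j' => by omega
    simp only [this, Finset.sum_ite_eq]
    split_ifs
    exacts [le_rfl, hc i]
  · rw [Finset.sum_eq_zero fun j _ => if_neg (by omega)]
    exact hc i

theorem act_add {m n : ℕ} (a b : T.Hom m n) : σ.act (a + b) = σ.act a + σ.act b := by
  refine LinearMap.ext fun x => PreHilbert.ext fun k j => ?_
  change ∑ i ∈ Finset.range (j + m + 1), T.comp (toeplitz (a + b) i j) (x.1 k i) =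
    (∑ i ∈ Finset.range (j + m + 1), T.comp (toeplitz a i j) (x.1 k i)) +
      ∑ i ∈ Finset.range (j + m + 1), T.comp (toeplitz b i j) (x.1 k i)
  rw [← Finset.sum_add_distrib, toeplitz_add]
  simp only [Pi.add_apply, map_add, LinearMap.add_apply]

theorem act_smul {m n : ℕ} (c : ℂ) (a : T.Hom m n) : σ.act (c • a) = c • σ.act a := by
  refine LinearMap.ext fun x => PreHilbert.ext fun k j => ?_
  change ∑ i ∈ Finset.range (j + m + 1), T.comp (toeplitz (c • a) i j) (x.1 k i) =
    c • ∑ i ∈ Finset.range (j + m + 1), T.comp (toeplitz a i j) (x.1 k i)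
  rw [Finset.smul_sum, toeplitz_smul]
  simp only [Pi.smul_apply, map_smul, LinearMap.smul_apply]

theorem act_act {l m n r : ℕ} (a : T.Hom m n) (b : T.Hom l (m + r)) (x : σ.PreHilbert) :
    σ.act a (σ.act b x) = σ.act (T.comp (T.tensPow r a) b) x := by
  refine PreHilbert.ext fun k j => ?_
  by_cases hj : n ≤ j + m
  · obtain ⟨q, hq⟩ := Nat.exists_eq_add_of_le' hj
    rw [σ.act_apply a _ k hq.symm]
    by_cases hp : m + r ≤ q + l
    · obtain ⟨p, hp⟩ := Nat.exists_eq_add_of_le' hp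
      rw [σ.act_apply b x k hp.symm, σ.act_apply _ x k (show p + (n + r) = j + l by omega),
        toeplitz_comp a b hp.symm hq.symm, T.comp_assoc]
    · rw [σ.act_apply_eq_zero b x k (by omega), map_zero,
        σ.act_apply_eq_zero _ x k (by omega)]
  · rw [σ.act_apply_eq_zero a _ k (by omega)]
    by_cases hp : n + r ≤ j + l
    · obtain ⟨p, hp⟩ := Nat.exists_eq_add_of_le' hp
      rw [σ.act_apply _ x k hp.symm, toeplitz_eq_zero _ (by omega)]
      simp
    · rw [σ.act_apply_eq_zero _ x k (by omega)]

/-- The bounded operator by which `a` acts. -/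
def actL {m n : ℕ} (a : T.Hom m n) : σ.PreHilbert →L[ℂ] σ.PreHilbert :=
  (σ.act a).mkContinuous ‖a‖ (σ.norm_act_le a)

/-- The Hilbert space on which `T` is represented. -/
abbrev Hilbert : Type u := UniformSpace.Completion σ.PreHilbert

open UniformSpace (Completion)

variable {σ} in
theorem hilbert_ext {f g : σ.Hilbert →L[ℂ] σ.Hilbert}
    (h : ∀ x : σ.PreHilbert, f (x : σ.Hilbert) = g (x : σ.Hilbert)) : f = g :=
  ContinuousLinearMap.ext fun c => Completion.induction_on c
    (isClosed_eq f.continuous g.continuous) h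

theorem actL_completion_coe {m n : ℕ} (a : T.Hom m n) (x : σ.PreHilbert) :
    (σ.actL a).completion (x : σ.Hilbert) = (σ.act a x : σ.PreHilbert) := by
  simp [actL]

theorem coe_eq_coe {x y : σ.PreHilbert} (h : ‖x - y‖ = 0) : (x : σ.Hilbert) = y := by
  rw [← sub_eq_zero, ← norm_eq_zero, ← Completion.coe_sub, Completion.norm_coe, h]

/-- The representation defined by a sequence of functionals. -/
def rep (K : T.Ideal) : TensorRep K (σ.Hilbert →L[ℂ] σ.Hilbert) where
  toFun m n :=
    { toFun := fun a => (σ.actL (a : T.Hom m n)).completion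
      map_add' := fun a b => hilbert_ext fun x => by
        rw [_root_.add_apply, actL_completion_coe, actL_completion_coe,
          actL_completion_coe, ← Completion.coe_add, Submodule.coe_add, act_add]
        rfl
      map_smul' := fun c a => hilbert_ext fun x => by
        rw [RingHom.id_apply, _root_.smul_apply, actL_completion_coe,
          actL_completion_coe, ← Completion.coe_smul, Submodule.coe_smul, act_smul]
        rfl }
  map_adj {m n} a := by
    refine (ContinuousLinearMap.eq_adjoint_iff _ _).2 fun x y => ?_
    induction x, y using Completion.induction_on₂ with
    | hp => apply isClosed_eq <;> fun_prop
    | ih x y =>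
      change inner ℂ ((σ.actL _).completion (x : σ.Hilbert)) (y : σ.Hilbert) =
        inner ℂ (x : σ.Hilbert) ((σ.actL _).completion (y : σ.Hilbert))
      rw [actL_completion_coe, actL_completion_coe, Completion.inner_coe, Completion.inner_coe,
        inner_act, T.adj_adj]
  map_comp a b := hilbert_ext fun x => by
    change (σ.actL _).completion (x : σ.Hilbert) =
      (σ.actL _).completion ((σ.actL _).completion (x : σ.Hilbert))
    rw [actL_completion_coe, actL_completion_coe, actL_completion_coe]
    exact congrArg _ (σ.act_act (r := 0) _ _ x).symm
  map_tens k a b := hilbert_ext fun x => by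
    change (σ.actL _).completion ((σ.actL _).completion (x : σ.Hilbert)) =
      (σ.actL _).completion (x : σ.Hilbert)
    rw [actL_completion_coe, actL_completion_coe, actL_completion_coe]
    exact congrArg _ (σ.act_act _ _ x)

theorem rep_apply_coe (K : T.Ideal) {m n : ℕ} (a : K.carrier m n) (x : σ.PreHilbert) :
    (σ.rep K).toFun m n a (x : σ.Hilbert) = (σ.act (a : T.Hom m n) x : σ.PreHilbert) :=
  σ.actL_completion_coe _ x

/-- The operators of `a` and `a ⊗ 1` differ only by the entry `a` at `(m, n)`. For large `k` either
`obj k` exceeds `m + D`, so that `x k` has no coordinate at `m`, or the functional kills `J`, which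
contains the resulting products. -/
theorem rep_coisometric (K : T.Ideal) : (σ.rep K).IsCoisometricOn J := by
  intro m n a ha ha' haJ
  refine hilbert_ext fun x => ?_
  rw [rep_apply_coe, rep_apply_coe]
  refine σ.coe_eq_coe (σ.norm_eq_zero_of_eventually ?_)
  obtain ⟨-, D, hD⟩ := x.2
  filter_upwards [σ.eventually (m + D)] with k hk j
  have hz : (σ.act a x - σ.act (T.tens a) x).1 k j =
      (σ.act a x).1 k j - (σ.act (T.tens a) x).1 k j := rfl
  rw [hz]
  by_cases hj : n ≤ j + m
  · obtain ⟨i, hi⟩ := Nat.exists_eq_add_of_le' hj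
    rw [σ.act_apply a x k hi.symm, σ.act_apply (T.tens a) x k (show i + (n + 1) = j + (m + 1) by
      omega), toeplitz_eq_entry_add a i j, map_add, LinearMap.add_apply, add_sub_cancel_right]
    by_cases h : i = m ∧ j = n
    · obtain ⟨rfl, rfl⟩ := h
      rw [entry_same]
      rcases hk with hk | hk
      · rw [hD k i (by omega)]
        simp
      · exact hk _ (J.comp_mem_left _ (J.comp_mem_right _ haJ))
    · rw [entry_of_ne a h]
      simp
  · rw [σ.act_apply_eq_zero a x k (by omega), σ.act_apply_eq_zero _ x k (by omega)]
    simp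

/-- By invariance every Toeplitz entry of `a` is in `N`, which the functionals kill. -/
theorem rep_eq_zero (hN : N.IsInvariant) (K : T.Ideal) {m n : ℕ} (a : K.carrier m n)
    (ha : (a : T.Hom m n) ∈ N.carrier m n) : (σ.rep K).toFun m n a = 0 := by
  refine hilbert_ext fun x => ?_
  rw [rep_apply_coe, _root_.zero_apply, ← norm_eq_zero, Completion.norm_coe]
  refine σ.norm_eq_zero_of_eventually (Filter.Eventually.of_forall fun k j => ?_)
  by_cases hj : n ≤ j + m
  · obtain ⟨i, hi⟩ := Nat.exists_eq_add_of_le' hj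
    rw [σ.act_apply _ x k hi.symm]
    exact σ.eq_zero k _ (N.comp_mem_left _ (N.comp_mem_right _ (toeplitz_mem hN ha i j)))
  · rw [σ.act_apply_eq_zero _ x k (by omega)]
    simp

/-- The representation defined by a sequence of functionals, bundled. -/
def coisometricRep (K : T.Ideal) : CoisometricRep K J where
  B := σ.Hilbert →L[ℂ] σ.Hilbert
  rep := σ.rep K
  coisometric := σ.rep_coisometric K

end FunctionalSeq

end CStarPrecategory

/-! ### Separation of matrices by coisometric representations -/

namespace CStarPrecategory

variable {T : CStarPrecategory.{u}}

/-- The matrix acts through its partial sums. With `S` the partial sum at `(obj k, q k)` and `h = S*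
S`, the vector with coordinate `h` at `obj k` is sent to one with coordinate `S h` at `q k`, and `(S
h)* (S h) = h³`, on which the functionals are bounded below. -/
theorem FunctionalSeq.integrate_bandToO_ne_zero {J N : T.Ideal} (σ : FunctionalSeq J N)
    {K : T.Ideal} {m n : ℕ} (a : Band K J m n) (q : ℕ → ℕ) (hq : ∀ k, σ.obj k + n = q k + m)
    {C : ℝ} (hC : ∀ k, ‖partialSum a.1 (σ.obj k) (q k)‖ ≤ C) (h : ∀ k, T.Hom (σ.obj k) (σ.obj k))
    (hh : ∀ k, h k = T.comp (T.adj (partialSum a.1 (σ.obj k) (q k)))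
      (partialSum a.1 (σ.obj k) (q k)))
    {c : ℝ} (hc0 : 0 < c) (hc : ∀ k, c ≤ (σ.fn k (h k * h k * h k)).re) :
    integrate K J (σ.coisometricRep K) (bandToO K J a) ≠ 0 := by
  intro h0
  let x : σ.PreHilbert := ⟨fun k => Pi.single (σ.obj k) (h k), by
    have hC0 : 0 ≤ C := (norm_nonneg _).trans (hC 0)
    refine ⟨⟨C * C, fun k i => ?_⟩, 0, fun k i hi => ?_⟩
    · by_cases hi : i = σ.obj k
      · subst hi
        dsimp only
        rw [Pi.single_eq_same, hh]
        refine (T.norm_comp_le _ _).trans (mul_le_mul ?_ (hC k) (norm_nonneg _) hC0)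
        rw [norm_adj]
        exact hC k
      · dsimp only
        rw [Pi.single_eq_of_ne hi, norm_zero]
        positivity
    · exact Pi.single_eq_of_ne (by omega) _⟩
  have hx : ∀ k, x.1 k (σ.obj k) = h k := fun k => Pi.single_eq_same _ _
  let y : σ.PreHilbert := ∑ i ∈ Finset.range (m + 1), ∑ j ∈ Finset.range (n + 1),
    σ.act (a.1 i j) x
  have hy : ‖y‖ = 0 := by
    have e : integrate K J (σ.coisometricRep K) (bandToO K J a) =
        ∑ i ∈ Finset.range (m + 1), ∑ j ∈ Finset.range (n + 1),
          (σ.rep K).toFun i j ⟨a.1 i j, a.2.1 i j⟩ := by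
      simp only [bandToO, map_sum]
      rfl
    rw [e] at h0
    have h1 := congrArg (fun f : σ.Hilbert →L[ℂ] σ.Hilbert => f (x : σ.Hilbert)) h0
    simp only [_root_.sum_apply, rep_apply_coe] at h1
    have h2 : ((y : σ.PreHilbert) : σ.Hilbert) = 0 := by
      refine Eq.trans ?_ h1
      change UniformSpace.Completion.toComplL (𝕜 := ℂ) y = _
      simp only [y, map_sum]
      rfl
    rw [← UniformSpace.Completion.norm_coe, h2, norm_zero]
  have hyk : ∀ k, y.1 k (q k) = T.comp (partialSum a.1 (σ.obj k) (q k)) (h k) := by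
    intro k
    let ev : σ.PreHilbert →+ T.Hom (σ.obj k) (q k) :=
      { toFun := fun z => z.1 k (q k)
        map_zero' := rfl
        map_add' := fun _ _ => rfl }
    change ev y = _
    simp only [y, map_sum]
    rw [partialSum_eq_sum_toeplitz a.2]
    simp only [map_sum, LinearMap.sum_apply]
    refine Finset.sum_congr rfl fun i _ => Finset.sum_congr rfl fun j _ => ?_
    change (σ.act (a.1 i j) x).1 k (q k) = _
    by_cases hij : i + n = j + m
    · rw [σ.act_apply (a.1 i j) x k (i := σ.obj k) (by have := hq k; omega), hx]
    · have : a.1 i j = 0 := a.2.2 i j fun h => hij h.1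
      rw [this]
      have e1 : σ.act (0 : T.Hom i j) = 0 := by simpa using σ.act_smul 0 (0 : T.Hom i j)
      have e2 : toeplitz (0 : T.Hom i j) = 0 := by simpa using toeplitz_smul 0 (0 : T.Hom i j)
      rw [e1, e2]
      change (0 : T.Hom (σ.obj k) (q k)) = T.comp (0 : T.Hom (σ.obj k) (q k)) (h k)
      simp
  have hlim := σ.tendsto_re_form y
  rw [hy] at hlim
  have : c ≤ 0 ^ 2 := by
    refine ge_of_tendsto hlim ?_
    -- Since `q k ≤ obj k + n`, the index `q k` lies below the cutoff `obj k + k + 1` as soon as `k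
    -- ≥ n`.
    filter_upwards [eventually_hyperfilter (Filter.eventually_ge_atTop n)] with k hk
    have hs : h k = T.adj (h k) := by rw [hh, T.adj_comp, T.adj_adj]
    have e : σ.fn k (T.comp (T.adj (y.1 k (q k))) (y.1 k (q k))) = σ.fn k (h k * h k * h k) := by
      congr 1
      rw [hyk, T.adj_comp, ← hs, mul_def, mul_def]
      conv_rhs => rw [T.comp_assoc, hh k]
      conv_lhs => rw [hh k]
      simp only [T.comp_assoc]
    refine (hc k).trans ?_
    rw [← e]
    simp only [FunctionalSeq.form, Complex.re_sum]
    exact Finset.single_le_sum (f := fun j => (σ.fn k (T.comp (T.adj (y.1 k j)) (y.1 k j))).re)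
      (fun j _ => σ.re_nonneg _) (Finset.mem_range.2 (by have := hq k; omega))
  norm_num at this
  linarith

/-- If `N` is invariant and `J`-saturated, there are enough representations that are coisometric
on `J` and vanish on `N`. -/
theorem exists_coisometricRep {K J N : T.Ideal} (hN : N.IsInvariant) (hNJ : N.IsSaturated J)
    {m n : ℕ} (a : Band K J m n)
    (ha : ¬((∀ i j, i < m → j < n → partialSum a.1 i j ∈ (sumIdeal J N).carrier i j) ∧
      partialSum a.1 m n ∈ N.carrier m n)) :
    ∃ ρ : CoisometricRep K J, (∀ (i j : ℕ) (b : K.carrier i j),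
      (b : T.Hom i j) ∈ N.carrier i j → ρ.rep.toFun i j b = 0) ∧
      integrate K J ρ (bandToO K J a) ≠ 0 := by
  set R := sumIdeal J N with hR
  have hNR : ∀ m n, N.carrier m n ≤ R.carrier m n := fun m n => le_sup_right
  have hJR : ∀ m n, J.carrier m n ≤ R.carrier m n := fun m n => le_sup_left
  -- the element `(x* x)^3` as a square
  have cube : ∀ {i j : ℕ} (x : T.Hom i j), ∃ w h : T.Hom i i, h = T.comp (T.adj x) x ∧
      star w * w = h * h * h ∧
      ∀ I : T.Ideal, star w * w ∈ I.carrier i i → x ∈ I.carrier i j := by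
    intro i j x
    obtain ⟨b, hb⟩ := T.adj_comp_self_pos x
    -- The cube is what the test vector produces, and it must be of the form `w* w` for
    -- `exists_functional`. Membership of the cube in an ideal forces membership of `x`, by taking
    -- square roots repeatedly.
    refine ⟨b * (star b * b), star b * b, hb.symm, ?_, fun I hI => ?_⟩
    · simp only [star_mul, star_star, mul_assoc]
    · have hI' := isClosedIdeal_carrier I i
      have h1 : b * (star b * b) ∈ I.carrier i i := hI'.mem_of_star_mul_self_mem hI
      have h2 : star (star b * b) * (star b * b) ∈ I.carrier i i := by
        have := (hI'.2 (star b) _ h1).1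
        simpa only [star_mul, star_star, mul_assoc] using this
      have h3 := hI'.mem_of_star_mul_self_mem h2
      exact mem_of_adj_comp_self_mem I (by rw [hb]; exact h3)
  -- If all partial sums are in `J + N`, only the corner can violate the criterion, and it is
  -- followed to infinity. Otherwise any position `(i, j)` with partial sum outside `J + N` is
  -- detected by a constant sequence.
  by_cases hall : ∀ i j, partialSum a.1 i j ∈ R.carrier i j
  · have hmn : partialSum a.1 m n ∉ N.carrier m n := fun h => ha ⟨fun i j _ _ => hall i j, h⟩
    let S : ∀ k, T.Hom (m + k) (n + k) := fun k => partialSum a.1 (m + k) (n + k)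
    have hS : ∀ k, S (k + 1) = T.tens (S k) := fun k => by
      change a.1 (m + k + 1) (n + k + 1) + T.tens (partialSum a.1 (m + k) (n + k)) = _
      rw [a.2.2 _ _ (by omega), zero_add]
    obtain ⟨w, h, hh, hwh, hw⟩ := cube (S 0)
    have hw0 : star w * w ∉ N.carrier m m := fun h' => hmn (hw N h')
    let wk : ∀ k, T.Hom (m + k) (m + k) := fun k => T.tensPow k w
    let hk : ∀ k, T.Hom (m + k) (m + k) := fun k => T.tensPow k h
    have hhk : ∀ k, hk k = T.comp (T.adj (S k)) (S k) := by
      intro k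
      induction k with
      | zero => exact hh
      | succ k ih =>
        change T.tens (hk k) = _
        rw [hS, ih, T.tens_comp, T.tens_adj]
    have hwhk : ∀ k, star (wk k) * wk k = hk k * hk k * hk k := by
      intro k
      induction k with
      | zero => exact hwh
      | succ k ih =>
        have := congrArg (tensHom T (m + k)) ih
        rw [map_mul, map_mul, map_mul, map_star] at this
        exact this
    have hwR : ∀ k, star (wk k) * wk k ∈ R.carrier (m + k) (m + k) := by
      intro k
      rw [hwhk]
      refine R.comp_mem_left _ ?_
      rw [hhk]
      exact R.comp_mem_left _ (hall _ _)
    set c : ℝ := Metric.infDist (star w * w) (N.carrier m m) with hc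
    have hc0 : 0 < c := by
      rw [hc, ← (N.isClosed m m).notMem_iff_infDist_pos ⟨0, (N.carrier m m).zero_mem⟩]
      exact hw0
    -- Saturation makes `⊗ 1` injective modulo `N` on `J + N`, so the distance to `N` does not
    -- shrink under repeated tensoring.
    have hck : ∀ k, c ≤ Metric.infDist (star (wk k) * wk k) (N.carrier (m + k) (m + k)) := by
      intro k
      induction k with
      | zero => exact le_rfl
      | succ k ih =>
        refine ih.trans ((infDist_le_infDist_tens (R := R) (fun m x hx hx' =>
          mem_of_mem_sumIdeal hN hNJ hx hx') (wk k) (hwR k)).trans (le_of_eq ?_))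
        have : T.tens (star (wk k) * wk k) = star (wk (k + 1)) * wk (k + 1) := by
          change tensHom T (m + k) (star (wk k) * wk k) = _
          rw [map_mul, map_star]
          rfl
        rw [this]
        rfl
    choose φ hφ1 hφ2 hφ3 hφ4 hφ5 using fun k =>
      (isClosedIdeal_carrier N (m + k)).exists_functional (wk k)
    let σ : FunctionalSeq J N :=
      { obj := fun k => m + k
        fn := φ
        nonneg := hφ1
        map_star := hφ2
        norm_le := hφ4
        eq_zero := hφ3
        eventually := fun i => by
          filter_upwards [Filter.eventually_gt_atTop i] with k hk
          exact Or.inl (by omega) }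
    refine ⟨σ.coisometricRep K, fun i j b hb => σ.rep_eq_zero hN K b hb,
      σ.integrate_bandToO_ne_zero a (fun k => n + k) (fun k => by change m + k + n = _; omega)
        (C := ‖S 0‖) (fun k => ?_) hk hhk hc0 fun k => ?_⟩
    · change ‖S k‖ ≤ _
      induction k with
      | zero => exact le_rfl
      | succ k ih =>
        rw [hS]
        exact (norm_tens_le _).trans ih
    · rw [← hwhk]
      exact (hck k).trans (hφ5 k)
  · push Not at hall
    obtain ⟨i, j, hij⟩ := hall
    have hdiag : i + n = j + m := by
      by_contra h
      exact hij (by rw [partialSum_eq_zero a.2 i j h]; exact zero_mem _)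
    obtain ⟨w, h, hh, hwh, hw⟩ := cube (partialSum a.1 i j)
    have hw0 : star w * w ∉ R.carrier i i := fun h' => hij (hw R h')
    have hc0 : 0 < Metric.infDist (star w * w) (R.carrier i i) := by
      rw [← (R.isClosed i i).notMem_iff_infDist_pos ⟨0, (R.carrier i i).zero_mem⟩]
      exact hw0
    obtain ⟨φ, hφ1, hφ2, hφ3, hφ4, hφ5⟩ := (isClosedIdeal_carrier R i).exists_functional w
    -- The functional kills `R = J + N`, so coisometry holds although the object stays fixed.
    let σ : FunctionalSeq J N :=
      { obj := fun _ => i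
        fn := fun _ => φ
        nonneg := fun _ => hφ1
        map_star := fun _ => hφ2
        norm_le := fun _ => hφ4
        eq_zero := fun _ x hx => hφ3 x (hNR _ _ hx)
        eventually := fun _ => Filter.Eventually.of_forall fun _ =>
          Or.inr fun x hx => hφ3 x (hJR _ _ hx) }
    refine ⟨σ.coisometricRep K, fun i j b hb => σ.rep_eq_zero hN K b hb,
      σ.integrate_bandToO_ne_zero a (fun _ => j) (fun _ => hdiag)
        (C := ‖partialSum a.1 i j‖) (fun _ => le_rfl) (fun _ => h)
        (fun _ => hh) hc0 fun _ => ?_⟩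
    rw [← hwh]
    exact hφ5

end CStarPrecategory

/-! ### The map from `M(m,n)` to `O_T(K, J)` -/

namespace CStarPrecategory

variable {T : CStarPrecategory.{u}}

theorem tensPow_mem {N : T.Ideal} (hN : N.IsInvariant) {m n : ℕ} {a : T.Hom m n}
    (ha : a ∈ N.carrier m n) (k : ℕ) : T.tensPow k a ∈ N.carrier (m + k) (n + k) := by
  rw [← toeplitz_add_right]
  exact toeplitz_mem hN ha _ _

theorem tensPow_adj {m n : ℕ} (a : T.Hom m n) (k : ℕ) :
    T.tensPow k (T.adj a) = T.adj (T.tensPow k a) := by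
  rw [← toeplitz_add_right, ← toeplitz_add_right, toeplitz_adj]

theorem shift_toeplitz {m n : ℕ} (a : T.Hom m n) (i j : ℕ) :
    shift (toeplitz a) i j = toeplitz (T.tens a) i j := by
  have h1 := partialSum_eq (entry a) i j
  have h2 := toeplitz_eq_entry_add a i j
  rw [toeplitz] at h2
  rw [h1] at h2
  exact add_left_cancel h2

theorem shift_sum {ι : Type*} (s : Finset ι) (x : ι → ∀ i j : ℕ, T.Hom i j) (i j : ℕ) :
    shift (∑ r ∈ s, x r) i j = ∑ r ∈ s, shift (x r) i j := by
  cases i <;> cases j <;> simp [shift, Finset.sum_apply]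

namespace TensorRep

variable {K : T.Ideal} {B : Type*} [NonUnitalCStarAlgebra B] (π : TensorRep K B)

/-- `t ↦ π (x t)`. -/
def compRight {m n : ℕ} (x : K.carrier m n) (l : ℕ) : T.Hom l m →ₗ[ℂ] B where
  toFun t := π.toFun l n ⟨T.comp (x : T.Hom m n) t, K.comp_mem_right t x.2⟩
  map_add' s t := by
    rw [← map_add]
    exact congrArg _ (Subtype.ext (map_add _ s t))
  map_smul' c t := by
    rw [RingHom.id_apply, ← map_smul]
    exact congrArg _ (Subtype.ext (map_smul _ c t))

/-- `t ↦ π (t y)`. -/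
def compLeft {l m : ℕ} (y : K.carrier l m) (n : ℕ) : T.Hom m n →ₗ[ℂ] B where
  toFun t := π.toFun l n ⟨T.comp t (y : T.Hom l m), K.comp_mem_left t y.2⟩
  map_add' s t := by
    rw [← map_add]
    exact congrArg _ (Subtype.ext (by simp))
  map_smul' c t := by
    rw [RingHom.id_apply, ← map_smul]
    exact congrArg _ (Subtype.ext (by simp))

/-- The mirror image of `map_tens`, obtained by taking adjoints. -/
theorem map_tens_right {l r n : ℕ} (k : ℕ) (a : K.carrier (r + k) n) (b : K.carrier l r) :
    π.toFun (r + k) n a * π.toFun l r b = π.compRight a (l + k) (T.tensPow k (b : T.Hom l r)) := by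
  have h := π.map_tens k ⟨T.adj (b : T.Hom l r), adj_mem K b.2⟩
    ⟨T.adj (a : T.Hom (r + k) n), adj_mem K a.2⟩
  rw [π.map_adj, π.map_adj, ← star_mul] at h
  have h2 := congrArg star h
  rw [star_star, ← π.map_adj] at h2
  rw [h2]
  refine congrArg _ (Subtype.ext ?_)
  simp only [T.adj_comp, tensPow_adj, T.adj_adj]

/-- Only the factor whose inner object is smaller gets tensored, so a product of two values is again
a value. Hence the linear span of the image is an algebra. -/
theorem exists_mul_eq {l m n r : ℕ} (a : K.carrier m n) (b : K.carrier l r) :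
    ∃ (p q : ℕ) (c : K.carrier p q), π.toFun m n a * π.toFun l r b = π.toFun p q c ∧
      ∀ N : T.Ideal, N.IsInvariant →
        (a : T.Hom m n) ∈ N.carrier m n ∨ (b : T.Hom l r) ∈ N.carrier l r →
        (c : T.Hom p q) ∈ N.carrier p q := by
  rcases le_total m r with h | h
  · obtain ⟨k, rfl⟩ := Nat.exists_eq_add_of_le h
    refine ⟨_, _, _, π.map_tens k a b, fun N hN h => ?_⟩
    rcases h with h | h
    · exact N.comp_mem_right _ (tensPow_mem hN h k)
    · exact N.comp_mem_left _ h
  · obtain ⟨k, rfl⟩ := Nat.exists_eq_add_of_le h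
    refine ⟨_, _, _, π.map_tens_right k a b, fun N hN h => ?_⟩
    rcases h with h | h
    · exact N.comp_mem_right _ h
    · exact N.comp_mem_left _ (tensPow_mem hN h k)

/-- The product of two values of a representation as a sum over Toeplitz matrices. -/
theorem mul_eq_sum {k q p k' L L' : ℕ} (x : K.carrier k q) (y : K.carrier p k')
    (h : (x : T.Hom k q) = 0 ∨ (y : T.Hom p k') = 0 ∨ (p + k < L + k' ∧ q + k' < L' + k)) :
    π.toFun k q x * π.toFun p k' y =
      ∑ p' ∈ Finset.range L, π.compRight x p' (toeplitz (y : T.Hom p k') p' k) +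
      ∑ q' ∈ Finset.range L', π.compLeft y q' (shift (toeplitz (x : T.Hom k q)) k' q') := by
  have htz : ∀ m n : ℕ, toeplitz (0 : T.Hom m n) = 0 := fun m n => by
    simpa using toeplitz_smul 0 (0 : T.Hom m n)
  rcases h with h | h | ⟨hL, hL'⟩
  · obtain rfl : x = 0 := Subtype.ext h
    have e : ∀ p', π.compRight (0 : K.carrier k q) p' = 0 := fun p' => by
      refine LinearMap.ext fun t => ?_
      change π.toFun p' q ⟨T.comp (0 : T.Hom k q) t, _⟩ = 0
      rw [← map_zero (π.toFun p' q)]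
      exact congrArg _ (Subtype.ext (by simp))
    have e2 : ∀ i j, shift (toeplitz (0 : T.Hom k q)) i j = 0 := fun i j => by
      rw [shift_toeplitz, map_zero, htz]
      rfl
    simp [e, e2]
  · obtain rfl : y = 0 := Subtype.ext h
    have e : ∀ q', π.compLeft (0 : K.carrier p k') q' = 0 := fun q' => by
      refine LinearMap.ext fun t => ?_
      change π.toFun p q' ⟨T.comp t (0 : T.Hom p k'), _⟩ = 0
      rw [← map_zero (π.toFun p q')]
      exact congrArg _ (Subtype.ext (by simp))
    simp [e, htz]
  · rcases le_or_gt k' k with hk | hk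
    · obtain ⟨r, rfl⟩ := Nat.exists_eq_add_of_le hk
      rw [Finset.sum_eq_single_of_mem (p + r) (Finset.mem_range.2 (by omega)) fun p' _ hp' => by
        rw [toeplitz_eq_zero _ (by omega), map_zero], Finset.sum_eq_zero fun q' _ => by
        rw [shift_toeplitz, toeplitz_eq_zero _ (by omega), map_zero], add_zero, toeplitz_add_right,
        π.map_tens_right]
    · obtain ⟨r, rfl⟩ := Nat.exists_eq_add_of_le hk.le
      rw [Finset.sum_eq_zero fun p' _ => by
        rw [toeplitz_eq_zero _ (by omega), map_zero],
        Finset.sum_eq_single_of_mem (q + r) (Finset.mem_range.2 (by omega)) fun q' _ hq' => by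
        rw [shift_toeplitz, toeplitz_eq_zero _ (by omega), map_zero], zero_add, shift_toeplitz,
        π.map_tens]
      have e := toeplitz_eq_entry_add (x : T.Hom k q) (k + r) (q + r)
      rw [entry_of_ne _ (by omega), zero_add, toeplitz_add_right] at e
      rw [← e]
      rfl

end TensorRep

variable {K J : T.Ideal}

theorem bandToO_add {m n : ℕ} (a b : Band K J m n) :
    bandToO K J (a + b) = bandToO K J a + bandToO K J b := by
  simp only [bandToO, ← Finset.sum_add_distrib]
  refine Finset.sum_congr rfl fun i _ => Finset.sum_congr rfl fun j _ => ?_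
  rw [← map_add]
  rfl

theorem bandToO_smul {m n : ℕ} (c : ℂ) (a : Band K J m n) :
    bandToO K J (c • a) = c • bandToO K J a := by
  simp only [bandToO, Finset.smul_sum]
  refine Finset.sum_congr rfl fun i _ => Finset.sum_congr rfl fun j _ => ?_
  rw [← map_smul]
  rfl

variable (K J) in
/-- `bandToO` as a linear map. -/
def bandToOₗ (m n : ℕ) : Band K J m n →ₗ[ℂ] O K J where
  toFun := bandToO K J
  map_add' := bandToO_add
  map_smul' := bandToO_smul

theorem univRep_eq_zero {m n : ℕ} {a : K.carrier m n} (ha : (a : T.Hom m n) = 0) :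
    (univRep K J).toFun m n a = 0 := by
  obtain rfl : a = 0 := Subtype.ext ha
  exact map_zero _

theorem bandToO_incl {m n : ℕ} (a : Band K J m n) :
    bandToO K J (Band.incl a) = bandToO K J a := by
  unfold bandToO
  rw [Finset.sum_range_succ, Finset.sum_eq_zero (s := Finset.range (n + 1 + 1)) fun j _ =>
    univRep_eq_zero (a.2.2 _ _ (by omega)), add_zero]
  refine Finset.sum_congr rfl fun i hi => ?_
  rw [Finset.sum_range_succ]
  rw [univRep_eq_zero (a.2.2 _ _ (by have := Finset.mem_range.1 hi; omega)), add_zero]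
  rfl

/-- Both sides are expanded over pairs of entries into the two families of Toeplitz terms of
`mul_eq_sum`. These correspond to the two halves of the convolution, and the remaining work is
reordering finite sums. -/
theorem bandToO_mul {l m n : ℕ} (a : Band K J m n) (b : Band K J l m) :
    bandToO K J (Band.mul a b) = bandToO K J a * bandToO K J b := by
  set π := univRep K J
  let x : ∀ k q, K.carrier k q := fun k q => ⟨a.1 k q, a.2.1 k q⟩
  let y : ∀ p k, K.carrier p k := fun p k => ⟨b.1 p k, b.2.1 p k⟩
  let M := Finset.range (m + 1)
  let L := Finset.range (l + 1)
  let N := Finset.range (n + 1)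
  have hR : bandToO K J a * bandToO K J b =
      ∑ k ∈ M, ∑ q ∈ N, ∑ p ∈ L, ∑ k' ∈ M,
        (∑ p' ∈ L, π.compRight (x k q) p' (toeplitz (b.1 p k') p' k) +
          ∑ q' ∈ N, π.compLeft (y p k') q' (shift (toeplitz (a.1 k q)) k' q')) := by
    simp only [bandToO, Finset.sum_mul, Finset.mul_sum]
    rw [Finset.sum_congr rfl fun p _ => Finset.sum_comm]
    rw [Finset.sum_comm]
    refine Finset.sum_congr rfl fun k hk => ?_
    rw [Finset.sum_congr rfl fun p _ => Finset.sum_comm, Finset.sum_comm]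
    refine Finset.sum_congr rfl fun q hq => Finset.sum_congr rfl fun p hp =>
      Finset.sum_congr rfl fun k' hk' => ?_
    refine π.mul_eq_sum (x k q) (y p k') ?_
    have := Finset.mem_range.1 hk
    have := Finset.mem_range.1 hk'
    by_cases h1 : k + n = q + m
    · by_cases h2 : p + m = k' + l
      · exact Or.inr (Or.inr ⟨by omega, by omega⟩)
      · exact Or.inr (Or.inl (b.2.2 p k' fun h => h2 h.1))
    · exact Or.inl (a.2.2 k q fun h => h1 h.1)
  have hSa : partialSum a.1 = ∑ k ∈ M, ∑ q ∈ N, toeplitz (a.1 k q) := by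
    funext i j
    rw [partialSum_eq_sum_toeplitz a.2]
    simp only [Finset.sum_apply]
    rfl
  have hL : bandToO K J (Band.mul a b) =
      ∑ p' ∈ L, ∑ q' ∈ N, ∑ k' ∈ M,
        (∑ p ∈ L, ∑ k ∈ M, π.compRight (x k' q') p' (toeplitz (b.1 p k) p' k') +
          ∑ k ∈ M, ∑ q ∈ N, π.compLeft (y p' k') q' (shift (toeplitz (a.1 k q)) k' q')) := by
    unfold bandToO
    refine Finset.sum_congr rfl fun p' _ => Finset.sum_congr rfl fun q' _ => ?_
    have e1 : ∀ k' ∈ M, ∑ p ∈ L, ∑ k ∈ M, π.compRight (x k' q') p' (toeplitz (b.1 p k) p' k') +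
        ∑ k ∈ M, ∑ q ∈ N, π.compLeft (y p' k') q' (shift (toeplitz (a.1 k q)) k' q') =
        π.toFun p' q' (⟨T.comp (a.1 k' q') (partialSum b.1 p' k'), K.comp_mem_right _ (a.2.1 _ _)⟩ +
          ⟨T.comp (shift (partialSum a.1) k' q') (b.1 p' k'), K.comp_mem_left _ (b.2.1 _ _)⟩) := by
      intro k' _
      rw [map_add]
      congr 1
      · simp only [← map_sum]
        rw [← partialSum_eq_sum_toeplitz b.2]
        rfl
      · simp only [← map_sum]
        rw [hSa]
        simp only [← shift_sum]
        rfl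
    rw [Finset.sum_congr rfl e1, ← map_sum]
    refine congrArg _ (Subtype.ext ?_)
    change convolution m a.1 b.1 p' q' = _
    rw [convolution, Submodule.coe_sum]
    rfl
  rw [hL, hR]
  simp only [Finset.sum_add_distrib]
  congr 1
  · rw [Finset.sum_congr rfl fun p' _ => Finset.sum_comm, Finset.sum_comm]
    refine Finset.sum_congr rfl fun k _ => ?_
    rw [Finset.sum_comm]
    refine Finset.sum_congr rfl fun q _ => ?_
    rw [Finset.sum_comm]
    refine Finset.sum_congr rfl fun p _ => ?_
    rw [Finset.sum_comm]
  · rw [Finset.sum_congr rfl fun p' _ => Finset.sum_congr rfl fun q' _ => Finset.sum_comm]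
    rw [Finset.sum_congr rfl fun p' _ => Finset.sum_comm, Finset.sum_comm]
    refine Finset.sum_congr rfl fun k _ => ?_
    rw [Finset.sum_congr rfl fun p' _ => Finset.sum_congr rfl fun q' _ => Finset.sum_comm]
    rw [Finset.sum_congr rfl fun p' _ => Finset.sum_comm, Finset.sum_comm]
    refine Finset.sum_congr rfl fun q _ => Finset.sum_congr rfl fun p _ => ?_
    rw [Finset.sum_comm]

/-- The involution `M(m,n) → M(n,m)`. -/
def Band.adj {m n : ℕ} (a : Band K J m n) : Band K J n m :=
  (⟨fun i j => T.adj (a.1 j i), fun i j => adj_mem K (a.2.1 j i), fun i j h =>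
    (congrArg T.adj (a.2.2 j i (by omega))).trans (map_zero _)⟩ : band K n m)

theorem partialSum_adj (x : ∀ i j : ℕ, T.Hom i j) (i j : ℕ) :
    partialSum (fun i j => T.adj (x j i)) i j = T.adj (partialSum x j i) := by
  induction i generalizing j with
  | zero => cases j <;> rfl
  | succ i ih =>
    cases j with
    | zero => rfl
    | succ j =>
      simp only [partialSum]
      rw [ih, map_add, T.tens_adj]

theorem bandToO_adj {m n : ℕ} (a : Band K J m n) :
    bandToO K J (Band.adj a) = star (bandToO K J a) := by
  simp only [bandToO, star_sum]
  rw [Finset.sum_comm]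
  refine Finset.sum_congr rfl fun i _ => Finset.sum_congr rfl fun j _ => ?_
  exact (univRep K J).map_adj ⟨a.1 i j, a.2.1 i j⟩

variable (K J) in
/-- The element of `M(m,n)` with the only nonzero entry `a` at `(m,n)`. -/
def Band.single {m n : ℕ} (a : K.carrier m n) : Band K J m n :=
  (⟨entry (a : T.Hom m n), fun i j => by
    by_cases h : i = m ∧ j = n
    · obtain ⟨rfl, rfl⟩ := h
      rw [entry_same]
      exact a.2
    · rw [entry_of_ne _ h]
      exact zero_mem _, fun i j h => entry_of_ne _ (by omega)⟩ : band K m n)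

theorem partialSum_single {m n : ℕ} (a : K.carrier m n) :
    partialSum (Band.single K J a).1 = toeplitz (a : T.Hom m n) := rfl

theorem bandToO_single {m n : ℕ} (a : K.carrier m n) :
    bandToO K J (Band.single K J a) = (univRep K J).toFun m n a := by
  unfold bandToO
  rw [Finset.sum_eq_single_of_mem m (Finset.mem_range.2 (by omega)) fun i _ hi =>
    Finset.sum_eq_zero fun j _ => univRep_eq_zero (entry_of_ne _ (by omega)),
    Finset.sum_eq_single_of_mem n (Finset.mem_range.2 (by omega)) fun j _ hj =>
      univRep_eq_zero (entry_of_ne _ (by omega))]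
  exact congrArg _ (Subtype.ext (entry_same _))

/-- The element of `M(m,n)` with given partial sums. -/
def Band.ofSums {m n : ℕ} (S : ∀ i j : ℕ, T.Hom i j) (h0 : ∀ i j, i + n ≠ j + m → S i j = 0)
    (hS : ∀ i j, i ≤ m → S i j - shift S i j ∈ K.carrier i j) : Band K J m n :=
  (⟨fun i j => if i ≤ m then S i j - shift S i j else 0, fun i j => by
    dsimp only
    split_ifs with h
    exacts [hS i j h, zero_mem _], fun i j h => by
    have hs : i + n ≠ j + m → shift S i j = 0 := fun h' => by
      cases i <;> cases j <;> simp only [shift]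
      rw [h0 _ _ (by omega), map_zero]
    dsimp only
    split_ifs with h'
    · rw [h0 i j (by omega), hs (by omega), sub_zero]
    · rfl⟩ : band K m n)

theorem partialSum_ofSums {m n : ℕ} (S : ∀ i j : ℕ, T.Hom i j)
    (h0 : ∀ i j, i + n ≠ j + m → S i j = 0)
    (hS : ∀ i j, i ≤ m → S i j - shift S i j ∈ K.carrier i j) {i : ℕ} (j : ℕ) (hi : i ≤ m) :
    partialSum (Band.ofSums (J := J) S h0 hS).1 i j = S i j := by
  induction i generalizing j with
  | zero =>
    rw [partialSum_eq]
    simp [Band.ofSums, shift]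
  | succ i ih =>
    rw [partialSum_eq]
    cases j with
    | zero => simp [Band.ofSums, shift, hi]
    | succ j =>
      simp only [shift]
      rw [ih j (by omega)]
      simp [Band.ofSums, shift, hi]

/-- Each entry is recovered as a partial sum minus the tensor of the previous one on its diagonal.
-/
theorem Band.ext_partialSum {m n : ℕ} {a b : Band K J m n}
    (h : ∀ i j, i ≤ m → partialSum a.1 i j = partialSum b.1 i j) : a = b := by
  refine Subtype.ext (funext fun i => funext fun j => ?_)
  by_cases hi : i ≤ m
  · have h1 := partialSum_eq a.1 i j
    have h2 := partialSum_eq b.1 i j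
    have h3 : shift (partialSum a.1) i j = shift (partialSum b.1) i j := by
      cases i <;> cases j <;> simp only [shift]
      rw [h _ _ (by omega)]
    rw [h i j hi, h2, h3] at h1
    exact (add_right_cancel h1).symm
  · rw [a.2.2 i j (by omega), b.2.2 i j (by omega)]

/-- The partial sums `S` lie in `J`, hence in `J(K)`, so they may be represented themselves.
Coisometry gives `i(c_{i+1,j+1}) = i(S_{i+1,j+1}) - i(S_{i,j})`, and the sum telescopes to the
corner, where `S` vanishes. -/
theorem bandToO_eq_zero_of_norm_eq_zero (hJ : ∀ m n, J.carrier m n ≤ K.tensPreimage m n)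
    {m n : ℕ} {c : Band K J m n} (hc : ‖c‖ = 0) : bandToO K J c = 0 := by
  rw [Band.norm_eq_zero_iff] at hc
  have hS : ∀ i j, i ≤ m → partialSum c.1 i j ∈ J.carrier i j := by
    intro i j hi
    by_cases h : i + n = j + m
    · rcases hi.lt_or_eq with h' | rfl
      · exact hc.1 i j h' (by omega)
      · obtain rfl : j = n := by omega
        rw [hc.2]
        exact zero_mem _
    · rw [partialSum_eq_zero c.2 i j h]
      exact zero_mem _
  -- The value `0` for `i > m` is a filler: there the partial sums are not known to be in `K`.
  let z : ∀ i j, O K J := fun i j =>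
    if h : i ≤ m then (univRep K J).toFun i j ⟨partialSum c.1 i j, (hJ i j (hS i j h)).2⟩ else 0
  have hz : ∀ i j, i ≤ m → partialSum c.1 i j = 0 → z i j = 0 := fun i j hi h => by
    simp only [z, hi, dite_true]
    exact univRep_eq_zero h
  have hc00 : ∀ i j, i ≤ m → (i = 0 ∨ j = 0) →
      (univRep K J).toFun i j ⟨c.1 i j, c.2.1 i j⟩ = z i j := by
    intro i j hi h
    simp only [z, hi, dite_true]
    refine congrArg _ (Subtype.ext ?_)
    change c.1 i j = partialSum c.1 i j
    rcases h with rfl | rfl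
    · rfl
    · cases i <;> rfl
  have hcs : ∀ i j, i + 1 ≤ m →
      (univRep K J).toFun (i + 1) (j + 1) ⟨c.1 (i + 1) (j + 1), c.2.1 _ _⟩ =
        z (i + 1) (j + 1) - z i j := by
    intro i j hi
    have hi' : i ≤ m := by omega
    simp only [z, hi, hi', dite_true]
    rw [univRep_coisometric K J i j _ (hJ i j (hS i j hi')).2 (hJ i j (hS i j hi')).1
      (hS i j hi'), ← map_sub]
    refine congrArg _ (Subtype.ext ?_)
    change c.1 (i + 1) (j + 1) =
      (c.1 (i + 1) (j + 1) + T.tens (partialSum c.1 i j)) - T.tens (partialSum c.1 i j)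
    abel
  have hlast1 : ∀ j, z m j = 0 := fun j => by
    refine hz m j le_rfl ?_
    by_cases h : j = n
    · rw [h]; exact hc.2
    · exact partialSum_eq_zero c.2 m j (by omega)
  have hlast2 : ∀ i, i ≤ m → z i n = 0 := fun i hi => by
    refine hz i n hi ?_
    by_cases h : i = m
    · rw [h]; exact hc.2
    · exact partialSum_eq_zero c.2 i n (by omega)
  clear_value z
  unfold bandToO
  rw [Finset.sum_range_succ']
  have e0 : ∑ j ∈ Finset.range (n + 1), (univRep K J).toFun 0 j ⟨c.1 0 j, c.2.1 0 j⟩ =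
      ∑ j ∈ Finset.range n, z 0 j := by
    rw [Finset.sum_congr rfl fun j _ => hc00 0 j (Nat.zero_le _) (Or.inl rfl),
      Finset.sum_range_succ, hlast2 0 (Nat.zero_le _), add_zero]
  have e1 : ∀ i ∈ Finset.range m, ∑ j ∈ Finset.range (n + 1),
      (univRep K J).toFun (i + 1) j ⟨c.1 (i + 1) j, c.2.1 (i + 1) j⟩ =
      ∑ j ∈ Finset.range n, z (i + 1) j - ∑ j ∈ Finset.range n, z i j := by
    intro i hi
    have hi' : i + 1 ≤ m := Finset.mem_range.1 hi
    rw [Finset.sum_range_succ', hc00 (i + 1) 0 hi' (Or.inr rfl),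
      Finset.sum_congr rfl fun j _ => hcs i j hi', Finset.sum_sub_distrib,
      sub_add_eq_add_sub, ← Finset.sum_range_succ' (fun j => z (i + 1) j), Finset.sum_range_succ,
      hlast2 (i + 1) hi', add_zero]
  rw [Finset.sum_congr rfl e1, Finset.sum_range_sub (fun i => ∑ j ∈ Finset.range n, z i j), e0,
    sub_add_cancel]
  exact Finset.sum_eq_zero fun j _ => hlast1 j

end CStarPrecategory

/-! ### Norm estimates -/

namespace CStarPrecategory

variable {T : CStarPrecategory.{u}}

variable {K J : T.Ideal}

theorem partialSum_mul_self {m : ℕ} (a b : Band K J m m) {i : ℕ} (hi : i ≤ m) :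
    partialSum (Band.mul a b).1 i i = partialSum a.1 i i * partialSum b.1 i i := by
  refine (partialSum_convolution (a := a.1) b.2 i i hi).trans ?_
  exact Finset.sum_eq_single_of_mem i (Finset.mem_range.2 (by omega)) fun k _ hk => by
    rw [partialSum_eq_zero b.2 i k (by omega), map_zero]

variable (K J) in
/-- The diagonal of partial sums of a matrix in `M(m,m)`. -/
def diagSums (m : ℕ) : Band K J m m →ₗ[ℂ] ∀ i : Fin (m + 1), T.Hom i i where
  toFun a i := partialSum a.1 i i
  map_add' a b := by
    funext i
    exact congrFun (congrFun (partialSum_add a.1 b.1) i) i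
  map_smul' c a := by
    funext i
    exact congrFun (congrFun (partialSum_smul c a.1) i) i

theorem diagSums_injective (m : ℕ) : Function.Injective (diagSums K J m) := by
  intro a b h
  refine Band.ext_partialSum fun i j hi => ?_
  by_cases hij : i = j
  · subst hij
    exact congrFun h ⟨i, by omega⟩
  · rw [partialSum_eq_zero a.2 i j (by omega), partialSum_eq_zero b.2 i j (by omega)]

variable (K J) in
/-- The algebra of the diagonals of partial sums of matrices in `M(m,m)`. -/
def diagAlg (m : ℕ) : NonUnitalStarSubalgebra ℂ (∀ i : Fin (m + 1), T.Hom i i) where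
  carrier := Set.range (diagSums K J m)
  add_mem' := by
    rintro _ _ ⟨a, rfl⟩ ⟨b, rfl⟩
    exact ⟨a + b, map_add _ a b⟩
  zero_mem' := ⟨0, map_zero _⟩
  smul_mem' := by
    rintro c _ ⟨a, rfl⟩
    exact ⟨c • a, map_smul _ c a⟩
  mul_mem' := by
    rintro _ _ ⟨a, rfl⟩ ⟨b, rfl⟩
    exact ⟨Band.mul a b, funext fun i => partialSum_mul_self a b (Nat.lt_succ_iff.1 i.2)⟩
  star_mem' := by
    rintro _ ⟨a, rfl⟩
    exact ⟨Band.adj a, funext fun i => partialSum_adj a.1 i i⟩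

/-- The entries of the matrix are the differences `x_{i+1} - x_i ⊗ 1`, so the diagonals of partial
sums are cut out by closed conditions. Thus `diagAlg` is a `C*`-algebra, and homomorphisms from it
are automatically contractive. -/
theorem diagAlg_eq (m : ℕ) : (diagAlg K J m : Set (∀ i : Fin (m + 1), T.Hom i i)) =
    {x | x 0 ∈ K.carrier 0 0} ∩ ⋂ i : Fin m,
      {x | x ⟨i + 1, by omega⟩ - T.tens (x ⟨i, by omega⟩) ∈ K.carrier (i + 1) (i + 1)} := by
  ext x
  simp only [Set.mem_inter_iff, Set.mem_ofPred_eq, Set.mem_iInter]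
  constructor
  · rintro ⟨a, rfl⟩
    refine ⟨a.2.1 0 0, fun i => ?_⟩
    change (a.1 (i + 1) (i + 1) + T.tens (partialSum a.1 i i)) - T.tens (partialSum a.1 i i) ∈ _
    rw [add_sub_cancel_right]
    exact a.2.1 _ _
  · rintro ⟨h0, hs⟩
    let S : ∀ i j : ℕ, T.Hom i j := fun i =>
      Pi.single i (if h : i < m + 1 then x ⟨i, h⟩ else 0)
    have hS0 : ∀ i j, i ≠ j → S i j = 0 := fun i j h => Pi.single_eq_of_ne (Ne.symm h) _
    have hSi : ∀ (i : ℕ) (h : i < m + 1), S i i = x ⟨i, h⟩ := fun i h => by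
      simp only [S, Pi.single_eq_same, h, dite_true]
    refine ⟨Band.ofSums S (fun i j h => hS0 i j (by omega)) fun i j hi => ?_, ?_⟩
    · by_cases hij : i = j
      · subst hij
        cases i with
        | zero =>
          rw [hSi 0 (by omega)]
          simp only [shift, sub_zero]
          exact h0
        | succ i =>
          have := hs ⟨i, by omega⟩
          simp only [shift]
          rw [hSi (i + 1) (by omega), hSi i (by omega)]
          exact this
      · rw [hS0 i j hij]
        have : shift S i j = 0 := by
          cases i <;> cases j <;> simp only [shift]
          rw [hS0 _ _ (by omega), map_zero]
        rw [this, sub_zero]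
        exact zero_mem _
    · funext i
      exact (partialSum_ofSums S _ _ _ (Nat.lt_succ_iff.1 i.2)).trans (hSi i i.2)

instance isClosed_diagAlg (m : ℕ) :
    IsClosed (diagAlg K J m : Set (∀ i : Fin (m + 1), T.Hom i i)) := by
  rw [diagAlg_eq]
  refine ((K.isClosed 0 0).preimage (continuous_apply (0 : Fin (m + 1)))).inter
    (isClosed_iInter fun i => (K.isClosed _ _).preimage ?_)
  exact (continuous_apply i.succ).sub
    ((continuous_tens (T := T)).comp (continuous_apply i.castSucc))

/-- The matrix with a given diagonal of partial sums. -/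
def diagBand {m : ℕ} (x : diagAlg K J m) : Band K J m m := x.2.choose

theorem diagSums_diagBand {m : ℕ} (x : diagAlg K J m) : diagSums K J m (diagBand x) = x.1 :=
  x.2.choose_spec

theorem diagBand_eq {m : ℕ} {x : diagAlg K J m} {a : Band K J m m}
    (h : diagSums K J m a = x.1) : diagBand x = a :=
  diagSums_injective m ((diagSums_diagBand x).trans h.symm)

variable (K J) in
/-- The homomorphism into `O_T(K, J)` induced by `bandToO`. -/
def diagHom (m : ℕ) : diagAlg K J m →⋆ₙₐ[ℂ] O K J where
  toFun x := bandToO K J (diagBand x)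
  map_smul' c x := by
    rw [diagBand_eq (a := c • diagBand x) (by rw [map_smul, diagSums_diagBand]; rfl), bandToO_smul]
    rfl
  map_zero' := by
    rw [diagBand_eq (a := 0) (map_zero _)]
    exact map_zero (bandToOₗ K J m m)
  map_add' x y := by
    rw [diagBand_eq (a := diagBand x + diagBand y) (by
      rw [map_add, diagSums_diagBand, diagSums_diagBand]; rfl), bandToO_add]
  map_mul' x y := by
    rw [diagBand_eq (a := Band.mul (diagBand x) (diagBand y)) ?_, bandToO_mul]
    funext i
    refine (partialSum_mul_self _ _ (Nat.lt_succ_iff.1 i.2)).trans ?_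
    exact congrArg₂ (· * ·) (congrFun (diagSums_diagBand x) i) (congrFun (diagSums_diagBand y) i)
  map_star' x := by
    rw [diagBand_eq (a := Band.adj (diagBand x)) ?_, bandToO_adj]
    funext i
    refine (partialSum_adj _ _ _).trans ?_
    exact congrArg T.adj (congrFun (diagSums_diagBand x) i)

theorem diagHom_apply {m : ℕ} (x : diagAlg K J m) :
    diagHom K J m x = bandToO K J (diagBand x) := rfl

theorem diagHom_diagSums {m : ℕ} (a : Band K J m m) :
    diagHom K J m ⟨diagSums K J m a, a, rfl⟩ = bandToO K J a := by
  rw [diagHom_apply, diagBand_eq rfl]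

theorem norm_bandToO_le_of_diag {m : ℕ} {a : Band K J m m} {C : ℝ} (hC : 0 ≤ C)
    (h : ∀ i, i ≤ m → ‖partialSum a.1 i i‖ ≤ C) : ‖bandToO K J a‖ ≤ C := by
  rw [← diagHom_diagSums]
  refine (NonUnitalStarAlgHom.norm_apply_le _ _).trans ?_
  refine (pi_norm_le_iff_of_nonneg hC).2 fun i => h i (Nat.lt_succ_iff.1 i.2)

/-- The `C*`-identity reduces to `a* a`, a square matrix on the main diagonal, where `diagHom` is
contractive. -/
theorem norm_bandToO_le_of_partialSum {m n : ℕ} {a : Band K J m n} {C : ℝ} (hC : 0 ≤ C)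
    (h : ∀ i j, i ≤ m → ‖partialSum a.1 i j‖ ≤ C) : ‖bandToO K J a‖ ≤ C := by
  have h1 : ‖bandToO K J a‖ * ‖bandToO K J a‖ ≤ C * C := by
    rw [← CStarRing.norm_star_mul_self, ← bandToO_adj, ← bandToO_mul]
    refine norm_bandToO_le_of_diag (by positivity) fun i hi => ?_
    have e : partialSum (Band.mul (Band.adj a) a).1 i i = _ :=
      partialSum_convolution (a := (Band.adj a).1) a.2 i i hi
    rw [e]
    by_cases hk : ∃ k, i + n = k + m
    · obtain ⟨k, hk⟩ := hk
      rw [Finset.sum_eq_single_of_mem k (Finset.mem_range.2 (by omega)) fun k' _ hk' => by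
        rw [partialSum_eq_zero a.2 i k' (by omega), map_zero]]
      refine (T.norm_comp_le _ _).trans ?_
      have e2 : partialSum (Band.adj a).1 k i = T.adj (partialSum a.1 i k) := partialSum_adj a.1 k i
      rw [e2, norm_adj]
      exact mul_le_mul (h i k hi) (h i k hi) (norm_nonneg _) hC
    · rw [Finset.sum_eq_zero fun k' _ => by
        rw [partialSum_eq_zero a.2 i k' fun h => hk ⟨k', h⟩, map_zero], norm_zero]
      positivity
  exact abs_le_of_sq_le_sq' (by nlinarith) hC |>.2

theorem Band.exists_norm_partialSum_sub_le {m n : ℕ} (a : Band K J m n) {ε : ℝ} (hε : 0 < ε)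
    {i j : ℕ} (hi : i < m) (hj : j < n) :
    ∃ s ∈ J.carrier i j, ‖partialSum a.1 i j - s‖ ≤ ‖a‖ + ε := by
  obtain ⟨y, hy, hy'⟩ := Submodule.Quotient.norm_mk_lt
    ((J.carrier i j).mkQ (partialSum a.1 i j)) hε
  refine ⟨partialSum a.1 i j - y, ?_, ?_⟩
  · rw [← (Submodule.Quotient.eq _), hy]
    rfl
  · rw [sub_sub_cancel]
    refine hy'.le.trans (add_le_add_left ?_ ε)
    have h2 := norm_le_pi_norm ((bandMap K J m n a).1 ⟨i, hi⟩) ⟨j, hj⟩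
    have h3 := norm_le_pi_norm (bandMap K J m n a).1 ⟨i, hi⟩
    exact (h2.trans h3).trans (le_max_left _ _)

theorem Band.norm_partialSum_le {m n : ℕ} (a : Band K J m n) : ‖partialSum a.1 m n‖ ≤ ‖a‖ :=
  le_max_right _ _

theorem partialSum_sub {m n : ℕ} (a b : Band K J m n) (i j : ℕ) :
    partialSum (a - b).1 i j = partialSum a.1 i j - partialSum b.1 i j := by
  have h := congrFun (congrFun (partialSum_add (a - b).1 b.1) i) j
  have h2 : (a - b).1 + b.1 = a.1 := congrArg Subtype.val (sub_add_cancel a b)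
  rw [h2] at h
  rw [h]
  simp

/-- A matrix of norm zero with given partial sums in `J`. -/
theorem Band.exists_norm_eq_zero (hJ : ∀ m n, J.carrier m n ≤ K.tensPreimage m n) {m n : ℕ}
    (s : ∀ i j, T.Hom i j) (hs : ∀ i j, i < m → j < n → s i j ∈ J.carrier i j) :
    ∃ c : Band K J m n, ‖c‖ = 0 ∧
      ∀ i j, i < m → j < n → i + n = j + m → partialSum c.1 i j = s i j := by
  let S : ∀ i j : ℕ, T.Hom i j := fun i j => if i < m ∧ j < n ∧ i + n = j + m then s i j else 0
  have hSJ : ∀ i j, S i j ∈ J.carrier i j := fun i j => by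
    by_cases h : i < m ∧ j < n ∧ i + n = j + m
    · simp only [S, h]
      exact hs i j h.1 h.2.1
    · simp only [S, h]
      exact zero_mem _
  -- The entries `S_{i+1,j+1} - S_{i,j} ⊗ 1` are in `K` precisely because `J ⊆ J(K)`.
  let c : Band K J m n := Band.ofSums S (fun i j h => if_neg fun h' => h h'.2.2) fun i j _ => by
    refine sub_mem (hJ i j (hSJ i j)).2 ?_
    cases i <;> cases j <;> simp only [shift]
    exacts [zero_mem _, zero_mem _, zero_mem _, (hJ _ _ (hSJ _ _)).1]
  have hc : ∀ i j, i ≤ m → partialSum c.1 i j = S i j := fun i j hi => partialSum_ofSums S _ _ j hi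
  refine ⟨c, (Band.norm_eq_zero_iff c).2 ⟨fun i j hi _ => ?_, ?_⟩, fun i j hi hj h => ?_⟩
  · rw [hc i j hi.le]
    exact hSJ i j
  · rw [hc m n le_rfl]
    exact if_neg fun h => lt_irrefl _ h.1
  · rw [hc i j hi.le]
    exact if_pos ⟨hi, hj, h⟩

theorem bandToO_sub {m n : ℕ} (a b : Band K J m n) :
    bandToO K J (a - b) = bandToO K J a - bandToO K J b := map_sub (bandToOₗ K J m n) a b

/-- Subtracting a null matrix, which `Ψ` kills, moves the partial sums before the corner by nearly
optimal elements of `J`. The plain bound by norms of partial sums then becomes the quotient bound.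
-/
theorem norm_bandToO_le (hJ : ∀ m n, J.carrier m n ≤ K.tensPreimage m n) {m n : ℕ}
    (a : Band K J m n) : ‖bandToO K J a‖ ≤ ‖a‖ := by
  refine le_of_forall_pos_le_add fun ε hε => ?_
  have h1 : ∀ i j, ∃ s : T.Hom i j, i < m → j < n →
      s ∈ J.carrier i j ∧ ‖partialSum a.1 i j - s‖ ≤ ‖a‖ + ε := by
    intro i j
    by_cases hi : i < m ∧ j < n
    · obtain ⟨s, hs, hs'⟩ := a.exists_norm_partialSum_sub_le hε hi.1 hi.2
      exact ⟨s, fun _ _ => ⟨hs, hs'⟩⟩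
    · exact ⟨0, fun h h' => absurd ⟨h, h'⟩ hi⟩
  choose s hs using h1
  obtain ⟨c, hc0, hc⟩ := Band.exists_norm_eq_zero hJ s fun i j hi hj => (hs i j hi hj).1
  rw [← sub_zero (bandToO K J a), ← bandToO_eq_zero_of_norm_eq_zero hJ hc0, ← bandToO_sub]
  refine norm_bandToO_le_of_partialSum (by positivity) fun i j hi => ?_
  by_cases h : i + n = j + m
  · rw [partialSum_sub]
    rcases hi.lt_or_eq with hi' | rfl
    · have hj : j < n := by omega
      rw [hc i j hi' hj h]
      exact (hs i j hi' hj).2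
    · obtain rfl : j = n := by omega
      rw [((Band.norm_eq_zero_iff c).1 hc0).2, sub_zero]
      exact a.norm_partialSum_le.trans (le_add_of_nonneg_right hε.le)
  · rw [partialSum_eq_zero (a - c).2 i j h, norm_zero]
    positivity

end CStarPrecategory

/-! ### Gauge-invariant ideals -/

namespace CStarPrecategory

variable {T : CStarPrecategory.{u}}

variable {K J : T.Ideal}

theorem continuous_starAlgHom {A B : Type*} [NonUnitalCStarAlgebra A] [NonUnitalCStarAlgebra B]
    (φ : A →⋆ₙₐ[ℂ] B) : Continuous φ :=
  AddMonoidHomClass.continuous_of_bound φ 1 fun x => by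
    rw [one_mul]
    exact NonUnitalStarAlgHom.norm_apply_le φ x

theorem exists_dual_ne_zero {E : Type*} [NormedAddCommGroup E] [NormedSpace ℂ E]
    {Q : Submodule ℂ E} (hQ : IsClosed (Q : Set E)) {p : E} (hp : p ∉ Q) :
    ∃ f : E →L[ℂ] ℂ, (∀ q ∈ Q, f q = 0) ∧ f p ≠ 0 := by
  have : IsClosed (Q : Set E) := hQ
  have h0 : Q.mkQL p ≠ 0 := fun h => hp ((Submodule.Quotient.mk_eq_zero Q).1 h)
  obtain ⟨g, hg⟩ := SeparatingDual.exists_ne_zero (R := ℂ) h0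
  refine ⟨g.comp Q.mkQL, fun q hq => ?_, hg⟩
  have h1 : Q.mkQL q = 0 := (Submodule.Quotient.mk_eq_zero Q).2 hq
  rw [ContinuousLinearMap.comp_apply, h1, map_zero]

/-- If `u* u` is close to an ideal `P`, then `u` is close to a multiple `u v` in `P`, where `v` can
be taken in any `C*`-algebra over which `u* u` lies. -/
theorem IsClosedIdeal.exists_cut {A D : Type*} [NonUnitalCStarAlgebra A] [NonUnitalCStarAlgebra D]
    {P : Submodule ℂ A} (hP : IsClosedIdeal P) {u y : A} (hy : y ∈ P) {δ : ℝ} (hδ : 0 < δ)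
    (hu : ‖star u * u - star y * y‖ < δ) (φ : D →⋆ₙₐ[ℂ] A) {x : D} (hx : IsSelfAdjoint x)
    (hφ : φ x = star u * u) :
    ∃ v : D, u * φ v ∈ P ∧ ‖u - u * φ v‖ ^ 2 ≤ δ := by
  let _ := CStarAlgebra.spectralOrder A
  let _ := CStarAlgebra.spectralOrderedRing A
  have hm : ∀ t : ℝ, max t δ ≠ 0 := fun t => (lt_max_of_lt_right hδ).ne'
  -- Here `h g(h) = (h - δ)₊`, which is in `P` because `h = u* u` is within less than `δ` of `P`, so
  -- `u g(h)` is in `P`. The error `t (1 - g(t))²` is at most `δ`. As `h` is the image of `x`, the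
  -- element `v = g(x)` can be taken in `D`.
  let g : ℝ → ℝ := fun t => max (t - δ) 0 / max t δ
  have hg : Continuous g := Continuous.div (by fun_prop) (by fun_prop) hm
  have hg0 : g 0 = 0 := by simp [g, hδ.le]
  have hgt : ∀ t, t * g t = max (t - δ) 0 := by
    intro t
    simp only [g]
    rcases le_total δ t with h | h
    · rw [max_eq_left h, mul_div_cancel₀ _ (hδ.trans_le h).ne']
    · rw [max_eq_right (by linarith : t - δ ≤ 0), zero_div, mul_zero]
  set h : A := star u * u with hh
  have hsa : IsSelfAdjoint h := IsSelfAdjoint.star_mul_self u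
  have hgc : ContinuousOn g (quasispectrum ℝ h) := hg.continuousOn
  have hvs : star (cfcₙ g h) = cfcₙ g h := cfcₙ_predicate g h
  have e1 : h * cfcₙ g h = cfcₙ (fun t : ℝ => max (t - δ) 0) h := by
    conv_lhs => rw [← cfcₙ_id' ℝ h, cfcₙ_id' ℝ h]
    have := cfcₙ_mul (fun t : ℝ => t) g h (by fun_prop) rfl hgc hg0
    rw [cfcₙ_id' ℝ h] at this
    rw [← this]
    exact cfcₙ_congr fun t _ => hgt t
  have hv : φ (cfcₙ g x) = cfcₙ g h := by
    rw [NonUnitalStarAlgHom.map_cfcₙ (S := ℂ) φ g x hg.continuousOn hg0 (continuous_starAlgHom φ) hx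
      (hx.map φ), hφ]
  refine ⟨cfcₙ g x, ?_, ?_⟩ <;> rw [hv]
  · refine hP.mem_of_star_mul_self_mem ?_
    have e2 : star (u * cfcₙ g h) * (u * cfcₙ g h) =
        cfcₙ g h * cfcₙ (fun t : ℝ => max (t - δ) 0) h := by
      rw [star_mul, hvs, ← e1, hh]
      simp only [mul_assoc]
    rw [e2]
    exact (hP.2 _ _ (hP.cfcₙ_sub_posPart_mem hsa (hP.2 _ _ hy).1 hu)).1
  · rw [sq, ← CStarRing.norm_star_mul_self]
    have e3 : star (u - u * cfcₙ g h) * (u - u * cfcₙ g h) =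
        cfcₙ (fun t : ℝ => t - t * g t - g t * (t - t * g t)) h := by
      rw [cfcₙ_sub (fun t : ℝ => t - t * g t) (fun t : ℝ => g t * (t - t * g t)) h
        (by fun_prop) (by simp) (by fun_prop) (by simp),
        cfcₙ_mul g (fun t : ℝ => t - t * g t) h (by fun_prop) hg0 (by fun_prop) (by simp),
        cfcₙ_sub (fun t : ℝ => t) (fun t : ℝ => t * g t) h
        (by fun_prop) rfl (by fun_prop) (by simp),
        cfcₙ_mul (fun t : ℝ => t) g h (by fun_prop) rfl hgc hg0, cfcₙ_id' ℝ h,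
        star_sub, star_mul, hvs]
      conv_rhs => rw [hh]
      rw [← hh]
      simp only [sub_mul, mul_sub, hh, mul_assoc]
      abel
    rw [e3]
    refine norm_cfcₙ_le fun t ht => ?_
    have ht0 : 0 ≤ t := quasispectrum_nonneg_of_nonneg h (star_mul_self_nonneg u) t ht
    have hg01 : 0 ≤ g t ∧ g t ≤ 1 := by
      refine ⟨by positivity, (div_le_one (lt_max_of_lt_right hδ)).2 (max_le_max ?_ hδ.le)⟩
      linarith
    have h2 : 0 ≤ t - t * g t ∧ t - t * g t ≤ δ := by
      rw [hgt]
      rcases max_cases (t - δ) 0 with h | h <;> constructor <;> linarith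
    rw [Real.norm_eq_abs, abs_le]
    constructor <;> nlinarith

variable {K J : T.Ideal}

/-- The linear span of the image of the universal representation is dense. -/
theorem eq_top_of_univRep_mem {Q : Submodule ℂ (O K J)} (hQ : IsClosed (Q : Set (O K J)))
    (h : ∀ m n (a : K.carrier m n), (univRep K J).toFun m n a ∈ Q) (p : O K J) : p ∈ Q := by
  let W : Submodule ℂ (RepProduct K J) :=
    Submodule.span ℂ {x | ∃ (m n : ℕ) (a : K.carrier m n), x = (productRep K J).toFun m n a}
  let W' : NonUnitalStarSubalgebra ℂ (RepProduct K J) :=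
    { W with
      mul_mem' := by
        intro x y hx hy
        refine Submodule.span_induction₂ (p := fun x y _ _ => x * y ∈ W) ?_ ?_ ?_ ?_ ?_ ?_ ?_ hx hy
        · rintro _ _ ⟨m, n, a, rfl⟩ ⟨l, r, b, rfl⟩
          obtain ⟨p, q, c, hc, -⟩ := (productRep K J).exists_mul_eq a b
          rw [hc]
          exact Submodule.subset_span ⟨p, q, c, rfl⟩
        · intro y _
          rw [zero_mul]
          exact zero_mem _
        · intro y _
          rw [mul_zero]
          exact zero_mem _
        · intro x y z _ _ _ h1 h2
          rw [add_mul]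
          exact add_mem h1 h2
        · intro x y z _ _ _ h1 h2
          rw [mul_add]
          exact add_mem h1 h2
        · intro c x y _ _ h1
          rw [smul_mul_assoc]
          exact W.smul_mem c h1
        · intro c x y _ _ h1
          rw [mul_smul_comm]
          exact W.smul_mem c h1
      star_mem' := by
        intro x hx
        refine Submodule.span_induction (p := fun x _ => star x ∈ W) ?_ ?_ ?_ ?_ hx
        · rintro _ ⟨m, n, a, rfl⟩
          rw [← (productRep K J).map_adj]
          exact Submodule.subset_span ⟨_, _, _, rfl⟩
        · rw [star_zero]
          exact zero_mem _
        · intro x y _ _ h1 h2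
          rw [star_add]
          exact add_mem h1 h2
        · intro c x _ h1
          rw [star_smul]
          exact W.smul_mem _ h1 }
  let Q' : Submodule ℂ (RepProduct K J) :=
    Q.map (algebraO K J).toNonUnitalSubalgebra.toSubmodule.subtype
  have hQ' : IsClosed (Q' : Set (RepProduct K J)) :=
    ((isClosed_algebraO K J).isClosedEmbedding_subtypeVal).isClosedMap _ hQ
  have hW : W ≤ Q' := by
    rw [Submodule.span_le]
    rintro _ ⟨m, n, a, rfl⟩
    exact ⟨_, h m n a, rfl⟩
  have h1 : p.1 ∈ Q' := by
    have h2 : (NonUnitalStarAlgebra.adjoin ℂ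
        {x | ∃ (m n : ℕ) (a : K.carrier m n), x = (productRep K J).toFun m n a}) ≤ W' :=
      NonUnitalStarAlgebra.adjoin_le fun x hx => Submodule.subset_span hx
    exact closure_minimal (fun x hx => hW (h2 hx)) hQ' p.2
  obtain ⟨q, hq, hqp⟩ := h1
  rwa [← Subtype.ext hqp]

variable (K J) in
theorem continuous_gauge_apply (p : O K J) : Continuous fun z : Circle => gauge K J z p := by
  let Q : Submodule ℂ (O K J) :=
    { carrier := {p | Continuous fun z : Circle => gauge K J z p}
      add_mem' := fun {a b} ha hb => by
        have : Continuous fun z : Circle => gauge K J z a + gauge K J z b := ha.add hb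
        simpa only [Set.mem_ofPred_eq, map_add] using this
      zero_mem' := by
        simp only [Set.mem_ofPred_eq, map_zero]
        exact continuous_const
      smul_mem' := fun c a ha => by
        have : Continuous fun z : Circle => c • gauge K J z a := ha.const_smul c
        simpa only [Set.mem_ofPred_eq, map_smul] using this }
  refine eq_top_of_univRep_mem (Q := Q) ?_ ?_ p
  · refine isClosed_of_closure_subset fun p hp => ?_
    -- Gauge automorphisms are contractive, so a norm limit of elements gives a uniform limit of
    -- orbits.
    refine continuous_of_uniform_approx_of_continuous fun u hu => ?_
    obtain ⟨ε, hε, hu⟩ := Metric.mem_uniformity_dist.1 hu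
    obtain ⟨q, hq, hpq⟩ := Metric.mem_closure_iff.1 hp ε hε
    refine ⟨_, hq, fun z => hu ?_⟩
    rw [dist_eq_norm, ← map_sub]
    refine (NonUnitalStarAlgHom.norm_apply_le _ _).trans_lt ?_
    rwa [← dist_eq_norm]
  · intro m n a
    change Continuous fun z : Circle => gauge K J z ((univRep K J).toFun m n a)
    simp only [gauge_univRep]
    have h : Continuous fun z : Circle => (z : ℂ) ^ ((m : ℤ) - n) :=
      (continuous_subtype_val : Continuous fun z : Circle => (z : ℂ)).zpow₀ _ fun z => Or.inl (Circle.coe_ne_zero z)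
    exact h.smul continuous_const

/-- The orbit of `p` under the gauge action, as a function on `ℝ/ℤ`. -/
def orbit (p : O K J) (t : AddCircle (1 : ℝ)) : O K J := gauge K J (AddCircle.toCircle t) p

theorem continuous_orbit (p : O K J) : Continuous (orbit p) :=
  (continuous_gauge_apply K J p).comp AddCircle.continuous_toCircle

theorem norm_orbit_le (p : O K J) (t : AddCircle (1 : ℝ)) : ‖orbit p t‖ ≤ ‖p‖ :=
  NonUnitalStarAlgHom.norm_apply_le _ p

theorem integrable_fourier_smul_orbit (p : O K J) (k : ℤ) :
    MeasureTheory.Integrable (fun t => fourier k t • orbit p t)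
      (AddCircle.haarAddCircle (T := (1 : ℝ))) :=
  (((map_continuous (fourier k)).smul (continuous_orbit p)).integrable_of_hasCompactSupport
    (HasCompactSupport.of_compactSpace _))

/-- The spectral components of `p` for the gauge action. -/
def component (k : ℤ) : O K J →L[ℂ] O K J :=
  LinearMap.mkContinuous
    { toFun := fun p => fourierCoeff (orbit p) k
      map_add' := fun p q => by
        simp only [fourierCoeff]
        rw [← MeasureTheory.integral_add (integrable_fourier_smul_orbit p _)
          (integrable_fourier_smul_orbit q _)]
        refine MeasureTheory.integral_congr_ae (Filter.Eventually.of_forall fun t => ?_)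
        simp only [orbit, map_add, smul_add]
      map_smul' := fun c p => by
        simp only [fourierCoeff, RingHom.id_apply]
        rw [← MeasureTheory.integral_smul]
        refine MeasureTheory.integral_congr_ae (Filter.Eventually.of_forall fun t => ?_)
        simp only [orbit, map_smul]
        rw [smul_comm] } 1 fun p => by
    rw [one_mul]
    change ‖∫ t, fourier (-k) t • orbit p t ∂AddCircle.haarAddCircle‖ ≤ _
    refine (MeasureTheory.norm_integral_le_of_norm_le_const
      (Filter.Eventually.of_forall fun t => ?_)).trans_eq
      (by rw [MeasureTheory.probReal_univ, mul_one])
    rw [norm_smul, fourier_apply, Circle.norm_coe, one_mul]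
    exact norm_orbit_le p t

theorem component_apply (k : ℤ) (p : O K J) :
    component k p = fourierCoeff (orbit p) k := rfl

theorem component_univRep (k : ℤ) {m n : ℕ} (a : K.carrier m n) :
    component k ((univRep K J).toFun m n a) =
      if k = (m : ℤ) - n then (univRep K J).toFun m n a else 0 := by
  have e : orbit ((univRep K J).toFun m n a) =
      fun t => fourier ((m : ℤ) - n) t • (univRep K J).toFun m n a := by
    funext t
    rw [orbit, gauge_univRep, fourier_apply, AddCircle.toCircle_zsmul, Circle.coe_zpow]
  have e2 := congrFun (fourierCoeff_fourier (T := (1 : ℝ)) ((m : ℤ) - n)) k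
  rw [component_apply, e, fourierCoeff]
  simp only [← smul_assoc]
  rw [integral_smul_const]
  rw [fourierCoeff] at e2
  rw [e2, Pi.single_apply, ite_smul, one_smul, zero_smul]

/-- A continuous functional that kills `Q` turns the orbit of `p` into a scalar function on the
circle with vanishing Fourier coefficients. Such a function is zero, in particular at the unit of
the circle, so the functional also kills `p`. -/
theorem mem_of_component_mem {Q : Submodule ℂ (O K J)} (hQ : IsClosed (Q : Set (O K J)))
    {p : O K J} (h : ∀ k, component k p ∈ Q) : p ∈ Q := by
  by_contra hp
  obtain ⟨f, hfQ, hfp⟩ := exists_dual_ne_zero hQ hp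
  let g : C(AddCircle (1 : ℝ), ℂ) := ⟨fun t => f (orbit p t), f.continuous.comp (continuous_orbit p)⟩
  have hg : fourierCoeff g = 0 := by
    funext k
    have h1 := f.integral_comp_comm (integrable_fourier_smul_orbit p (-k))
    have h2 : f (component k p) = 0 := hfQ _ (h k)
    rw [component_apply, fourierCoeff, ← h1] at h2
    rw [fourierCoeff, Pi.zero_apply, ← h2]
    simp only [map_smul]
    rfl
  have hs := has_pointwise_sum_fourier_series_of_summable (f := g) (by rw [hg]; exact summable_zero) 0
  rw [hg] at hs
  simp only [Pi.zero_apply, zero_smul] at hs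
  have h3 : g 0 = 0 := hs.unique hasSum_zero
  refine hfp ?_
  have h4 : orbit p 0 = p := by
    rw [orbit, AddCircle.toCircle_zero]
    refine eq_top_of_univRep_mem (Q := LinearMap.eqLocus
      ((gauge K J 1 : O K J →⋆ₙₐ[ℂ] O K J) : O K J →ₗ[ℂ] O K J) LinearMap.id) ?_ ?_ p
    · exact isClosed_eq (continuous_starAlgHom (gauge K J 1)) continuous_id
    · intro m n a
      change gauge K J 1 _ = _
      rw [gauge_univRep]
      simp
  rw [← h4]
  exact h3

/-- A continuous functional vanishing on `P` vanishes on the integrand, hence on the integral. -/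
theorem component_mem {P : Submodule ℂ (O K J)} (hP : IsClosed (P : Set (O K J)))
    (hPg : ∀ z : Circle, ∀ p ∈ P, gauge K J z p ∈ P) (k : ℤ) {p : O K J} (hp : p ∈ P) :
    component k p ∈ P := by
  by_contra h
  obtain ⟨f, hfP, hfp⟩ := exists_dual_ne_zero hP h
  refine hfp ?_
  rw [component_apply, fourierCoeff, ← f.integral_comp_comm (integrable_fourier_smul_orbit p (-k))]
  refine MeasureTheory.integral_eq_zero_of_ae (Filter.Eventually.of_forall fun t => ?_)
  exact hfP _ (P.smul_mem _ (hPg _ _ hp))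

end CStarPrecategory

/-! ### Approximation of gauge-invariant ideals -/

namespace CStarPrecategory

variable {T : CStarPrecategory.{u}}

variable {K J : T.Ideal}
variable {K J : T.Ideal}

/-- The inclusion `M(m,n) ⊆ M(m+d,n+d)`. -/
def Band.inclPow {m n : ℕ} (a : Band K J m n) : ∀ d : ℕ, Band K J (m + d) (n + d)
  | 0 => a
  | d + 1 => Band.incl (Band.inclPow a d)

theorem bandToO_inclPow {m n : ℕ} (a : Band K J m n) (d : ℕ) :
    bandToO K J (Band.inclPow a d) = bandToO K J a := by
  induction d with
  | zero => rfl
  | succ d ih => exact (bandToO_incl _).trans ih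

/-- Matrices on the same diagonal can be moved to a common corner by the inclusions, which `Ψ` does
not see. -/
theorem exists_bandToO_add {m n m' n' : ℕ} (a : Band K J m n) (b : Band K J m' n')
    (h : m + n' = m' + n) :
    ∃ (r s : ℕ) (c : Band K J r s), r + n = m + s ∧ bandToO K J c = bandToO K J a + bandToO K J b := by
  rcases le_total m m' with h' | h'
  · obtain ⟨d, rfl⟩ := Nat.exists_eq_add_of_le h'
    obtain rfl : n' = n + d := by omega
    exact ⟨_, _, Band.inclPow a d + b, by omega, by rw [bandToO_add, bandToO_inclPow]⟩
  · obtain ⟨d, rfl⟩ := Nat.exists_eq_add_of_le h'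
    obtain rfl : n = n' + d := by omega
    exact ⟨_, _, a + Band.inclPow b d, by omega, by rw [bandToO_add, bandToO_inclPow]⟩

variable (K J) in
/-- The elements of `O_T(K, J)` of degree `k` that come from matrices. -/
def bandDegree (k : ℤ) : Submodule ℂ (O K J) where
  carrier := {x | ∃ (m n : ℕ) (a : Band K J m n), (m : ℤ) - n = k ∧ bandToO K J a = x}
  add_mem' := by
    rintro _ _ ⟨m, n, a, h, rfl⟩ ⟨m', n', a', h', rfl⟩
    obtain ⟨r, s, c, hrs, hc⟩ := exists_bandToO_add a a' (by omega)
    exact ⟨r, s, c, by omega, hc⟩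
  zero_mem' := by
    rcases le_total 0 k with h | h
    · exact ⟨k.toNat, 0, 0, by omega, map_zero (bandToOₗ K J k.toNat 0)⟩
    · exact ⟨0, (-k).toNat, 0, by omega, map_zero (bandToOₗ K J 0 (-k).toNat)⟩
  smul_mem' := by
    rintro c _ ⟨m, n, a, h, rfl⟩
    exact ⟨m, n, c • a, h, bandToO_smul c a⟩

theorem component_mem_closure (k : ℤ) (p : O K J) :
    component k p ∈ (bandDegree K J k).topologicalClosure := by
  refine eq_top_of_univRep_mem
    (Q := (bandDegree K J k).topologicalClosure.comap (component k).toLinearMap) ?_ ?_ p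
  · exact (Submodule.isClosed_topologicalClosure _).preimage (component k).continuous
  · intro m n a
    change component k ((univRep K J).toFun m n a) ∈ (bandDegree K J k).topologicalClosure
    rw [component_univRep]
    split_ifs with h
    · exact Submodule.le_topologicalClosure _ ⟨m, n, Band.single K J a, h.symm, bandToO_single a⟩
    · exact zero_mem _

theorem isSelfAdjoint_diagSums {m n : ℕ} (b : Band K J m n) :
    IsSelfAdjoint (⟨diagSums K J m (Band.mul (Band.adj b) b), _, rfl⟩ : diagAlg K J m) := by
  refine Subtype.ext (funext fun i => ?_)
  have e : partialSum (Band.mul (Band.adj b) b).1 i i = _ :=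
    partialSum_convolution (a := (Band.adj b).1) b.2 i i (Nat.lt_succ_iff.1 i.2)
  change T.adj (partialSum (Band.mul (Band.adj b) b).1 i i) =
    partialSum (Band.mul (Band.adj b) b).1 i i
  rw [e, map_sum]
  refine Finset.sum_congr rfl fun k _ => ?_
  have e2 : partialSum (Band.adj b).1 k i = T.adj (partialSum b.1 i k) := partialSum_adj b.1 k i
  rw [e2, T.adj_comp, T.adj_adj]

/-- A gauge-invariant closed ideal is generated, as a closed subspace, by the elements that come
from matrices. -/
theorem mem_of_gaugeInvariant {P Q : Submodule ℂ (O K J)} (hP : P ∈ gaugeLat K J)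
    (hQ : IsClosed (Q : Set (O K J)))
    (h : ∀ (m n : ℕ) (a : Band K J m n), bandToO K J a ∈ P → bandToO K J a ∈ Q)
    {p : O K J} (hp : p ∈ P) : p ∈ Q := by
  refine mem_of_component_mem hQ fun k => ?_
  set y := component k p with hy
  have hyP : y ∈ P := component_mem hP.1.1 hP.2 k hp
  have hyc : y ∈ closure (bandDegree K J k : Set (O K J)) := component_mem_closure k p
  -- The homogeneous element `y` of `P` is approximated by some `Ψ(b)`, with `Ψ(b)* Ψ(b)` close to
  -- `y* y`. Cutting `Ψ(b)` into `P` is done by a factor from the algebra `diagAlg` of square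
  -- matrices, so the result is again the image of a matrix.
  rw [← SetLike.mem_coe, ← hQ.closure_eq, Metric.mem_closure_iff]
  intro ε hε
  have hc : Continuous fun u : O K J => star u * u - star y * y := by fun_prop
  have ho : IsOpen {u : O K J | ‖star u * u - star y * y‖ < (ε / 2) ^ 2 ∧ ‖y - u‖ < ε / 2} :=
    (isOpen_lt hc.norm continuous_const).inter
      (isOpen_lt (continuous_const.sub continuous_id).norm continuous_const)
  obtain ⟨u, ⟨hu1, hu2⟩, ⟨m, n, b, -, rfl⟩⟩ := mem_closure_iff.1 hyc _ ho
    ⟨by rw [sub_self, norm_zero]; positivity, by rw [sub_self, norm_zero]; positivity⟩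
  obtain ⟨v, hgP, hgn⟩ := hP.1.exists_cut hyP (by positivity) hu1 (diagHom K J m)
    (isSelfAdjoint_diagSums b) (by rw [diagHom_diagSums, bandToO_mul, bandToO_adj])
  set c := diagBand v
  rw [diagHom_apply, ← bandToO_mul] at hgP hgn
  refine ⟨_, h _ _ _ hgP, ?_⟩
  rw [dist_eq_norm]
  have h1 := abs_le_of_sq_le_sq' hgn (by positivity)
  calc ‖y - bandToO K J (Band.mul b c)‖ ≤ ‖y - bandToO K J b‖ +
        ‖bandToO K J b - bandToO K J (Band.mul b c)‖ := norm_sub_le_norm_sub_add_norm_sub _ _ _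
    _ < ε / 2 + ε / 2 := add_lt_add_of_lt_of_le hu2 h1.2
    _ = ε := by ring

end CStarPrecategory

/-! ### Ideals in the precategory of matrices -/

namespace CStarPrecategory

variable {T : CStarPrecategory.{u}}

variable {K J : T.Ideal}
variable {K J : T.Ideal}

theorem toKJ_eq_iff {m n : ℕ} {a b : Band K J m n} : toKJ K J a = toKJ K J b ↔ ‖a - b‖ = 0 :=
  SeparationQuotient.mk_eq_mk.trans Band.inseparable_iff

theorem toKJ_surjective {m n : ℕ} (x : (KJ K J).Hom m n) : ∃ a : Band K J m n, toKJ K J a = x :=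
  SeparationQuotient.surjective_mk x

theorem comp_toKJ {l m n : ℕ} (a : Band K J m n) (b : Band K J l m) :
    (KJ K J).comp (toKJ K J a) (toKJ K J b) = toKJ K J (Band.mul a b) := rfl

theorem tens_toKJ {m n : ℕ} (a : Band K J m n) :
    (KJ K J).tens (toKJ K J a) = toKJ K J (Band.incl a) := rfl

theorem toKJ_add {m n : ℕ} (a b : Band K J m n) :
    toKJ K J (a + b) = toKJ K J a + toKJ K J b := rfl

theorem partialSum_mem {N : T.Ideal} (hN : N.IsInvariant) {x : ∀ i j : ℕ, T.Hom i j}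
    (hx : ∀ i j, x i j ∈ N.carrier i j) (i j : ℕ) : partialSum x i j ∈ N.carrier i j := by
  induction i generalizing j with
  | zero => exact hx 0 j
  | succ i ih =>
    cases j with
    | zero => exact hx _ 0
    | succ j => exact add_mem (hx _ _) (hN _ _ _ (ih j))

/-- The condition on the partial sums of a matrix that characterizes `N_J[K ∩ N]`. -/
def Band.SumsMem (N : T.Ideal) {m n : ℕ} (a : Band K J m n) : Prop :=
  (∀ i j, i < m → j < n → partialSum a.1 i j ∈ (sumIdeal J N).carrier i j) ∧
    partialSum a.1 m n ∈ N.carrier m n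

/-- Null matrices change the partial sums before the corner by arbitrary elements of `J`, so these
parts can be subtracted to leave all partial sums in `N`. By invariance the entries are then in `N`
too. -/
theorem toKJ_mem_bandIdeal_iff (hJ : ∀ m n, J.carrier m n ≤ K.tensPreimage m n) {N : T.Ideal}
    (hN : N.IsInvariant) {m n : ℕ} (a : Band K J m n) :
    toKJ K J a ∈ bandIdeal K J (K ⊓ N) m n ↔ a.SumsMem N := by
  constructor
  · rintro ⟨b, hb, hab⟩
    rw [toKJ_eq_iff, Band.norm_eq_zero_iff] at hab
    have hbN := partialSum_mem hN fun i j => (hb i j).2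
    refine ⟨fun i j hi hj => ?_, ?_⟩
    · have h1 := hab.1 i j hi hj
      rw [partialSum_sub] at h1
      rw [← sub_sub_cancel (partialSum b.1 i j) (partialSum a.1 i j)]
      exact sub_mem (Submodule.mem_sup_right (hbN i j)) (Submodule.mem_sup_left h1)
    · have h1 := hab.2
      rw [partialSum_sub, sub_eq_zero] at h1
      rw [← h1]
      exact hbN m n
  · rintro ⟨h1, h2⟩
    have h3 : ∀ i j, ∃ s : T.Hom i j, i < m → j < n →
        s ∈ J.carrier i j ∧ partialSum a.1 i j - s ∈ N.carrier i j := by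
      intro i j
      by_cases hi : i < m ∧ j < n
      · obtain ⟨s, hs, t, ht, hst⟩ := Submodule.mem_sup.1 (h1 i j hi.1 hi.2)
        refine ⟨s, fun _ _ => ⟨hs, ?_⟩⟩
        rwa [← hst, add_sub_cancel_left]
      · exact ⟨0, fun h h' => absurd ⟨h, h'⟩ hi⟩
    choose s hs using h3
    obtain ⟨c, hc0, hc⟩ := Band.exists_norm_eq_zero hJ s fun i j hi hj => (hs i j hi hj).1
    have hS : ∀ i j, i ≤ m → partialSum (a - c).1 i j ∈ N.carrier i j := by
      intro i j hi
      by_cases h : i + n = j + m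
      · rw [partialSum_sub]
        rcases hi.lt_or_eq with hi' | rfl
        · have hj : j < n := by omega
          rw [hc i j hi' hj h]
          exact (hs i j hi' hj).2
        · obtain rfl : j = n := by omega
          rw [((Band.norm_eq_zero_iff c).1 hc0).2, sub_zero]
          exact h2
      · rw [partialSum_eq_zero (a - c).2 i j h]
        exact zero_mem _
    refine ⟨a - c, fun i j => ⟨(a - c).2.1 i j, ?_⟩, ?_⟩
    · by_cases hi : i ≤ m
      · rw [eq_sub_of_add_eq (partialSum_eq (a - c).1 i j).symm]
        refine sub_mem (hS i j hi) ?_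
        cases i <;> cases j <;> simp only [shift]
        exacts [zero_mem _, zero_mem _, zero_mem _, hN _ _ _ (hS _ _ (by omega))]
      · rw [(a - c).2.2 i j (by omega)]
        exact zero_mem _
    · rw [toKJ_eq_iff, sub_sub_cancel_left, norm_neg, hc0]

/-- The seminorm sees partial sums before the corner only modulo `J`. This suffices because `J + N`
contains `J` and is closed. -/
theorem Band.isClosed_sumsMem (N : T.Ideal) (m n : ℕ) :
    IsClosed {a : Band K J m n | a.SumsMem N} := by
  refine isClosed_of_closure_subset fun a ha => ?_
  have h : ∀ ε : ℝ, 0 < ε → ∃ b : Band K J m n, b.SumsMem N ∧ ‖a - b‖ < ε := by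
    intro ε hε
    obtain ⟨b, hb, hab⟩ := Metric.mem_closure_iff.1 ha ε hε
    exact ⟨b, hb, by rwa [← dist_eq_norm]⟩
  refine ⟨fun i j hi hj => ?_, ?_⟩
  · rw [← SetLike.mem_coe, ← ((sumIdeal J N).isClosed i j).closure_eq, Metric.mem_closure_iff]
    intro ε hε
    obtain ⟨b, hb, hab⟩ := h (ε / 2) (by positivity)
    obtain ⟨s, hs, hs'⟩ := (a - b).exists_norm_partialSum_sub_le (half_pos hε) hi hj
    refine ⟨partialSum b.1 i j + s, add_mem (hb.1 i j hi hj) (Submodule.mem_sup_left hs), ?_⟩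
    rw [partialSum_sub] at hs'
    rw [dist_eq_norm, ← sub_sub]
    linarith
  · rw [← SetLike.mem_coe, ← (N.isClosed m n).closure_eq, Metric.mem_closure_iff]
    intro ε hε
    obtain ⟨b, hb, hab⟩ := h ε hε
    refine ⟨_, hb.2, ?_⟩
    rw [dist_eq_norm, ← partialSum_sub]
    exact (a - b).norm_partialSum_le.trans_lt hab

theorem Band.SumsMem.mul_left {N : T.Ideal} {l m n : ℕ} (a : Band K J m n) {b : Band K J l m}
    (hb : b.SumsMem N) : (Band.mul a b).SumsMem N := by
  have hS := partialSum_convolution (a := a.1) b.2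
  refine ⟨fun i j hi hj => ?_, ?_⟩
  · change partialSum (convolution m a.1 b.1) i j ∈ _
    rw [hS i j hi.le]
    refine Submodule.sum_mem _ fun k hk => ?_
    by_cases h : i + m = k + l
    · exact (sumIdeal J N).comp_mem_left _ (hb.1 i k hi (by omega))
    · rw [partialSum_eq_zero b.2 i k h, map_zero]
      exact zero_mem _
  · change partialSum (convolution m a.1 b.1) l n ∈ _
    rw [hS l n le_rfl]
    refine Submodule.sum_mem _ fun k hk => ?_
    by_cases h : k = m
    · subst h
      exact N.comp_mem_left _ hb.2
    · rw [partialSum_eq_zero b.2 l k (by omega), map_zero]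
      exact zero_mem _

theorem Band.SumsMem.mul_right {N : T.Ideal} {l m n : ℕ} {a : Band K J m n} (b : Band K J l m)
    (ha : a.SumsMem N) : (Band.mul a b).SumsMem N := by
  have hS := partialSum_convolution (a := a.1) b.2
  refine ⟨fun i j hi hj => ?_, ?_⟩
  · change partialSum (convolution m a.1 b.1) i j ∈ _
    rw [hS i j hi.le]
    refine Submodule.sum_mem _ fun k hk => ?_
    by_cases h : k + n = j + m
    · exact (sumIdeal J N).comp_mem_right _ (ha.1 k j (by omega) hj)
    · rw [partialSum_eq_zero a.2 k j h]
      simp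
  · change partialSum (convolution m a.1 b.1) l n ∈ _
    rw [hS l n le_rfl]
    refine Submodule.sum_mem _ fun k hk => ?_
    by_cases h : k = m
    · subst h
      exact N.comp_mem_right _ ha.2
    · rw [partialSum_eq_zero a.2 k n (by omega)]
      simp

theorem Band.SumsMem.incl {N : T.Ideal} (hN : N.IsInvariant) {m n : ℕ} {a : Band K J m n}
    (ha : a.SumsMem N) : (Band.incl a).SumsMem N := by
  refine ⟨fun i j hi hj => ?_, ?_⟩
  · change partialSum a.1 i j ∈ _
    by_cases h : i + n = j + m
    · rcases Nat.lt_succ_iff_lt_or_eq.1 hi with h' | h'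
      · exact ha.1 i j h' (by omega)
      · obtain rfl : j = n := by omega
        subst h'
        exact Submodule.mem_sup_right ha.2
    · rw [partialSum_eq_zero a.2 i j h]
      exact zero_mem _
  · change a.1 (m + 1) (n + 1) + T.tens (partialSum a.1 m n) ∈ _
    rw [a.2.2 _ _ (by omega), zero_add]
    exact hN _ _ _ ha.2

/-- After the inclusion the old corner is known to be in `J + N` with its tensor in `N`; saturation
puts it in `N`. -/
theorem Band.SumsMem.of_incl {N : T.Ideal} (hN : N.IsInvariant) (hNJ : N.IsSaturated J) {m n : ℕ}
    {a : Band K J m n} (ha : (Band.incl a).SumsMem N) : a.SumsMem N := by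
  refine ⟨fun i j hi hj => ha.1 i j (by omega) (by omega), ?_⟩
  have h2 : a.1 (m + 1) (n + 1) + T.tens (partialSum a.1 m n) ∈ N.carrier (m + 1) (n + 1) := ha.2
  rw [a.2.2 _ _ (by omega), zero_add] at h2
  exact mem_of_mem_sumIdeal hN hNJ (ha.1 m n (by omega) (by omega)) h2

/-- `N_J[K ∩ N]` as an ideal. -/
def bandIdealOf (hJ : ∀ m n, J.carrier m n ≤ K.tensPreimage m n) {N : T.Ideal}
    (hN : N.IsInvariant) : (KJ K J).Ideal where
  carrier m n :=
    { carrier := bandIdeal K J (K ⊓ N) m n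
      add_mem' := by
        rintro _ _ ⟨a, ha, rfl⟩ ⟨b, hb, rfl⟩
        exact ⟨a + b, fun i j => add_mem (ha i j) (hb i j), rfl⟩
      zero_mem' := ⟨0, fun i j => zero_mem _, rfl⟩
      smul_mem' := by
        rintro c _ ⟨a, ha, rfl⟩
        exact ⟨c • a, fun i j => Submodule.smul_mem _ c (ha i j), rfl⟩ }
  isClosed m n := by
    refine SeparationQuotient.isQuotientMap_mk.isClosed_preimage.1 ?_
    convert! Band.isClosed_sumsMem (K := K) (J := J) N m n using 1
    ext a
    exact toKJ_mem_bandIdeal_iff hJ hN a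
  comp_mem_left {l m n} a b hb := by
    obtain ⟨a, rfl⟩ := toKJ_surjective a
    obtain ⟨b, rfl⟩ := toKJ_surjective b
    exact (toKJ_mem_bandIdeal_iff hJ hN _).2
      (((toKJ_mem_bandIdeal_iff hJ hN b).1 hb).mul_left a)
  comp_mem_right {l m n} a b ha := by
    obtain ⟨a, rfl⟩ := toKJ_surjective a
    obtain ⟨b, rfl⟩ := toKJ_surjective b
    exact (toKJ_mem_bandIdeal_iff hJ hN _).2
      (((toKJ_mem_bandIdeal_iff hJ hN a).1 ha).mul_right b)

theorem isInvariant_bandIdealOf (hJ : ∀ m n, J.carrier m n ≤ K.tensPreimage m n) {N : T.Ideal}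
    (hN : N.IsInvariant) : (bandIdealOf hJ hN).IsInvariant := by
  intro m n a ha
  obtain ⟨a, rfl⟩ := toKJ_surjective a
  exact (toKJ_mem_bandIdeal_iff hJ hN _).2 (((toKJ_mem_bandIdeal_iff hJ hN a).1 ha).incl hN)

theorem isSaturated_bandIdealOf (hJ : ∀ m n, J.carrier m n ≤ K.tensPreimage m n) {N : T.Ideal}
    (hN : N.IsInvariant) (hNJ : N.IsSaturated J) : (bandIdealOf hJ hN).IsSaturated ⊤ := by
  intro m n a _ ha
  obtain ⟨a, rfl⟩ := toKJ_surjective a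
  exact (toKJ_mem_bandIdeal_iff hJ hN _).2
    (((toKJ_mem_bandIdeal_iff hJ hN (Band.incl a)).1 ha).of_incl hN hNJ)

theorem mem_lat_top_iff {NJ : (KJ K J).Ideal} :
    NJ ∈ Lat (⊤ : (KJ K J).Ideal) ⊤ ↔ NJ.IsInvariant ∧ NJ.IsSaturated ⊤ := by
  have h : ∀ N : (KJ K J).Ideal, ⊤ ⊓ N = N := fun N => by
    ext m n x
    exact and_iff_right trivial
  constructor
  · rintro ⟨N, h1, h2, rfl⟩
    rw [h]
    exact ⟨h1, h2⟩
  · rintro ⟨h1, h2⟩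
    exact ⟨NJ, h1, h2, (h NJ).symm⟩

theorem single_mem_bandIdeal_iff (hJ : ∀ m n, J.carrier m n ≤ K.tensPreimage m n) {N : T.Ideal}
    (hN : N.IsInvariant) {m n : ℕ} (a : K.carrier m n) :
    toKJ K J (Band.single K J a) ∈ bandIdeal K J (K ⊓ N) m n ↔ (a : T.Hom m n) ∈ N.carrier m n := by
  constructor
  · intro h
    have h2 := ((toKJ_mem_bandIdeal_iff hJ hN _).1 h).2
    rwa [partialSum_single, toeplitz_same] at h2
  · intro h
    refine ⟨Band.single K J a, fun i j => ?_, rfl⟩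
    change entry (a : T.Hom m n) i j ∈ _
    by_cases hij : i = m ∧ j = n
    · obtain ⟨rfl, rfl⟩ := hij
      rw [entry_same]
      exact ⟨a.2, h⟩
    · rw [entry_of_ne _ hij]
      exact zero_mem _

end CStarPrecategory

/-! ### Saturated ideals in the precategory of matrices -/

namespace CStarPrecategory

variable {T : CStarPrecategory.{u}}

variable {K J : T.Ideal}
variable {K J : T.Ideal}

variable (K J) in
/-- `Band.single` as a linear map. -/
def Band.singleₗ (m n : ℕ) : K.carrier m n →ₗ[ℂ] Band K J m n where
  toFun := Band.single K J
  map_add' a b := Subtype.ext (entry_add (a : T.Hom m n) b)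
  map_smul' c a := Subtype.ext (entry_smul c (a : T.Hom m n))

theorem Band.norm_le_of_partialSum {m n : ℕ} {a : Band K J m n} {C : ℝ} (hC : 0 ≤ C)
    (h : ∀ i j, i ≤ m → ‖partialSum a.1 i j‖ ≤ C) : ‖a‖ ≤ C := by
  rw [Band.norm_def]
  refine max_le ?_ (h m n le_rfl)
  refine (pi_norm_le_iff_of_nonneg hC).2 fun i => (pi_norm_le_iff_of_nonneg hC).2 fun j => ?_
  exact (Submodule.Quotient.norm_mk_le (S := J.carrier i j) _).trans (h i j i.2.le)

theorem Band.norm_single_le {m n : ℕ} (a : K.carrier m n) : ‖Band.single K J a‖ ≤ ‖a‖ :=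
  Band.norm_le_of_partialSum (norm_nonneg _) fun i j _ => norm_toeplitz_le (a : T.Hom m n) i j

theorem continuous_toKJ_single (m n : ℕ) :
    Continuous fun a : K.carrier m n => toKJ K J (Band.single K J a) := by
  have h : Continuous (Band.singleₗ K J m n) :=
    AddMonoidHomClass.continuous_of_bound (Band.singleₗ K J m n) 1 fun a => by
      rw [one_mul]
      exact Band.norm_single_le a
  exact SeparationQuotient.continuous_mk.comp h

/-- Multiplying by a matrix concentrated at the corner retains only the corner partial sum of the
other factor. This links classes in `K_J` to products of arrows in `T`. -/
theorem Band.mul_single {l m n : ℕ} (a : Band K J m n) (c : K.carrier l m) :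
    Band.mul a (Band.single K J c) =
      Band.single K J ⟨T.comp (partialSum a.1 m n) (c : T.Hom l m), K.comp_mem_left _ c.2⟩ := by
  refine Band.ext_partialSum fun i j hi => ?_
  have e1 : partialSum (Band.mul a (Band.single K J c)).1 i j =
      ∑ k ∈ Finset.range (m + 1), T.comp (partialSum a.1 k j) (toeplitz (c : T.Hom l m) i k) :=
    partialSum_convolution (a := a.1) (Band.single K J c).2 i j hi
  rw [e1, partialSum_single]
  by_cases h : i = l ∧ j = n
  · obtain ⟨rfl, rfl⟩ := h
    rw [toeplitz_same, Finset.sum_eq_single_of_mem m (Finset.mem_range.2 (by omega)) fun k _ hk => by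
      rw [toeplitz_eq_zero _ (by omega), map_zero], toeplitz_same]
  · rw [toeplitz_eq_zero (T.comp (partialSum a.1 m n) (c : T.Hom l m)) (by omega)]
    refine Finset.sum_eq_zero fun k _ => ?_
    by_cases hk : i = l ∧ k = m
    · obtain ⟨rfl, rfl⟩ := hk
      rw [partialSum_eq_zero a.2 k j (by omega)]
      simp
    · rw [toeplitz_eq_zero _ (by omega), map_zero]

theorem Band.single_mul_single {l m n : ℕ} (a : K.carrier m n) (c : K.carrier l m) :
    Band.mul (Band.single K J a) (Band.single K J c) =
      Band.single K J ⟨T.comp (a : T.Hom m n) (c : T.Hom l m), K.comp_mem_left _ c.2⟩ := by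
  rw [Band.mul_single]
  congr 2
  rw [partialSum_single, toeplitz_same]

theorem Band.inclPow_mem {NJ : (KJ K J).Ideal} (hN : NJ.IsInvariant) {m n : ℕ} {a : Band K J m n}
    (ha : toKJ K J a ∈ NJ.carrier m n) (d : ℕ) :
    toKJ K J (Band.inclPow a d) ∈ NJ.carrier (m + d) (n + d) := by
  induction d with
  | zero => exact ha
  | succ d ih => exact hN _ _ _ ih

theorem Band.inclPow_val {m n : ℕ} (a : Band K J m n) (d : ℕ) : (Band.inclPow a d).1 = a.1 := by
  induction d with
  | zero => rfl
  | succ d ih => exact ih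

theorem Band.partialSum_add_right {m n : ℕ} (a : Band K J m n) (d : ℕ) :
    partialSum a.1 (m + d) (n + d) = T.tensPow d (partialSum a.1 m n) := by
  induction d with
  | zero => rfl
  | succ d ih =>
    change a.1 (m + d + 1) (n + d + 1) + T.tens (partialSum a.1 (m + d) (n + d)) = _
    rw [ih, a.2.2 _ _ (by omega), zero_add]
    rfl

/-- The space of all `a` in `K(m,n)` whose class in `K_J` is in a given ideal. -/
def coreSubmodule (NJ : (KJ K J).Ideal) (m n : ℕ) : Submodule ℂ (T.Hom m n) where
  carrier := {a | ∃ h : a ∈ K.carrier m n, toKJ K J (Band.single K J ⟨a, h⟩) ∈ NJ.carrier m n}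
  add_mem' := by
    rintro a b ⟨ha, ha'⟩ ⟨hb, hb'⟩
    refine ⟨add_mem ha hb, ?_⟩
    have e : Band.single K J ⟨a + b, add_mem ha hb⟩ =
      Band.single K J ⟨a, ha⟩ + Band.single K J ⟨b, hb⟩ :=
        (Band.singleₗ K J m n).map_add ⟨a, ha⟩ ⟨b, hb⟩
    rw [e]
    exact add_mem ha' hb'
  zero_mem' := ⟨zero_mem _, by
    have e : Band.single K J (0 : K.carrier m n) = 0 := (Band.singleₗ K J m n).map_zero
    change toKJ K J (Band.single K J 0) ∈ _
    rw [e]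
    exact zero_mem _⟩
  smul_mem' := by
    rintro c a ⟨ha, ha'⟩
    refine ⟨Submodule.smul_mem _ c ha, ?_⟩
    have e : Band.single K J ⟨c • a, Submodule.smul_mem _ c ha⟩ =
      c • Band.single K J ⟨a, ha⟩ := (Band.singleₗ K J m n).map_smul c ⟨a, ha⟩
    rw [e]
    exact Submodule.smul_mem _ c ha'

theorem isClosed_coreSubmodule (NJ : (KJ K J).Ideal) (m n : ℕ) :
    IsClosed (coreSubmodule NJ m n : Set (T.Hom m n)) := by
  have h1 := (NJ.isClosed m n).preimage (continuous_toKJ_single (K := K) (J := J) m n)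
  have h2 := ((K.isClosed m n).isClosedEmbedding_subtypeVal).isClosedMap _ h1
  convert! h2 using 1
  ext a
  constructor
  · rintro ⟨h, h'⟩
    exact ⟨⟨a, h⟩, h', rfl⟩
  · rintro ⟨⟨a, h⟩, h', rfl⟩
    exact ⟨h, h'⟩

/-- The ideal of all `a` in `K` whose class in `K_J` is in a given ideal. -/
def coreIdeal (NJ : (KJ K J).Ideal) : T.Ideal where
  carrier := coreSubmodule NJ
  isClosed := isClosed_coreSubmodule NJ
  comp_mem_left {l m n} a b hb := by
    obtain ⟨h, h'⟩ := hb
    -- The arrow `a` need not be in `K` and so has no class in `K_J`. Replacing `b` by `u b` with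
    -- `u` in `K` lets `a u` act instead.
    refine mem_of_forall_comp_mem_left K h (C := {y | T.comp a y ∈ coreSubmodule NJ l n})
      ((isClosed_coreSubmodule NJ l n).preimage (continuous_comp_left a)) fun u hu => ?_
    refine ⟨K.comp_mem_left a (K.comp_mem_left u h), ?_⟩
    have h2 := NJ.comp_mem_left (toKJ K J (Band.single K J ⟨_, K.comp_mem_left a hu⟩)) h'
    rw [comp_toKJ, Band.single_mul_single] at h2
    simpa only [T.comp_assoc] using h2
  comp_mem_right {l m n} a b ha := by
    obtain ⟨h, h'⟩ := ha
    refine mem_of_forall_comp_mem K h (C := {y | T.comp y b ∈ coreSubmodule NJ l n})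
      ((isClosed_coreSubmodule NJ l n).preimage (continuous_comp_right b)) fun u hu => ?_
    refine ⟨K.comp_mem_right b (K.comp_mem_right u h), ?_⟩
    have h2 := NJ.comp_mem_right (toKJ K J (Band.single K J ⟨_, K.comp_mem_right b hu⟩)) h'
    rw [comp_toKJ, Band.single_mul_single] at h2
    simpa only [T.comp_assoc] using h2

/-- The largest ideal `N` with `(a ⊗ 1^k) c` in `I` for all `a` in `N` and `c` in `K`. -/
def invariantHull (K I : T.Ideal) : T.Ideal where
  carrier m n :=
    { carrier := {a | ∀ (l p q : ℕ), ∀ c ∈ K.carrier l p, T.comp (toeplitz a p q) c ∈ I.carrier l q}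
      add_mem' := fun {a b} ha hb l p q c hc => by
        rw [toeplitz_add]
        change T.comp (toeplitz a p q + toeplitz b p q) c ∈ _
        rw [map_add, LinearMap.add_apply]
        exact add_mem (ha l p q c hc) (hb l p q c hc)
      zero_mem' := fun l p q c hc => by
        have e : toeplitz (0 : T.Hom m n) p q = 0 := by
          simpa using congrFun (congrFun (toeplitz_smul 0 (0 : T.Hom m n)) p) q
        rw [e, map_zero, LinearMap.zero_apply]
        exact zero_mem _
      smul_mem' := fun z a ha l p q c hc => by
        rw [toeplitz_smul]
        change T.comp (z • toeplitz a p q) c ∈ _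
        rw [map_smul, LinearMap.smul_apply]
        exact Submodule.smul_mem _ z (ha l p q c hc) }
  isClosed m n := by
    have e : ∀ p q, Continuous fun a : T.Hom m n => toeplitz a p q := fun p q =>
      AddMonoidHomClass.continuous_of_bound
        (⟨⟨fun a => toeplitz a p q, by
          simpa using congrFun (congrFun (toeplitz_smul 0 (0 : T.Hom m n)) p) q⟩,
          fun a b => congrFun (congrFun (toeplitz_add a b) p) q⟩ : T.Hom m n →+ T.Hom p q) 1
        fun a => by
          rw [one_mul]
          exact norm_toeplitz_le a p q
    have e2 : IsClosed (⋂ (l : ℕ) (p : ℕ) (q : ℕ) (c : K.carrier l p),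
        {a : T.Hom m n | T.comp (toeplitz a p q) c.1 ∈ I.carrier l q}) :=
      isClosed_iInter fun l => isClosed_iInter fun p => isClosed_iInter fun q =>
        isClosed_iInter fun c => (I.isClosed l q).preimage ((continuous_comp_right c.1).comp (e p q))
    convert! e2 using 1
    ext a
    simp only [Set.mem_iInter, Subtype.forall]
    rfl
  comp_mem_left {l m n} a b hb k p q c hc := by
    by_cases h : p + n = q + l ∧ l ≤ p
    · obtain ⟨d, rfl⟩ := Nat.exists_eq_add_of_le h.2
      have e := toeplitz_comp (k := 0) a b (p := l + d) (q := m + d) (j := q) (by omega) (by omega)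
      change toeplitz (T.comp a b) (l + d) q = _ at e
      rw [e, T.comp_assoc]
      exact I.comp_mem_left _ (hb k (l + d) (m + d) c hc)
    · rw [toeplitz_eq_zero _ h]
      simp
  comp_mem_right {l m n} a b ha k p q c hc := by
    by_cases h : p + n = q + l ∧ l ≤ p
    · obtain ⟨d, rfl⟩ := Nat.exists_eq_add_of_le h.2
      have e := toeplitz_comp (k := 0) a b (p := l + d) (q := m + d) (j := q) (by omega) (by omega)
      change toeplitz (T.comp a b) (l + d) q = _ at e
      rw [e, T.comp_assoc]
      exact ha k (m + d) q _ (K.comp_mem_left _ hc)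
    · rw [toeplitz_eq_zero _ h]
      simp

theorem isInvariant_invariantHull (K I : T.Ideal) : (invariantHull K I).IsInvariant := by
  intro m n a ha l p q c hc
  have h1 := toeplitz_eq_entry_add a p q
  by_cases h : p = m ∧ q = n
  · obtain ⟨rfl, rfl⟩ := h
    rw [toeplitz_eq_zero _ (by omega)]
    simp
  · rw [entry_of_ne _ h, zero_add] at h1
    rw [← h1]
    exact ha l p q c hc

/-- The top partial sum of a matrix with class in an invariant ideal. -/
theorem partialSum_mem_invariantHull {NJ : (KJ K J).Ideal} (hN : NJ.IsInvariant) {m n : ℕ}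
    {a : Band K J m n} (ha : toKJ K J a ∈ NJ.carrier m n) :
    partialSum a.1 m n ∈ (invariantHull K (coreIdeal NJ)).carrier m n := by
  intro l p q c hc
  by_cases h : p + n = q + m ∧ m ≤ p
  · obtain ⟨d, rfl⟩ := Nat.exists_eq_add_of_le h.2
    obtain rfl : q = n + d := by omega
    refine ⟨K.comp_mem_left _ hc, ?_⟩
    have h2 := NJ.comp_mem_right (toKJ K J (Band.single K J ⟨c, hc⟩)) (Band.inclPow_mem hN ha d)
    rw [comp_toKJ, Band.mul_single] at h2
    convert! h2 using 4
    rw [toeplitz_add_right, ← Band.partialSum_add_right, Band.inclPow_val]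
  · rw [toeplitz_eq_zero _ h]
    simp

/-- An element of the core is the corner partial sum of its one-entry matrix, hence in the hull.
Conversely, for `a` in `K` and in the hull, the products `a u` with `u` in `K` are in the core and
approximate `a`. -/
theorem coreIdeal_eq {NJ : (KJ K J).Ideal} (hN : NJ.IsInvariant) :
    coreIdeal NJ = K ⊓ invariantHull K (coreIdeal NJ) := by
  ext m n a
  constructor
  · rintro ⟨h, h'⟩
    refine ⟨h, ?_⟩
    have h2 := partialSum_mem_invariantHull hN h'
    rwa [partialSum_single, toeplitz_same] at h2
  · rintro ⟨h, h'⟩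
    refine mem_of_forall_comp_mem K h ((coreIdeal NJ).isClosed m n) fun u hu => ?_
    have h2 := h' m m n u hu
    rwa [toeplitz_same] at h2

/-- If `a` is in `J`, then `a` and `a ⊗ 1` have the same class. -/
theorem toKJ_single_tens (hJ : ∀ m n, J.carrier m n ≤ K.tensPreimage m n) {m n : ℕ} {a : T.Hom m n}
    (ha : a ∈ J.carrier m n) :
    toKJ K J (Band.single K J ⟨T.tens a, (hJ m n ha).1⟩) =
      (KJ K J).tens (toKJ K J (Band.single K J ⟨a, (hJ m n ha).2⟩)) := by
  rw [tens_toKJ, eq_comm, toKJ_eq_iff, Band.norm_eq_zero_iff]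
  have e : ∀ i j, partialSum (Band.incl (Band.single K J ⟨a, (hJ m n ha).2⟩) -
      Band.single K J ⟨T.tens a, (hJ m n ha).1⟩).1 i j = entry a i j := fun i j => by
    rw [partialSum_sub]
    change toeplitz a i j - toeplitz (T.tens a) i j = _
    rw [toeplitz_eq_entry_add a, add_sub_cancel_right]
  refine ⟨fun i j _ _ => ?_, ?_⟩
  · rw [e]
    by_cases h : i = m ∧ j = n
    · obtain ⟨rfl, rfl⟩ := h
      rwa [entry_same]
    · rw [entry_of_ne _ h]
      exact zero_mem _
  · rw [e]
    exact entry_of_ne _ (by omega)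

/-- For `a` in `J`, the class of `a ⊗ 1` is the class of `a` tensored in `K_J`, so saturation in
`K_J` descends to `J`-saturation in `T`. -/
theorem isSaturated_invariantHull (hJ : ∀ m n, J.carrier m n ≤ K.tensPreimage m n)
    {NJ : (KJ K J).Ideal} (hN : NJ.IsInvariant) (hNs : NJ.IsSaturated ⊤) :
    (invariantHull K (coreIdeal NJ)).IsSaturated J := by
  intro m n a ha hta
  have h1 : T.tens a ∈ (coreIdeal NJ).carrier (m + 1) (n + 1) := by
    rw [coreIdeal_eq hN]
    exact ⟨(hJ m n ha).1, hta⟩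
  obtain ⟨h, h'⟩ := h1
  have h2 : a ∈ (coreIdeal NJ).carrier m n := by
    refine ⟨(hJ m n ha).2, hNs m n _ Submodule.mem_top ?_⟩
    rwa [← toKJ_single_tens hJ ha]
  rw [coreIdeal_eq hN] at h2
  exact h2.2

end CStarPrecategory

/-! ### The first lattice isomorphism -/

namespace CStarPrecategory

variable {T : CStarPrecategory.{u}}

variable {K J : T.Ideal}
variable {K J : T.Ideal}

theorem Band.exists_eq_incl_add_single {m n : ℕ} (a : Band K J (m + 1) (n + 1)) :
    ∃ a' : Band K J m n, a = Band.incl a' +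
        Band.single K J ⟨a.1 (m + 1) (n + 1), a.2.1 _ _⟩ ∧
      ∀ i j, a'.1 i j = a.1 i j ∨ a'.1 i j = 0 := by
  let a' : Band K J m n := (⟨fun i j => if i ≤ m then a.1 i j else 0, fun i j => by
    dsimp only
    split_ifs
    exacts [a.2.1 i j, zero_mem _], fun i j h => by
    dsimp only
    split_ifs
    exacts [a.2.2 i j (by omega), rfl]⟩ : band K m n)
  refine ⟨a', Subtype.ext (funext fun i => funext fun j => ?_), fun i j => ?_⟩
  · change a.1 i j = (if i ≤ m then a.1 i j else 0) + entry (a.1 (m + 1) (n + 1)) i j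
    by_cases h : i = m + 1 ∧ j = n + 1
    · obtain ⟨rfl, rfl⟩ := h
      rw [if_neg (by omega), entry_same, zero_add]
    · rw [entry_of_ne _ h, add_zero]
      split_ifs with hi
      · rfl
      · exact a.2.2 i j (by omega)
  · change (if i ≤ m then a.1 i j else 0) = a.1 i j ∨ (if i ≤ m then a.1 i j else 0) = 0
    split_ifs
    exacts [Or.inl rfl, Or.inr rfl]

theorem Band.eq_single {m n : ℕ} (h : m = 0 ∨ n = 0) (a : Band K J m n) :
    a = Band.single K J ⟨a.1 m n, a.2.1 m n⟩ := by
  refine Subtype.ext (funext fun i => funext fun j => ?_)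
  change a.1 i j = entry (a.1 m n) i j
  by_cases h : i = m ∧ j = n
  · obtain ⟨rfl, rfl⟩ := h
    rw [entry_same]
  · rw [entry_of_ne _ h, a.2.2 i j (by omega)]

theorem Band.eq_partialSum {m n : ℕ} (h : m = 0 ∨ n = 0) (a : Band K J m n) :
    partialSum a.1 m n = a.1 m n := by
  rcases h with rfl | rfl
  · rfl
  · cases m <;> rfl

/-- Classes of matrices with entries in the core of an invariant ideal are in the ideal. -/
theorem mem_of_entries_mem {NJ : (KJ K J).Ideal} (hN : NJ.IsInvariant) {m n : ℕ}
    (a : Band K J m n) (ha : ∀ i j, a.1 i j ∈ (coreIdeal NJ).carrier i j) :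
    toKJ K J a ∈ NJ.carrier m n := by
  induction m generalizing n with
  | zero =>
    rw [Band.eq_single (Or.inl rfl) a]
    exact (ha _ _).2
  | succ m ih =>
    cases n with
    | zero =>
      rw [Band.eq_single (Or.inr rfl) a]
      exact (ha _ _).2
    | succ n =>
      obtain ⟨a', h, h'⟩ := a.exists_eq_incl_add_single
      rw [h, toKJ_add]
      refine add_mem (hN _ _ _ (ih a' fun i j => ?_)) (ha _ _).2
      rcases h' i j with h | h
      · rw [h]
        exact ha i j
      · rw [h]
        exact zero_mem _

/-- Every class in `K_J(m+1,n+1)` is the sum of an element `w ⊗_J 1` and the class of a matrix with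
one entry `x` at `(m+1,n+1)`, where `x` is determined by the top partial sum. -/
def IsDecomposable (K J : T.Ideal) : Prop :=
  ∀ (m n : ℕ) (a : Band K J (m + 1) (n + 1)), ∃ (w : Band K J m n) (x : K.carrier (m + 1) (n + 1)),
    toKJ K J a = (KJ K J).tens (toKJ K J w) + toKJ K J (Band.single K J x) ∧
      (T.tens (partialSum w.1 m n) = 0 ∨ x = 0)

/-- For the corner entry `x`, the transfer `L(x)` is in `J` and `L(x) ⊗ 1 = x`. Hence the class of
`x` is already of the form `w ⊗_J 1`, and the remaining corner entry is zero. -/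
theorem isDecomposable_of_transfer (hJ : ∀ m n, J.carrier m n ≤ K.tensPreimage m n)
    (hK : K.AdmitsTransferAction) (hJK : ∀ m n, J.carrier m n =
      K.tensPreimage m n ⊓ annihilator (kerTens T.toPrecategory) m n) : IsDecomposable K J := by
  intro m n a
  obtain ⟨L, hL1, hL2⟩ := hK
  -- `L` is not assumed linear; `L(0) = 0` comes from `L(0 (0 ⊗ 1)) = L(0) 0`.
  have hL0 : ∀ n m, (L n m 0 : T.Hom n m) = 0 := by
    intro n m
    have h := hL2 n n m 0 0
    refine Eq.trans (congrArg (fun y => (L n m y : T.Hom n m)) (Subtype.ext ?_))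
      (h.trans (map_zero (T.comp (L n m 0 : T.Hom n m))))
    exact (by simp : (0 : T.Hom (n + 1) (m + 1)) = T.comp 0 (T.tens (0 : T.Hom n n)))
  obtain ⟨a', h, -⟩ := a.exists_eq_incl_add_single
  set x : K.carrier (m + 1) (n + 1) := ⟨a.1 (m + 1) (n + 1), a.2.1 _ _⟩
  have hLJ : (L m n x : T.Hom m n) ∈ J.carrier m n := by
    rw [hJK]
    refine ⟨⟨?_, (L m n x).2⟩, fun k b hb => ?_⟩
    · change T.tens (L m n x : T.Hom m n) ∈ K.carrier (m + 1) (n + 1)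
      rw [hL1]
      exact x.2
    -- For `b ⊗ 1 = 0` and `u` in `K`, `L(x) u b = L(x ((u b) ⊗ 1)) = L(0) = 0`. The factor `u` is
    -- needed because the transfer identity holds only for right factors in `K`.
    · refine mem_of_forall_comp_mem K (L m n x).2 (C := {y | T.comp y b = 0})
        (isClosed_eq (continuous_comp_right b) continuous_const) fun u hu => ?_
      change T.comp (T.comp _ u) b = 0
      rw [T.comp_assoc, ← hL2 k m n x ⟨T.comp u b, K.comp_mem_right b hu⟩, ← hL0 k n]
      refine congrArg (fun y => (L k n y : T.Hom k n)) (Subtype.ext ?_)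
      change T.comp x.1 (T.tens (T.comp u b)) = 0
      have hb0 : T.tens b = 0 := hb
      rw [T.tens_comp, hb0, map_zero, map_zero]
  refine ⟨a' + Band.single K J (L m n x), 0, ?_, Or.inr rfl⟩
  have e0 : Band.single K J (0 : K.carrier (m + 1) (n + 1)) = 0 := (Band.singleₗ K J _ _).map_zero
  have e1 := toKJ_single_tens hJ hLJ
  have e2 : (⟨T.tens (L m n x : T.Hom m n), (hJ m n hLJ).1⟩ : K.carrier (m + 1) (n + 1)) = x :=
    Subtype.ext (hL1 m n x)
  rw [e2] at e1
  rw [e0, toKJ_add, map_add, ← e1, tens_toKJ, h, toKJ_add]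
  exact (add_zero _).symm

/-- The corner sum before the last step splits as `s + t` with `s` in `J` and `t ⊗ 1 = 0`. The class
of `s ⊗ 1` equals that of `s` tensored, so `s` moves into the new corner entry while `t` stays
behind and contributes nothing to the corner sum. Induction then carries all of the corner sum in
one entry. -/
theorem isDecomposable_of_le_sup (hJ : ∀ m n, J.carrier m n ≤ K.tensPreimage m n)
    (hK : ∀ m n, K.carrier m n ≤ J.carrier m n ⊔ kerTens T.toPrecategory m n) :
    IsDecomposable K J := by
  have step : ∀ (m n : ℕ) (a : Band K J (m + 1) (n + 1)),
      (∀ a' : Band K J m n, ∃ (x : K.carrier m n) (b : Band K J m n),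
        toKJ K J a' = toKJ K J (Band.single K J x) + toKJ K J b ∧ partialSum b.1 m n = 0) →
      ∃ (w : Band K J m n) (x : K.carrier (m + 1) (n + 1)),
        toKJ K J a = (KJ K J).tens (toKJ K J w) + toKJ K J (Band.single K J x) ∧
          T.tens (partialSum w.1 m n) = 0 := by
    intro m n a H
    obtain ⟨a', h, -⟩ := a.exists_eq_incl_add_single
    set x : K.carrier (m + 1) (n + 1) := ⟨a.1 (m + 1) (n + 1), a.2.1 _ _⟩
    obtain ⟨x', b, hb, hb0⟩ := H a'
    obtain ⟨s, hs, t, ht, hst⟩ := Submodule.mem_sup.1 (hK m n x'.2)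
    have htK : t ∈ K.carrier m n := by
      rw [← add_sub_cancel_left s t, hst]
      exact sub_mem x'.2 (hJ m n hs).2
    have hsK : s ∈ K.carrier m n := (hJ m n hs).2
    have hts : T.tens s ∈ K.carrier (m + 1) (n + 1) := (hJ m n hs).1
    refine ⟨Band.single K J ⟨t, htK⟩ + b, ⟨T.tens s, hts⟩ + x, ?_, ?_⟩
    · have e1 : Band.single K J x' = Band.single K J ⟨s, hsK⟩ + Band.single K J ⟨t, htK⟩ := by
        rw [← Subtype.ext (a2 := x') (a1 := ⟨s, hsK⟩ + ⟨t, htK⟩) hst]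
        exact (Band.singleₗ K J m n).map_add _ _
      have e2 : Band.single K J (⟨T.tens s, hts⟩ + x) =
          Band.single K J ⟨T.tens s, hts⟩ + Band.single K J x :=
        (Band.singleₗ K J _ _).map_add _ _
      have e3 : toKJ K J (Band.single K J ⟨T.tens s, hts⟩) =
        (KJ K J).tens (toKJ K J (Band.single K J ⟨s, hsK⟩)) := toKJ_single_tens hJ hs
      rw [e2, toKJ_add (Band.single K J ⟨T.tens s, hts⟩), e3, h, toKJ_add (Band.incl a'),
        ← tens_toKJ, hb, e1, toKJ_add, toKJ_add]
      simp only [map_add]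
      abel
    · have e : partialSum (Band.single K J ⟨t, htK⟩ + b).1 m n =
          partialSum (Band.single K J ⟨t, htK⟩).1 m n + partialSum b.1 m n :=
        congrFun (congrFun (partialSum_add _ _) m) n
      rw [e, hb0, add_zero, partialSum_single, toeplitz_same]
      exact ht
  have key : ∀ (m n : ℕ) (a : Band K J m n), ∃ (x : K.carrier m n) (b : Band K J m n),
      toKJ K J a = toKJ K J (Band.single K J x) + toKJ K J b ∧ partialSum b.1 m n = 0 := by
    intro m
    induction m with
    | zero =>
      intro n a
      refine ⟨⟨a.1 0 n, a.2.1 0 n⟩, 0, ?_, Band.eq_partialSum (Or.inl rfl) 0⟩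
      rw [← toKJ_add, add_zero, ← Band.eq_single (Or.inl rfl) a]
    | succ m ih =>
      intro n a
      cases n with
      | zero =>
        refine ⟨⟨a.1 (m + 1) 0, a.2.1 (m + 1) 0⟩, 0, ?_, Band.eq_partialSum (Or.inr rfl) 0⟩
        rw [← toKJ_add, add_zero, ← Band.eq_single (Or.inr rfl) a]
      | succ n =>
        obtain ⟨w, x, h, hw⟩ := step m n a (ih n)
        refine ⟨x, Band.incl w, h.trans (add_comm _ _), ?_⟩
        change w.1 (m + 1) (n + 1) + T.tens (partialSum w.1 m n) = 0
        rw [hw, w.2.2 _ _ (by omega), add_zero]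
  intro m n a
  obtain ⟨w, x, h, hw⟩ := step m n a (key m n)
  exact ⟨w, x, h, Or.inl hw⟩

/-- Saturated invariant ideals consist of the classes of the matrices with entries in the core. -/
theorem carrier_eq_bandIdeal (hJ : ∀ m n, J.carrier m n ≤ K.tensPreimage m n)
    (hd : IsDecomposable K J) {NJ : (KJ K J).Ideal} (hN : NJ.IsInvariant)
    (hNs : NJ.IsSaturated ⊤) (m n : ℕ) :
    (NJ.carrier m n : Set ((KJ K J).Hom m n)) = bandIdeal K J (coreIdeal NJ) m n := by
  have hH := isInvariant_invariantHull K (coreIdeal NJ)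
  have base : ∀ (m n : ℕ) (a : Band K J m n), m = 0 ∨ n = 0 → toKJ K J a ∈ NJ.carrier m n →
      toKJ K J a ∈ (bandIdealOf hJ hH).carrier m n := by
    intro m n a h ha
    have h1 := partialSum_mem_invariantHull hN ha
    exact (toKJ_mem_bandIdeal_iff hJ hH a).2 ⟨fun i j _ _ => by omega, h1⟩
  have key : ∀ (m n : ℕ) (a : Band K J m n), toKJ K J a ∈ NJ.carrier m n →
      toKJ K J a ∈ (bandIdealOf hJ hH).carrier m n := by
    intro m
    induction m with
    | zero => exact fun n a => base 0 n a (Or.inl rfl)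
    | succ m ih =>
      intro n a ha
      cases n with
      | zero => exact base _ _ a (Or.inr rfl) ha
      | succ n =>
        obtain ⟨w, x, h, hx⟩ := hd m n a
        -- If the corner sum of `w` has zero tensor, then `x` is the corner sum of `a`, which is in
        -- the hull because the class of `a` is in the ideal.
        have hxI : (x : T.Hom (m + 1) (n + 1)) ∈ (coreIdeal NJ).carrier (m + 1) (n + 1) := by
          rcases hx with hx | rfl
          · have h1 := partialSum_mem_invariantHull hN ha
            rw [tens_toKJ, ← toKJ_add, toKJ_eq_iff, Band.norm_eq_zero_iff] at h
            have h2 := h.2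
            rw [partialSum_sub, sub_eq_zero] at h2
            have e : partialSum (Band.incl w + Band.single K J x).1 (m + 1) (n + 1) =
                partialSum (Band.incl w).1 (m + 1) (n + 1) +
                  partialSum (Band.single K J x).1 (m + 1) (n + 1) :=
              congrFun (congrFun (partialSum_add _ _) _) _
            have e2 : partialSum (Band.incl w).1 (m + 1) (n + 1) =
              w.1 (m + 1) (n + 1) + T.tens (partialSum w.1 m n) := rfl
            rw [h2, e, e2, hx, w.2.2 _ _ (by omega), add_zero, zero_add, partialSum_single,
              toeplitz_same] at h1
            rw [coreIdeal_eq hN]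
            exact ⟨x.2, h1⟩
          · exact zero_mem _
        -- Removing the class of `x` leaves `w ⊗_J 1` in the ideal, and saturation removes the
        -- tensor.
        have hw : toKJ K J w ∈ NJ.carrier m n := by
          refine hNs m n _ Submodule.mem_top ?_
          rw [h] at ha
          exact (add_mem_cancel_right hxI.2).1 ha
        rw [h]
        refine add_mem (isInvariant_bandIdealOf hJ hH _ _ _ (ih n w hw)) ?_
        rw [coreIdeal_eq hN] at hxI
        exact (single_mem_bandIdeal_iff hJ hH x).2 hxI.2
  ext z
  obtain ⟨a, rfl⟩ := toKJ_surjective z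
  constructor
  · intro h
    have h1 := key m n a h
    rw [coreIdeal_eq hN]
    exact h1
  · rintro ⟨b, hb, hba⟩
    rw [← hba]
    exact mem_of_entries_mem hN b hb

theorem coreIdeal_mem_lat (hJ : ∀ m n, J.carrier m n ≤ K.tensPreimage m n)
    {NJ : (KJ K J).Ideal} (hN : NJ.IsInvariant) (hNs : NJ.IsSaturated ⊤) :
    coreIdeal NJ ∈ Lat J K :=
  ⟨_, isInvariant_invariantHull K _, isSaturated_invariantHull hJ hN hNs, coreIdeal_eq hN⟩

/-- The isomorphism `I ↦ N_J[I]`. -/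
theorem exists_bandIdeal_orderIso (hJ : ∀ m n, J.carrier m n ≤ K.tensPreimage m n)
    (hd : IsDecomposable K J) : ∃ e : Lat J K ≃o Lat (⊤ : (KJ K J).Ideal) ⊤,
      ∀ (I : Lat J K) (m n : ℕ),
        ((e I).1.carrier m n : Set ((KJ K J).Hom m n)) = bandIdeal K J I.1 m n := by
  have h1 : ∀ I : Lat J K, ∃ NJ : Lat (⊤ : (KJ K J).Ideal) ⊤, ∀ m n : ℕ,
      (NJ.1.carrier m n : Set ((KJ K J).Hom m n)) = bandIdeal K J I.1 m n := by
    rintro ⟨_, N, hN, hNJ, rfl⟩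
    exact ⟨⟨bandIdealOf hJ hN, mem_lat_top_iff.2
      ⟨isInvariant_bandIdealOf hJ hN, isSaturated_bandIdealOf hJ hN hNJ⟩⟩, fun m n => rfl⟩
  choose f hf using h1
  have hle : ∀ I I' : Lat J K, f I ≤ f I' ↔ I ≤ I' := by
    rintro ⟨_, N, hN, hNJ, rfl⟩ ⟨_, N', hN', hNJ', rfl⟩
    have hM : K ⊓ N ∈ Lat J K := ⟨N, hN, hNJ, rfl⟩
    have hM' : K ⊓ N' ∈ Lat J K := ⟨N', hN', hNJ', rfl⟩
    constructor
    · intro h m n a ha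
      have h2 : toKJ K J (Band.single K J ⟨a, ha.1⟩) ∈ bandIdeal K J (K ⊓ N) m n :=
        (single_mem_bandIdeal_iff hJ hN ⟨a, ha.1⟩).2 ha.2
      rw [← hf ⟨K ⊓ N, hM⟩] at h2
      have h3 : _ ∈ ((f ⟨K ⊓ N', hM'⟩).1.carrier m n : Set ((KJ K J).Hom m n)) := h m n h2
      rw [hf] at h3
      exact ⟨ha.1, (single_mem_bandIdeal_iff hJ hN' ⟨a, ha.1⟩).1 h3⟩
    · intro h m n x hx
      have h2 : x ∈ ((f ⟨K ⊓ N, hM⟩).1.carrier m n : Set ((KJ K J).Hom m n)) := hx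
      rw [hf] at h2
      obtain ⟨a, ha, rfl⟩ := h2
      have h3 : toKJ K J a ∈ bandIdeal K J (K ⊓ N') m n := ⟨a, fun i j => h i j (ha i j), rfl⟩
      rw [← hf ⟨K ⊓ N', hM'⟩] at h3
      exact h3
  have hsurj : Function.Surjective f := by
    rintro ⟨NJ, hNJ⟩
    obtain ⟨hN, hNs⟩ := mem_lat_top_iff.1 hNJ
    refine ⟨⟨coreIdeal NJ, coreIdeal_mem_lat hJ hN hNs⟩, Subtype.ext ?_⟩
    ext m n x
    have h2 := hf ⟨coreIdeal NJ, coreIdeal_mem_lat hJ hN hNs⟩ m n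
    rw [← carrier_eq_bandIdeal hJ hd hN hNs] at h2
    exact Set.ext_iff.1 h2 x
  exact ⟨RelIso.ofSurjective (OrderEmbedding.ofMapLEIff f hle) hsurj, hf⟩

end CStarPrecategory

/-! ### The second lattice isomorphism -/

namespace CStarPrecategory

variable {T : CStarPrecategory.{u}}

variable {K J : T.Ideal}
variable {K J : T.Ideal}

theorem bandToO_eq_of_toKJ_eq (hJ : ∀ m n, J.carrier m n ≤ K.tensPreimage m n) {m n : ℕ}
    {a b : Band K J m n} (h : toKJ K J a = toKJ K J b) : bandToO K J a = bandToO K J b := by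
  rw [← sub_eq_zero, ← bandToO_sub]
  exact bandToO_eq_zero_of_norm_eq_zero hJ (toKJ_eq_iff.1 h)

theorem gauge_bandToO (z : Circle) {m n : ℕ} (a : Band K J m n) :
    gauge K J z (bandToO K J a) = ((z : ℂ) ^ ((m : ℤ) - n)) • bandToO K J a := by
  simp only [bandToO, map_sum, gauge_univRep, Finset.smul_sum]
  refine Finset.sum_congr rfl fun i _ => Finset.sum_congr rfl fun j _ => ?_
  by_cases h : i + n = j + m
  · have : (i : ℤ) - j = (m : ℤ) - n := by omega
    rw [this]
  · rw [univRep_eq_zero (a.2.2 i j fun h' => h h'.1), smul_zero, smul_zero]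

theorem exists_bandToO_mul {m n l r : ℕ} (a : Band K J m n) (b : Band K J l r) :
    ∃ (p q : ℕ) (c : Band K J p q), bandToO K J c = bandToO K J a * bandToO K J b ∧
      ∀ NJ : (KJ K J).Ideal, NJ.IsInvariant →
        toKJ K J a ∈ NJ.carrier m n ∨ toKJ K J b ∈ NJ.carrier l r → toKJ K J c ∈ NJ.carrier p q := by
  rcases le_total m r with h | h
  · obtain ⟨d, rfl⟩ := Nat.exists_eq_add_of_le h
    refine ⟨_, _, Band.mul (a.inclPow d) b, by rw [bandToO_mul, bandToO_inclPow], fun NJ hN h => ?_⟩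
    rcases h with h | h
    · exact NJ.comp_mem_right (toKJ K J b) (Band.inclPow_mem hN h d)
    · exact NJ.comp_mem_left (toKJ K J (a.inclPow d)) h
  · obtain ⟨d, rfl⟩ := Nat.exists_eq_add_of_le h
    refine ⟨_, _, Band.mul a (b.inclPow d), by rw [bandToO_mul, bandToO_inclPow], fun NJ hN h => ?_⟩
    rcases h with h | h
    · exact NJ.comp_mem_right (toKJ K J (b.inclPow d)) h
    · exact NJ.comp_mem_left (toKJ K J a) (Band.inclPow_mem hN h d)

/-- The closed linear span of the elements of `O_T(K, J)` that come from an ideal in `K_J`. -/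
def gaugeIdeal (NJ : (KJ K J).Ideal) : Submodule ℂ (O K J) :=
  (Submodule.span ℂ {x : O K J | ∃ (m n : ℕ) (a : Band K J m n),
    toKJ K J a ∈ NJ.carrier m n ∧ bandToO K J a = x}).topologicalClosure

theorem isClosed_gaugeIdeal (NJ : (KJ K J).Ideal) : IsClosed (gaugeIdeal NJ : Set (O K J)) :=
  Submodule.isClosed_topologicalClosure _

theorem bandToO_mem_gaugeIdeal {NJ : (KJ K J).Ideal} {m n : ℕ} {a : Band K J m n}
    (ha : toKJ K J a ∈ NJ.carrier m n) : bandToO K J a ∈ gaugeIdeal NJ :=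
  Submodule.le_topologicalClosure _ (Submodule.subset_span ⟨m, n, a, ha, rfl⟩)

theorem gaugeIdeal_le {NJ : (KJ K J).Ideal} {Q : Submodule ℂ (O K J)}
    (hQ : IsClosed (Q : Set (O K J)))
    (h : ∀ (m n : ℕ) (a : Band K J m n), toKJ K J a ∈ NJ.carrier m n → bandToO K J a ∈ Q) :
    gaugeIdeal NJ ≤ Q := by
  refine Submodule.topologicalClosure_minimal _ (Submodule.span_le.2 ?_) hQ
  rintro _ ⟨m, n, a, ha, rfl⟩
  exact h m n a ha

theorem gaugeIdeal_mem_gaugeLat {NJ : (KJ K J).Ideal} (hN : NJ.IsInvariant) :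
    gaugeIdeal NJ ∈ gaugeLat K J := by
  refine ⟨⟨isClosed_gaugeIdeal NJ, ?_⟩, fun z p hp => ?_⟩
  · have hleft : ∀ (m n : ℕ) (c : K.carrier m n), gaugeIdeal NJ ≤
        (gaugeIdeal NJ).comap (LinearMap.mulLeft ℂ ((univRep K J).toFun m n c)) := by
      intro m n c
      refine gaugeIdeal_le ((isClosed_gaugeIdeal NJ).preimage (continuous_const.mul continuous_id))
        fun l r a ha => ?_
      obtain ⟨p, q, b, hb, hbN⟩ := exists_bandToO_mul (Band.single K J c) a
      change (univRep K J).toFun m n c * bandToO K J a ∈ gaugeIdeal NJ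
      rw [← bandToO_single, ← hb]
      exact bandToO_mem_gaugeIdeal (hbN NJ hN (Or.inr ha))
    have hright : ∀ (m n : ℕ) (c : K.carrier m n), gaugeIdeal NJ ≤
        (gaugeIdeal NJ).comap (LinearMap.mulRight ℂ ((univRep K J).toFun m n c)) := by
      intro m n c
      refine gaugeIdeal_le ((isClosed_gaugeIdeal NJ).preimage (continuous_id.mul continuous_const))
        fun l r a ha => ?_
      obtain ⟨p, q, b, hb, hbN⟩ := exists_bandToO_mul a (Band.single K J c)
      change bandToO K J a * (univRep K J).toFun m n c ∈ gaugeIdeal NJ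
      rw [← bandToO_single, ← hb]
      exact bandToO_mem_gaugeIdeal (hbN NJ hN (Or.inl ha))
    intro x p hp
    constructor
    · refine eq_top_of_univRep_mem (Q := (gaugeIdeal NJ).comap (LinearMap.mulRight ℂ p))
        ((isClosed_gaugeIdeal NJ).preimage (continuous_id.mul continuous_const))
        (fun m n c => hleft m n c hp) x
    · refine eq_top_of_univRep_mem (Q := (gaugeIdeal NJ).comap (LinearMap.mulLeft ℂ p))
        ((isClosed_gaugeIdeal NJ).preimage (continuous_const.mul continuous_id))
        (fun m n c => hright m n c hp) x
  · have h : gaugeIdeal NJ ≤ (gaugeIdeal NJ).comap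
        ((gauge K J z : O K J →⋆ₙₐ[ℂ] O K J) : O K J →ₗ[ℂ] O K J) := by
      refine gaugeIdeal_le ((isClosed_gaugeIdeal NJ).preimage (continuous_starAlgHom (gauge K J z)))
        fun m n a ha => ?_
      change gauge K J z (bandToO K J a) ∈ gaugeIdeal NJ
      rw [gauge_bandToO]
      exact Submodule.smul_mem _ _ (bandToO_mem_gaugeIdeal ha)
    exact h hp

/-- The ideal of all classes of matrices that are mapped into `P`. -/
def bandPreimage (hJ : ∀ m n, J.carrier m n ≤ K.tensPreimage m n) {P : Submodule ℂ (O K J)}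
    (hP : IsClosedIdeal P) : (KJ K J).Ideal where
  carrier m n :=
    { carrier := {x | ∃ a : Band K J m n, bandToO K J a ∈ P ∧ toKJ K J a = x}
      add_mem' := by
        rintro _ _ ⟨a, ha, rfl⟩ ⟨b, hb, rfl⟩
        exact ⟨a + b, by rw [bandToO_add]; exact add_mem ha hb, rfl⟩
      zero_mem' := ⟨0, by
        have e : bandToO K J (0 : Band K J m n) = 0 := map_zero (bandToOₗ K J m n)
        rw [e]
        exact zero_mem _, rfl⟩
      smul_mem' := by
        rintro c _ ⟨a, ha, rfl⟩
        exact ⟨c • a, by rw [bandToO_smul]; exact P.smul_mem c ha, rfl⟩ }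
  isClosed m n := by
    have hc : Continuous (bandToOₗ K J m n) :=
      AddMonoidHomClass.continuous_of_bound (bandToOₗ K J m n) 1 fun a => by
        rw [one_mul]
        exact norm_bandToO_le hJ a
    refine SeparationQuotient.isQuotientMap_mk.isClosed_preimage.1 ?_
    convert! hP.1.preimage hc using 1
    ext a
    constructor
    · rintro ⟨b, hb, hba⟩
      change bandToO K J a ∈ P
      rwa [← bandToO_eq_of_toKJ_eq hJ hba]
    · exact fun h => ⟨a, h, rfl⟩
  comp_mem_left {l m n} a b hb := by
    obtain ⟨a, rfl⟩ := toKJ_surjective a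
    obtain ⟨b, hb, rfl⟩ := hb
    exact ⟨Band.mul a b, by rw [bandToO_mul]; exact (hP.2 _ _ hb).1, rfl⟩
  comp_mem_right {l m n} a b ha := by
    obtain ⟨b, rfl⟩ := toKJ_surjective b
    obtain ⟨a, ha, rfl⟩ := ha
    exact ⟨Band.mul a b, by rw [bandToO_mul]; exact (hP.2 _ _ ha).2, rfl⟩

theorem mem_bandPreimage_iff (hJ : ∀ m n, J.carrier m n ≤ K.tensPreimage m n)
    {P : Submodule ℂ (O K J)} (hP : IsClosedIdeal P) {m n : ℕ} (a : Band K J m n) :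
    toKJ K J a ∈ (bandPreimage hJ hP).carrier m n ↔ bandToO K J a ∈ P := by
  constructor
  · rintro ⟨b, hb, hba⟩
    rwa [← bandToO_eq_of_toKJ_eq hJ hba]
  · exact fun h => ⟨a, h, rfl⟩

theorem isInvariant_bandPreimage (hJ : ∀ m n, J.carrier m n ≤ K.tensPreimage m n)
    {P : Submodule ℂ (O K J)} (hP : IsClosedIdeal P) : (bandPreimage hJ hP).IsInvariant := by
  intro m n x hx
  obtain ⟨a, ha, rfl⟩ := hx
  rw [tens_toKJ, mem_bandPreimage_iff, bandToO_incl]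
  exact ha

theorem isSaturated_bandPreimage (hJ : ∀ m n, J.carrier m n ≤ K.tensPreimage m n)
    {P : Submodule ℂ (O K J)} (hP : IsClosedIdeal P) : (bandPreimage hJ hP).IsSaturated ⊤ := by
  intro m n x _ hx
  obtain ⟨a, rfl⟩ := toKJ_surjective x
  rw [tens_toKJ, mem_bandPreimage_iff, bandToO_incl] at hx
  rwa [mem_bandPreimage_iff]

/-- The nontrivial inclusion is the approximation of a gauge-invariant ideal by matrices. -/
theorem gaugeIdeal_bandPreimage (hJ : ∀ m n, J.carrier m n ≤ K.tensPreimage m n)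
    {P : Submodule ℂ (O K J)} (hP : P ∈ gaugeLat K J) : gaugeIdeal (bandPreimage hJ hP.1) = P := by
  refine le_antisymm (gaugeIdeal_le hP.1.1 fun m n a ha => (mem_bandPreimage_iff hJ hP.1 a).1 ha)
    fun p hp => ?_
  exact mem_of_gaugeInvariant hP (isClosed_gaugeIdeal _)
    (fun m n a ha => bandToO_mem_gaugeIdeal ((mem_bandPreimage_iff hJ hP.1 a).2 ha)) hp

theorem bandToO_mem_of_entries {Q : Submodule ℂ (O K J)} {I : T.Ideal}
    (hQ : ∀ m n (a : K.carrier m n), (a : T.Hom m n) ∈ I.carrier m n →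
      (univRep K J).toFun m n a ∈ Q) {m n : ℕ} {a : Band K J m n}
    (ha : ∀ i j, a.1 i j ∈ I.carrier i j) : bandToO K J a ∈ Q :=
  Submodule.sum_mem _ fun i _ => Submodule.sum_mem _ fun j _ => hQ i j _ (ha i j)

theorem bandToO_mem_of_mem_bandIdeal (hJ : ∀ m n, J.carrier m n ≤ K.tensPreimage m n)
    {Q : Submodule ℂ (O K J)} {I : T.Ideal}
    (hQ : ∀ m n (a : K.carrier m n), (a : T.Hom m n) ∈ I.carrier m n →
      (univRep K J).toFun m n a ∈ Q) {m n : ℕ} {a : Band K J m n}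
    (ha : toKJ K J a ∈ bandIdeal K J I m n) : bandToO K J a ∈ Q := by
  obtain ⟨b, hb, hba⟩ := ha
  rw [← bandToO_eq_of_toKJ_eq hJ hba]
  exact bandToO_mem_of_entries hQ hb

/-- An element that comes from a matrix is in the ideal generated by `K ∩ N` only if its class is in
`N_J[K ∩ N]`. -/
theorem toKJ_mem_of_bandToO_mem (hJ : ∀ m n, J.carrier m n ≤ K.tensPreimage m n) {N : T.Ideal}
    (hN : N.IsInvariant) (hNJ : N.IsSaturated J) {m n : ℕ} {a : Band K J m n}
    (ha : ∀ P : Submodule ℂ (O K J), IsClosed (P : Set (O K J)) →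
      (∀ (l r : ℕ) (b : Band K J l r), toKJ K J b ∈ bandIdeal K J (K ⊓ N) l r → bandToO K J b ∈ P) →
      bandToO K J a ∈ P) : toKJ K J a ∈ bandIdeal K J (K ⊓ N) m n := by
  rw [toKJ_mem_bandIdeal_iff hJ hN]
  by_contra h
  obtain ⟨ρ, hρ, hρa⟩ := exists_coisometricRep hN hNJ a h
  refine hρa ?_
  -- The kernel of the separating representation contains the images of all matrices with class in
  -- `N_J[K ∩ N]`, since that representation kills `N`.
  refine ha (LinearMap.ker ((integrate K J ρ : O K J →⋆ₙₐ[ℂ] ρ.B) : O K J →ₗ[ℂ] ρ.B))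
    (isClosed_singleton.preimage (continuous_starAlgHom (integrate K J ρ))) fun l r b hb => ?_
  refine bandToO_mem_of_mem_bandIdeal hJ (fun i j c hc => ?_) hb
  exact (integrate_univRep K J ρ c).trans (hρ i j c hc.2)

/-- Taking the closed span adds no new classes. The ideal is `N_J[K ∩ N]` for the hull `N` of its
core, and the representations killing `N` detect everything outside it. -/
theorem bandToO_mem_gaugeIdeal_iff (hJ : ∀ m n, J.carrier m n ≤ K.tensPreimage m n)
    (hd : IsDecomposable K J) {NJ : (KJ K J).Ideal} (hN : NJ.IsInvariant)
    (hNs : NJ.IsSaturated ⊤) {m n : ℕ} (a : Band K J m n) :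
    bandToO K J a ∈ gaugeIdeal NJ ↔ toKJ K J a ∈ NJ.carrier m n := by
  refine ⟨fun h => ?_, bandToO_mem_gaugeIdeal⟩
  have hc := carrier_eq_bandIdeal hJ hd hN hNs
  rw [coreIdeal_eq hN] at hc
  rw [← SetLike.mem_coe, hc]
  refine toKJ_mem_of_bandToO_mem hJ (isInvariant_invariantHull K _)
    (isSaturated_invariantHull hJ hN hNs) fun P hP hPb => ?_
  refine gaugeIdeal_le hP (fun l r b hb => hPb l r b ?_) h
  rw [← hc]
  exact hb

/-- The isomorphism between the lattice of saturated invariant ideals in `K_J` and the lattice of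
gauge-invariant ideals in `O_T(K, J)`. -/
theorem exists_gaugeIdeal_orderIso (hJ : ∀ m n, J.carrier m n ≤ K.tensPreimage m n)
    (hd : IsDecomposable K J) :
    ∃ e : Lat (⊤ : (KJ K J).Ideal) ⊤ ≃o gaugeLat K J,
      (∀ NJ : Lat (⊤ : (KJ K J).Ideal) ⊤, (e NJ).1 = gaugeIdeal NJ.1) ∧
      ∀ (P : gaugeLat K J) (m n : ℕ) (a : Band K J m n),
        toKJ K J a ∈ (e.symm P).1.carrier m n ↔ bandToO K J a ∈ P.1 := by
  let f : Lat (⊤ : (KJ K J).Ideal) ⊤ → gaugeLat K J := fun NJ =>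
    ⟨gaugeIdeal NJ.1, gaugeIdeal_mem_gaugeLat (mem_lat_top_iff.1 NJ.2).1⟩
  have hf : ∀ (NJ : Lat (⊤ : (KJ K J).Ideal) ⊤) (m n : ℕ) (a : Band K J m n),
      bandToO K J a ∈ (f NJ).1 ↔ toKJ K J a ∈ NJ.1.carrier m n := fun NJ m n a =>
    bandToO_mem_gaugeIdeal_iff hJ hd (mem_lat_top_iff.1 NJ.2).1 (mem_lat_top_iff.1 NJ.2).2 a
  have hle : ∀ NJ NJ' : Lat (⊤ : (KJ K J).Ideal) ⊤, f NJ ≤ f NJ' ↔ NJ ≤ NJ' := by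
    intro NJ NJ'
    constructor
    · intro h m n x hx
      obtain ⟨a, rfl⟩ := toKJ_surjective x
      exact (hf NJ' m n a).1 (h ((hf NJ m n a).2 hx))
    · intro h
      exact gaugeIdeal_le (isClosed_gaugeIdeal _) fun m n a ha => bandToO_mem_gaugeIdeal (h m n ha)
  have hsurj : Function.Surjective f := fun P =>
    ⟨⟨bandPreimage hJ P.2.1, mem_lat_top_iff.2
      ⟨isInvariant_bandPreimage hJ P.2.1, isSaturated_bandPreimage hJ P.2.1⟩⟩,
      Subtype.ext (gaugeIdeal_bandPreimage hJ P.2)⟩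
  let e : Lat (⊤ : (KJ K J).Ideal) ⊤ ≃o gaugeLat K J :=
    RelIso.ofSurjective (OrderEmbedding.ofMapLEIff f hle) hsurj
  refine ⟨e, fun _ => rfl, fun P m n a => ?_⟩
  rw [← hf]
  change bandToO K J a ∈ (e (e.symm P)).1 ↔ _
  rw [e.apply_symm_apply]

end CStarPrecategory

/-! ### Gauge-invariant ideals as universal algebras -/

namespace CStarPrecategory

variable {T : CStarPrecategory.{u}}

variable {K J : T.Ideal}
variable {K J : T.Ideal}

variable (J) in
/-- The restriction of a representation of `K` to `K ∩ N`. -/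
abbrev CoisometricRep.restrict (N : T.Ideal) (ρ : CoisometricRep K J) :
    CoisometricRep (K ⊓ N) (J ⊓ N) where
  B := ρ.B
  rep :=
    { toFun := fun m n => ρ.rep.toFun m n ∘ₗ Submodule.inclusion inf_le_left
      map_adj := fun a => ρ.rep.map_adj ⟨a.1, a.2.1⟩
      map_comp := fun a b => ρ.rep.map_comp ⟨a.1, a.2.1⟩ ⟨b.1, b.2.1⟩
      map_tens := fun k a b => ρ.rep.map_tens k ⟨a.1, a.2.1⟩ ⟨b.1, b.2.1⟩ }
  coisometric := fun m n a ha ha' haJ => ρ.coisometric m n a ha.1 ha'.1 haJ.1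

variable (K J) in
/-- Composition of the coordinates with the restriction of representations. -/
def restrictProduct (N : T.Ideal) : RepProduct (K ⊓ N) (J ⊓ N) →⋆ₙₐ[ℂ] RepProduct K J where
  toFun x := ⟨fun ρ => x (ρ.restrict J N), memℓp_infty ⟨‖x‖, by
    rintro _ ⟨ρ, rfl⟩
    exact lp.norm_apply_le_norm ENNReal.top_ne_zero x (ρ.restrict J N)⟩⟩
  map_smul' _ _ := rfl
  map_zero' := rfl
  map_add' _ _ := rfl
  map_mul' _ _ := rfl
  map_star' _ := rfl

theorem restrictProduct_mem (N : T.Ideal) {x : RepProduct (K ⊓ N) (J ⊓ N)}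
    (hx : x ∈ algebraO (K ⊓ N) (J ⊓ N)) : restrictProduct K J N x ∈ algebraO K J := by
  have h2 := NonUnitalStarSubalgebra.map_topologicalClosure_le
    (NonUnitalStarAlgebra.adjoin ℂ {x | ∃ (m n : ℕ) (a : (K ⊓ N).carrier m n),
      x = (productRep (K ⊓ N) (J ⊓ N)).toFun m n a})
    (continuous_starAlgHom (restrictProduct K J N)) ⟨x, hx, rfl⟩
  refine NonUnitalStarSubalgebra.topologicalClosure_minimal _ ?_ (isClosed_algebraO K J) h2
  rw [NonUnitalStarAlgHom.map_adjoin, NonUnitalStarAlgebra.adjoin_le_iff]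
  rintro _ ⟨_, ⟨m, n, a, rfl⟩, rfl⟩
  exact productRep_mem K J ⟨a.1, a.2.1⟩

variable (K J) in
/-- The canonical map `O_T(K ∩ N, J ∩ N) → O_T(K, J)`. -/
def restrictHom (N : T.Ideal) : O (K ⊓ N) (J ⊓ N) →⋆ₙₐ[ℂ] O K J where
  toFun x := ⟨restrictProduct K J N x.1, restrictProduct_mem N x.2⟩
  map_smul' _ _ := rfl
  map_zero' := rfl
  map_add' _ _ := rfl
  map_mul' _ _ := rfl
  map_star' _ := rfl

theorem restrictHom_univRep (N : T.Ideal) {m n : ℕ} (a : (K ⊓ N).carrier m n) :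
    restrictHom K J N ((univRep (K ⊓ N) (J ⊓ N)).toFun m n a) =
      (univRep K J).toFun m n ⟨a.1, a.2.1⟩ := rfl

theorem restrictHom_gauge (N : T.Ideal) (z : Circle) (x : O (K ⊓ N) (J ⊓ N)) :
    restrictHom K J N (gauge (K ⊓ N) (J ⊓ N) z x) = gauge K J z (restrictHom K J N x) := rfl

theorem inf_le_tensPreimage (hJ : ∀ m n, J.carrier m n ≤ K.tensPreimage m n) {N : T.Ideal}
    (hN : N.IsInvariant) (m n : ℕ) : (J ⊓ N).carrier m n ≤ (K ⊓ N).tensPreimage m n :=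
  fun _ ha => ⟨⟨(hJ m n ha.1).1, hN _ _ _ ha.2⟩, (hJ m n ha.1).2, ha.2⟩

/-- Approximate units of `N` distribute over the sum: if `x = s + t`, then `x u = s u + t u` with `s
u` in `R ∩ N`. -/
theorem mem_sumIdeal_inf {R N N' : T.Ideal} {m n : ℕ} {x : T.Hom m n}
    (hx : x ∈ N.carrier m n) (hx' : x ∈ (sumIdeal R N').carrier m n) :
    x ∈ (sumIdeal (R ⊓ N) N').carrier m n := by
  refine mem_of_forall_comp_mem N hx ((sumIdeal (R ⊓ N) N').isClosed m n) fun u hu => ?_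
  obtain ⟨s, hs, t, ht, rfl⟩ := Submodule.mem_sup.1 hx'
  rw [map_add, LinearMap.add_apply]
  exact Submodule.add_mem_sup ⟨R.comp_mem_right u hs, N.comp_mem_left s hu⟩
    (N'.comp_mem_right u ht)

/-- A matrix with entries in `K ∩ N`, as a matrix with entries in `K`. -/
def Band.ofInf {N : T.Ideal} {m n : ℕ} (a : Band (K ⊓ N) (J ⊓ N) m n) : Band K J m n :=
  (⟨a.1, fun i j => (a.2.1 i j).1, a.2.2⟩ : band K m n)

theorem restrictHom_bandToO {N : T.Ideal} {m n : ℕ} (a : Band (K ⊓ N) (J ⊓ N) m n) :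
    restrictHom K J N (bandToO (K ⊓ N) (J ⊓ N) a) = bandToO K J (Band.ofInf a) := by
  simp only [bandToO, map_sum]
  rfl

/-- The linear map underlying a `*`-homomorphism. -/
def linearOfStarAlgHom {A B : Type*} [NonUnitalCStarAlgebra A] [NonUnitalCStarAlgebra B]
    (φ : A →⋆ₙₐ[ℂ] B) : A →ₗ[ℂ] B where
  toFun := φ
  map_add' := map_add φ
  map_smul' := map_smul φ

theorem isClosedIdeal_ker {A B : Type*} [NonUnitalCStarAlgebra A] [NonUnitalCStarAlgebra B]
    (φ : A →⋆ₙₐ[ℂ] B) : IsClosedIdeal (LinearMap.ker (linearOfStarAlgHom φ)) := by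
  refine ⟨isClosed_singleton.preimage (continuous_starAlgHom φ), fun x p hp => ?_⟩
  have hp' : φ p = 0 := hp
  constructor
  · change φ (x * p) = 0
    rw [map_mul, hp', mul_zero]
  · change φ (p * x) = 0
    rw [map_mul, hp', zero_mul]

theorem isClosedIdeal_bot {A : Type*} [NonUnitalCStarAlgebra A] :
    IsClosedIdeal (⊥ : Submodule ℂ A) := by
  refine ⟨isClosed_singleton, fun x p hp => ?_⟩
  obtain rfl := (Submodule.mem_bot ℂ).1 hp
  simp

/-- The kernel is gauge-invariant, so it suffices to test matrices. If `Ψ(a) = 0` in the larger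
algebra, the partial sums of `a` satisfy the criterion for `J` and `N'`. Being in `N`, they satisfy
it for `J ∩ N` and `N'`, and this forces `Ψ(a) = 0` in the smaller algebra. -/
theorem restrictHom_injective (hJ : ∀ m n, J.carrier m n ≤ K.tensPreimage m n) {N : T.Ideal}
    (hN : N.IsInvariant) : Function.Injective (restrictHom K J N) := by
  have hJ' := inf_le_tensPreimage hJ hN
  set K' := K ⊓ N
  set J' := J ⊓ N
  let NJ : (KJ K' J').Ideal := bandPreimage hJ' isClosedIdeal_bot
  have hNJ : NJ.IsInvariant := isInvariant_bandPreimage hJ' isClosedIdeal_bot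
  have hNJs : NJ.IsSaturated ⊤ := isSaturated_bandPreimage hJ' isClosedIdeal_bot
  -- The core of the null classes: `K' ∩ N'` consists of the arrows in `K'` that vanish in `O(K',
  -- J')`.
  let N' : T.Ideal := invariantHull K' (coreIdeal NJ)
  have hcore : coreIdeal NJ = K' ⊓ N' := coreIdeal_eq hNJ
  have hN' : N'.IsInvariant := isInvariant_invariantHull K' _
  have hN's : N'.IsSaturated J' := isSaturated_invariantHull hJ' hNJ hNJs
  -- Saturation improves from `J ∩ N` to `J` because the hull is tested against `c` in `K ∩ N` only,
  -- and then `a c` is in `J ∩ N` for `a` in `J`.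
  have hN'J : N'.IsSaturated J := by
    intro m n a ha hta l p q c hc
    rw [hcore]
    by_cases h : p = m ∧ q = n
    · obtain ⟨rfl, rfl⟩ := h
      rw [toeplitz_same]
      have h1 : T.comp a c ∈ J'.carrier l q := ⟨J.comp_mem_right c ha, N.comp_mem_left a hc.2⟩
      refine ⟨K'.comp_mem_left a hc, hN's _ _ _ h1 ?_⟩
      rw [T.tens_comp]
      exact N'.comp_mem_right _ hta
    · have h1 := toeplitz_eq_entry_add a p q
      rw [entry_of_ne _ h, zero_add] at h1
      rw [h1, ← hcore]
      exact hta l p q c hc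
  have hI : ∀ (m n : ℕ) (a : K'.carrier m n), (a : T.Hom m n) ∈ (K' ⊓ N').carrier m n →
      (univRep K' J').toFun m n a ∈ (⊥ : Submodule ℂ (O K' J')) := by
    intro m n a ha
    rw [← hcore] at ha
    obtain ⟨h, h'⟩ := ha
    rw [mem_bandPreimage_iff, bandToO_single] at h'
    exact h'
  have key : ∀ (m n : ℕ) (a : Band K' J' m n),
      restrictHom K J N (bandToO K' J' a) = 0 → bandToO K' J' a ∈ (⊥ : Submodule ℂ (O K' J')) := by
    intro m n a ha
    rw [restrictHom_bandToO] at ha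
    have h1 : toKJ K J (Band.ofInf a) ∈ bandIdeal K J (K ⊓ N') m n :=
      toKJ_mem_of_bandToO_mem hJ hN' hN'J fun P _ _ => by rw [ha]; exact zero_mem P
    rw [toKJ_mem_bandIdeal_iff hJ hN'] at h1
    have h2 : a.SumsMem N' :=
      ⟨fun i j hi hj => mem_sumIdeal_inf (partialSum_mem hN (fun i j => (a.2.1 i j).2) i j)
        (h1.1 i j hi hj), h1.2⟩
    exact bandToO_mem_of_mem_bandIdeal hJ' hI ((toKJ_mem_bandIdeal_iff hJ' hN' a).2 h2)
  rw [injective_iff_map_eq_zero]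
  intro x hx
  have hP : LinearMap.ker (linearOfStarAlgHom (restrictHom K J N)) ∈
      gaugeLat K' J' := by
    refine ⟨isClosedIdeal_ker _, fun z p hp => ?_⟩
    have hp' : restrictHom K J N p = 0 := hp
    change restrictHom K J N (gauge K' J' z p) = 0
    rw [restrictHom_gauge, hp', map_zero]
  exact mem_of_gaugeInvariant hP (Q := ⊥) isClosed_singleton key hx

/-- An injective `*`-homomorphism is isometric, so the range is closed. Minimality of `P` is
required among closed subspaces, since the range is not known in advance to be an ideal. -/
theorem range_restrictHom (hJ : ∀ m n, J.carrier m n ≤ K.tensPreimage m n) {N : T.Ideal}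
    (hN : N.IsInvariant) {P : Submodule ℂ (O K J)}
    (hP : IsLeast {Q : Submodule ℂ (O K J) | IsClosedIdeal Q ∧
      ∀ (m n : ℕ) (a : (K ⊓ N).carrier m n), (univRep K J).toFun m n ⟨a.1, a.2.1⟩ ∈ Q} P)
    (hP' : ∀ Q : Submodule ℂ (O K J), IsClosed (Q : Set (O K J)) →
      (∀ (m n : ℕ) (a : (K ⊓ N).carrier m n), (univRep K J).toFun m n ⟨a.1, a.2.1⟩ ∈ Q) → P ≤ Q) :
    Set.range (restrictHom K J N) = (P : Set (O K J)) := by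
  refine Set.Subset.antisymm ?_ ?_
  · rintro _ ⟨x, rfl⟩
    exact eq_top_of_univRep_mem (Q := P.comap (linearOfStarAlgHom (restrictHom K J N)))
      (hP.1.1.1.preimage (continuous_starAlgHom (restrictHom K J N)))
      (fun m n a => hP.1.2 m n a) x
  · have hcl : IsClosed (Set.range (restrictHom K J N)) :=
      (NonUnitalStarAlgHom.isometry (restrictHom K J N)
        (restrictHom_injective hJ hN)).isClosedEmbedding.isClosed_range
    exact hP' (LinearMap.range (linearOfStarAlgHom (restrictHom K J N))) hcl fun m n a => ⟨_, restrictHom_univRep N a⟩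

theorem exists_restrictHom_range_eq (hJ : ∀ m n, J.carrier m n ≤ K.tensPreimage m n)
    (hd : IsDecomposable K J) {P : Submodule ℂ (O K J)} (hP : P ∈ gaugeLat K J) :
    ∃ N : T.Ideal, N.IsInvariant ∧
      IsLeast {Q : Submodule ℂ (O K J) | IsClosedIdeal Q ∧
        ∀ (m n : ℕ) (a : (K ⊓ N).carrier m n),
          (univRep K J).toFun m n ⟨a.1, a.2.1⟩ ∈ Q} P ∧
      Set.range (restrictHom K J N) = (P : Set (O K J)) := by
  have hNJ := isInvariant_bandPreimage hJ hP.1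
  have hNJs := isSaturated_bandPreimage hJ hP.1
  set NJ := bandPreimage hJ hP.1
  have hcore := coreIdeal_eq hNJ
  have hle : ∀ Q : Submodule ℂ (O K J), IsClosed (Q : Set (O K J)) →
      (∀ (m n : ℕ) (a : (K ⊓ invariantHull K (coreIdeal NJ)).carrier m n),
        (univRep K J).toFun m n ⟨a.1, a.2.1⟩ ∈ Q) → P ≤ Q := by
    intro Q hQ h
    rw [← gaugeIdeal_bandPreimage hJ hP]
    refine gaugeIdeal_le hQ fun m n a ha => ?_
    have hc := carrier_eq_bandIdeal hJ hd hNJ hNJs m n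
    rw [← SetLike.mem_coe, hc, hcore] at ha
    exact bandToO_mem_of_mem_bandIdeal hJ (fun i j b hb => h i j ⟨b.1, hb⟩) ha
  have hleast : IsLeast {Q : Submodule ℂ (O K J) | IsClosedIdeal Q ∧
      ∀ (m n : ℕ) (a : (K ⊓ invariantHull K (coreIdeal NJ)).carrier m n),
        (univRep K J).toFun m n ⟨a.1, a.2.1⟩ ∈ Q} P := by
    refine ⟨⟨hP.1, fun m n a => ?_⟩, fun Q hQ => hle Q hQ.1.1 hQ.2⟩
    obtain ⟨h, h'⟩ := hcore.ge m n a.2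
    rwa [mem_bandPreimage_iff, bandToO_single] at h'
  have hN := isInvariant_invariantHull K (coreIdeal NJ)
  exact ⟨_, hN, hleast, range_restrictHom hJ hN hleast hle⟩

theorem isDecomposable (hJ : ∀ m n, J.carrier m n ≤ K.tensPreimage m n)
    (h : (∀ m n, K.carrier m n ≤ J.carrier m n ⊔ kerTens T.toPrecategory m n) ∨
      (K.AdmitsTransferAction ∧ ∀ m n, J.carrier m n =
        K.tensPreimage m n ⊓ annihilator (kerTens T.toPrecategory) m n)) : IsDecomposable K J :=
  h.elim (isDecomposable_of_le_sup hJ) fun h => isDecomposable_of_transfer hJ h.1 h.2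

end CStarPrecategory

end

end RightTensor

/-! ### The main theorem -/

theorem mainTheorem6 (T : CStarPrecategory.{u}) (K J : T.Ideal)
    (hJ : ∀ m n, J.carrier m n ≤ K.tensPreimage m n)
    (h : (∀ m n, K.carrier m n ≤ J.carrier m n ⊔ kerTens T.toPrecategory m n) ∨
      (K.AdmitsTransferAction ∧ ∀ m n, J.carrier m n =
        K.tensPreimage m n ⊓ annihilator (kerTens T.toPrecategory) m n)) :
    -- every ideal in `Lat_{K_J}(K_J)` is of the form `N_J[K ∩ N]`
    (∀ NJ ∈ Lat (⊤ : (KJ K J).Ideal) ⊤, ∃ I ∈ Lat J K,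
      ∀ m n, (NJ.carrier m n : Set ((KJ K J).Hom m n)) = bandIdeal K J I m n) ∧
    -- the lattice isomorphisms `Lat_J(K) ≅ Lat_{K_J}(K_J) ≅ Lat(O_T(K, J))`
    (∃ (e₁ : Lat J K ≃o Lat (⊤ : (KJ K J).Ideal) ⊤)
        (e₂ : Lat (⊤ : (KJ K J).Ideal) ⊤ ≃o gaugeLat K J),
      (∀ (I : Lat J K) (m n : ℕ),
        ((e₁ I).1.carrier m n : Set ((KJ K J).Hom m n)) = bandIdeal K J I.1 m n) ∧
      (∀ NJ : Lat (⊤ : (KJ K J).Ideal) ⊤,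
        (e₂ NJ).1 = (Submodule.span ℂ {x : O K J | ∃ (m n : ℕ) (a : Band K J m n),
          toKJ K J a ∈ NJ.1.carrier m n ∧ bandToO K J a = x}).topologicalClosure) ∧
      (∀ (P : gaugeLat K J) (m n : ℕ) (a : Band K J m n),
        toKJ K J a ∈ (e₂.symm P).1.carrier m n ↔ bandToO K J a ∈ P.1)) ∧
    -- gauge-invariant ideals are generated by some `K ∩ N` and isomorphic to `O_T(K ∩ N, J ∩ N)`
    (∀ P ∈ gaugeLat K J, ∃ N : T.Ideal, N.IsInvariant ∧
      IsLeast {Q : Submodule ℂ (O K J) | IsClosedIdeal Q ∧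
        ∀ (m n : ℕ) (a : (K ⊓ N).carrier m n),
          (univRep K J).toFun m n ⟨a.1, a.2.1⟩ ∈ Q} P ∧
      ∃ φ : O (K ⊓ N) (J ⊓ N) →⋆ₙₐ[ℂ] O K J, Function.Injective φ ∧
        Set.range φ = (P : Set (O K J)) ∧
        ∀ (m n : ℕ) (a : (K ⊓ N).carrier m n),
          φ ((univRep (K ⊓ N) (J ⊓ N)).toFun m n a) =
            (univRep K J).toFun m n ⟨a.1, a.2.1⟩) := by
  have hd := isDecomposable hJ h
  refine ⟨fun NJ hNJ => ?_, ?_, fun P hP => ?_⟩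
  · obtain ⟨hN, hNs⟩ := mem_lat_top_iff.1 hNJ
    exact ⟨coreIdeal NJ, coreIdeal_mem_lat hJ hN hNs, carrier_eq_bandIdeal hJ hd hN hNs⟩
  · obtain ⟨e₁, he₁⟩ := exists_bandIdeal_orderIso hJ hd
    obtain ⟨e₂, he₂, he₂'⟩ := exists_gaugeIdeal_orderIso hJ hd
    exact ⟨e₁, e₂, he₁, he₂, he₂'⟩
  · obtain ⟨N, hN, hP', hr⟩ := exists_restrictHom_range_eq hJ hd hP
    exact ⟨N, hN, hP', restrictHom K J N, restrictHom_injective hJ hN, hr, fun m n a => rfl⟩
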